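/- **Setting.** Nets are indexed by $\varepsilon\in(0,1]$, and $O(\cdot)$ refers to $\varepsilon\to0$. For a complex vector space $E$ with seminorms $(p_i)_{i\in I}$ let $\mathcal M_E$ be the set of nets in $E$ such that for every $i$ there is $N$ with $p_i(u_\varepsilon)=O(\varepsilon^{-N})$, let $\mathcal N_E$ be the set of nets such that $p_i(u_\varepsilon)=O(\varepsilon^{q})$ for all $i$ and all $q\in\mathbb N$, and put $\mathcal G_E=\mathcal M_E/\mathcal N_E$, with the topology of the ultra-pseudo-seminorms $\mathcal P_i(u)=e^{-\mathrm v_i(u)}$, $\mathrm v_i(u)=\sup\{b\in\mathbb R: p_i(u_\varepsilon)=O(\varepsilon^b)\}$. Write $\widetilde{\mathbb C}=\mathcal G_{\mathbb C}$ (a ring, with ultra-pseudo-norm $|\cdot|_e$), $\mathcal G(\mathbb R^n)=\mathcal G_{C^\infty(\mathbb R^n)}$ with $p_{K,i}(f)=\sup_{x\in K,|\alpha|\le i}|\partial^\alpha f(x)|$ ($K$ compact, $i\in\mathbb N$), and $\mathcal G_{\mathscr S}(\mathbb R^n)=\mathcal G_{\mathscr S(\mathbb R^n)}$ with $p_h(f)=\sup_{x\in\mathbb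 R^n,|\alpha|\le h}(1+|x|)^h|\partial^\alpha f(x)|$. $\mathcal G_c(\mathbb R^n)\subseteq\mathcal G(\mathbb R^n)$ consists of the classes that have a representative whose members are supported in one common compact set; it carries the locally convex ($\widetilde{\mathbb C}$-linear) inductive limit topology of the spaces $\mathcal G_K(\mathbb R^n)=\{u\in\mathcal G_c(\mathbb R^n):\operatorname{supp}u\subseteq K\}$, where $\mathcal G_K(\mathbb R^n)$ has the ultra-pseudo-seminorms $\mathcal P_{K',i}$, $i\in\mathbb N$, with $K'$ any compact neighbourhood of $K$. $\mathcal G_\tau(\mathbb R^n)$ is the space of tempered generalized functions: nets of smooth functions with polynomially bounded derivatives such that for every $\alpha$ there is $N$ with $\sup_x(1+|x|)^{-N}|\partial^\alpha u_\varepsilon(x)|=O(\varepsilon^{-N})$, modulo the nets such that for every $\alpha$ there is $N$ with $\sup_x(1+|x|)^{-N}|\partial^\alpha u_\varepsilon(x)|=O(\varepsilon^{q})$ for all $q\in\mathbb N$. For $\mathcal G\in\{\mathcal G_c(\mathbb R^n),\mathcal G(\mathbb R^n),\mathcal G_{\mathscr S}(\mathbb R^n)\}$ let $\mathcal L(\mathcal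 G,\widetilde{\mathbb C})$ be the space of continuous $\widetilde{\mathbb C}$-linear functionals, with the topology of uniform convergence on bounded subsets of $\mathcal G$ (sets on which every continuous ultra-pseudo-seminorm is bounded). A functional $T$ in it is *basic* if there is a net $(T_\varepsilon)_\varepsilon$ in $\mathcal D'(\mathbb R^n)$, $\mathcal E'(\mathbb R^n)$ or $\mathscr S'(\mathbb R^n)$, respectively, such that $Tu=[(T_\varepsilon u_\varepsilon)_\varepsilon]$ for all $u=[(u_\varepsilon)_\varepsilon]\in\mathcal G$ (with representatives supported in one compact set in the case of $\mathcal G_c$), and such that - for $\mathcal G_c(\mathbb R^n)$: for every compact $K$ there are $j,N\in\mathbb N$ and $\eta\in(0,1]$ with $|T_\varepsilon f|\le\varepsilon^{-N}p_{K,j}(f)$ for all $f\in C_c^\infty(\mathbb R^n)$ with $\operatorname{supp}f\subseteq K$ and all $\varepsilon\in(0,\eta]$; - for $\mathcal G(\mathbb R^n)$: there are a compact $K$, $j,N\in\mathbb N$ and $\eta\in(0,1]$ with $|T_\varepsilon f|\le\varepsilon^{-N}p_{K,j}(f)$ for all $f\in C^\infty(\mathbb R^n)$ and all $\varepsilon\in(0,\eta]$;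 - for $\mathcal G_{\mathscr S}(\mathbb R^n)$: there are $j,N\in\mathbb N$ and $\eta\in(0,1]$ with $|T_\varepsilon f|\le\varepsilon^{-N}p_j(f)$ for all $f\in\mathscr S(\mathbb R^n)$ and all $\varepsilon\in(0,\eta]$. For $u=[(u_\varepsilon)_\varepsilon]\in\mathcal G$ and $T$ basic, the convolution $u*T$ is the class of the net of functions $x\mapsto T_\varepsilon(u_\varepsilon(x-\cdot))$. **Theorem.** Let $\rho\in C_c^\infty(\mathbb R^n)$ with $\int_{\mathbb R^n}\rho(y)\,dy=1$, let $\rho_\delta(y)=\delta^{-n}\rho(y/\delta)$ for $\delta>0$, and consider the class $[(\rho_{\varepsilon^q})_\varepsilon]$ for $q\in\mathbb N$. 1. If $T\in\mathcal L(\mathcal G_c(\mathbb R^n),\widetilde{\mathbb C})$ is basic, then $T_q:=[(\rho_{\varepsilon^q})_\varepsilon]*T$ is a well-defined element of $\mathcal G(\mathbb R^n)$ for all $q\in\mathbb N$ (independent of the choice of the representing nets), and, as functionals $v\mapsto\int_{\mathbb R^n}T_q(x)v(x)\,dx$, $T_q\to T$ in $\mathcal L(\mathcal G_c(\mathbb R^n),\widetilde{\mathbb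 C})$ as $q\to\infty$. 2. If $T\in\mathcal L(\mathcal G(\mathbb R^n),\widetilde{\mathbb C})$ is basic, then $T_q:=[(\rho_{\varepsilon^q})_\varepsilon]*T$ is a well-defined element of $\mathcal G_c(\mathbb R^n)$ for all $q\in\mathbb N$, and, as functionals $v\mapsto\int_{\mathbb R^n}T_q(x)v(x)\,dx$, $T_q\to T$ in $\mathcal L(\mathcal G(\mathbb R^n),\widetilde{\mathbb C})$ as $q\to\infty$. 3. If $T\in\mathcal L(\mathcal G_{\mathscr S}(\mathbb R^n),\widetilde{\mathbb C})$ is basic, then $T_q:=[(\rho_{\varepsilon^q})_\varepsilon]*T$ is a well-defined element of $\mathcal G_\tau(\mathbb R^n)$ for all $q\in\mathbb N$, and, as functionals $v\mapsto\int_{\mathbb R^n}T_q(x)v(x)\,dx$, $T_q\to T$ in $\mathcal L(\mathcal G_{\mathscr S}(\mathbb R^n),\widetilde{\mathbb C})$ as $q\to\infty$. -/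

import Mathlib

open Filter Topology MeasureTheory
open scoped Distributions SchwartzMap

noncomputable section

namespace Colombeau

/-! ### Nets indexed by `ε ∈ (0,1]` -/

/-- The index set `(0,1]`. -/
abbrev Eps : Type := Set.Ioc (0 : ℝ) 1

/-- The filter `ε → 0` on `(0,1]`. -/
def toZero : Filter Eps := comap ((↑) : Eps → ℝ) (𝓝 0)

/-- `f ε = O(ε^(-N))` as `ε → 0` for some `N`. -/
def ModerateNet (f : Eps → ℝ) : Prop :=
  ∃ N : ℕ, f =O[toZero] fun ε => ((ε : ℝ) ^ N)⁻¹

/-- `f ε = O(ε^q)` as `ε → 0` for all `q`. -/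
def NegligibleNet (f : Eps → ℝ) : Prop :=
  ∀ q : ℕ, f =O[toZero] fun ε => (ε : ℝ) ^ q

/-- The exponents `b ∈ ℝ` with `f ε = O(ε^b)` as `ε → 0`. -/
def orderSet (f : Eps → ℝ) : Set ℝ := {b | f =O[toZero] fun ε => (ε : ℝ) ^ b}

/-- The valuation `sup {b ∈ ℝ : f ε = O(ε^b)}`. -/
def netVal (f : Eps → ℝ) : EReal := sSup (((↑) : ℝ → EReal) '' orderSet f)

/-- `e ^ (- val f)`, with `e ^ (-∞) = 0`. It is finite for moderate nets. -/
def expNegVal (f : Eps → ℝ) : ℝ := (EReal.exp (-netVal f)).toReal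

theorem isBigO_inv_pow_mono {M N : ℕ} (h : M ≤ N) :
    (fun ε : Eps => ((ε : ℝ) ^ M)⁻¹) =O[toZero] fun ε : Eps => ((ε : ℝ) ^ N)⁻¹ := by
  refine Asymptotics.IsBigO.of_norm_le fun ε => ?_
  have h0 := ε.2.1
  have h1 := ε.2.2
  rw [Real.norm_of_nonneg (by positivity), ]
  exact inv_anti₀ (by positivity) (pow_le_pow_of_le_one h0.le h1 h)

theorem ModerateNet.mono {f g : Eps → ℝ} (hg : ModerateNet g) (h : ∀ ε, |f ε| ≤ g ε) :
    ModerateNet f := by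
  obtain ⟨N, hN⟩ := hg
  exact ⟨N, (Asymptotics.IsBigO.of_norm_le fun ε => by simpa using h ε).trans hN⟩

theorem ModerateNet.add {f g : Eps → ℝ} (hf : ModerateNet f) (hg : ModerateNet g) :
    ModerateNet fun ε => f ε + g ε := by
  obtain ⟨N, hN⟩ := hf
  obtain ⟨M, hM⟩ := hg
  exact ⟨max N M, (hN.trans (isBigO_inv_pow_mono (le_max_left _ _))).add
    (hM.trans (isBigO_inv_pow_mono (le_max_right _ _)))⟩

theorem ModerateNet.mul {f g : Eps → ℝ} (hf : ModerateNet f) (hg : ModerateNet g) :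
    ModerateNet fun ε => f ε * g ε := by
  obtain ⟨N, hN⟩ := hf
  obtain ⟨M, hM⟩ := hg
  refine ⟨N + M, (hN.mul hM).congr_right fun ε => ?_⟩
  rw [pow_add, mul_inv]

theorem ModerateNet.const (c : ℝ) : ModerateNet fun _ => c :=
  ⟨0, by simpa using Asymptotics.isBigO_const_const c (one_ne_zero (α := ℝ)) toZero⟩

theorem NegligibleNet.mono {f g : Eps → ℝ} (hg : NegligibleNet g) (h : ∀ ε, |f ε| ≤ g ε) :
    NegligibleNet f := fun q =>
  (Asymptotics.IsBigO.of_norm_le fun ε => by simpa using h ε).trans (hg q)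

theorem NegligibleNet.zero : NegligibleNet fun _ => (0 : ℝ) := fun _ => Asymptotics.isBigO_zero _ _

theorem NegligibleNet.add {f g : Eps → ℝ} (hf : NegligibleNet f) (hg : NegligibleNet g) :
    NegligibleNet fun ε => f ε + g ε := fun q => (hf q).add (hg q)

theorem ModerateNet.mul_negligible {f g : Eps → ℝ} (hf : ModerateNet f) (hg : NegligibleNet g) :
    NegligibleNet fun ε => f ε * g ε := by
  obtain ⟨N, hN⟩ := hf
  intro q
  refine (hN.mul (hg (N + q))).congr_right fun ε => ?_
  have h0 := ε.2.1
  rw [pow_add]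
  field_simp

theorem ModerateNet.orderSet_nonempty {f : Eps → ℝ} (hf : ModerateNet f) :
    (orderSet f).Nonempty := by
  obtain ⟨N, hN⟩ := hf
  refine ⟨-(N : ℝ), hN.congr_right fun ε => ?_⟩
  rw [Real.rpow_neg ε.2.1.le, Real.rpow_natCast]

theorem NegligibleNet.mem_orderSet {f : Eps → ℝ} (hf : NegligibleNet f) (b : ℝ) :
    b ∈ orderSet f := by
  obtain ⟨q, hq⟩ := exists_nat_ge b
  refine (hf q).trans (Asymptotics.IsBigO.of_norm_le fun ε => ?_)
  have h0 := ε.2.1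
  rw [Real.norm_of_nonneg (by positivity), ← Real.rpow_natCast]
  exact Real.rpow_le_rpow_of_exponent_ge h0 ε.2.2 hq

theorem orderSet_anti {f g : Eps → ℝ} (h : ∀ ε, |f ε| ≤ g ε) : orderSet g ⊆ orderSet f :=
  fun _ hb => (Asymptotics.IsBigO.of_norm_le fun ε => by simpa using h ε).trans hb

theorem mem_orderSet_of_le {f : Eps → ℝ} {b c : ℝ} (hb : b ∈ orderSet f) (h : c ≤ b) :
    c ∈ orderSet f := by
  refine Asymptotics.IsBigO.trans hb (Asymptotics.IsBigO.of_norm_le fun ε => ?_)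
  have h0 := ε.2.1
  rw [Real.norm_of_nonneg (by positivity)]
  exact Real.rpow_le_rpow_of_exponent_ge h0 ε.2.2 h

theorem min_netVal_le {f g : Eps → ℝ} :
    min (netVal f) (netVal g) ≤ netVal fun ε => f ε + g ε := by
  refine le_of_forall_lt fun c hc => ?_
  obtain ⟨h1, h2⟩ := lt_min_iff.1 hc
  obtain ⟨_, ⟨a, ha, rfl⟩, hca⟩ := lt_sSup_iff.1 h1
  obtain ⟨_, ⟨b, hb, rfl⟩, hcb⟩ := lt_sSup_iff.1 h2
  have hmem : min a b ∈ orderSet fun ε => f ε + g ε :=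
    Asymptotics.IsBigO.add (mem_orderSet_of_le ha (min_le_left _ _))
      (mem_orderSet_of_le hb (min_le_right _ _))
  refine lt_of_lt_of_le ?_ (le_sSup (Set.mem_image_of_mem _ hmem))
  rcases min_choice a b with h | h <;> rw [h] <;> assumption

theorem netVal_ne_bot {f : Eps → ℝ} (hf : ModerateNet f) : netVal f ≠ ⊥ := by
  obtain ⟨b, hb⟩ := hf.orderSet_nonempty
  exact ((EReal.bot_lt_coe b).trans_le (le_sSup (Set.mem_image_of_mem _ hb))).ne'

theorem expNegVal_nonneg (f : Eps → ℝ) : 0 ≤ expNegVal f := ENNReal.toReal_nonneg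

theorem expNegVal_le_max {f g h : Eps → ℝ} (hg : ModerateNet g) (hh : ModerateNet h)
    (hle : ∀ ε, |f ε| ≤ g ε + h ε) : expNegVal f ≤ max (expNegVal g) (expNegVal h) := by
  have key : min (netVal g) (netVal h) ≤ netVal f :=
    min_netVal_le.trans (sSup_le_sSup (Set.image_mono (orderSet_anti hle)))
  have fin : ∀ {k : Eps → ℝ}, ModerateNet k → EReal.exp (-netVal k) ≠ ⊤ := fun hk => by
    simpa using netVal_ne_bot hk
  rcases min_le_iff.1 key with h1 | h1
  · exact le_max_of_le_left (ENNReal.toReal_mono (fin hg)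
      (EReal.exp_monotone (EReal.neg_le_neg_iff.2 h1)))
  · exact le_max_of_le_right (ENNReal.toReal_mono (fin hh)
      (EReal.exp_monotone (EReal.neg_le_neg_iff.2 h1)))

theorem expNegVal_congr {f g d : Eps → ℝ} (hd : NegligibleNet d)
    (h1 : ∀ ε, |f ε| ≤ g ε + d ε) (h2 : ∀ ε, |g ε| ≤ f ε + d ε) : expNegVal f = expNegVal g := by
  have : orderSet f = orderSet g := by
    refine Set.Subset.antisymm (fun b hb => ?_) (fun b hb => ?_)
    · exact orderSet_anti h2 (Asymptotics.IsBigO.add hb (hd.mem_orderSet b))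
    · exact orderSet_anti h1 (Asymptotics.IsBigO.add hb (hd.mem_orderSet b))
  rw [expNegVal, expNegVal, netVal, netVal, this]

theorem expNegVal_zero : expNegVal (fun _ => 0) = 0 := by
  have : netVal (fun _ => 0) = ⊤ := by
    rw [netVal, sSup_eq_top]
    intro b hb
    obtain ⟨c, hc, -⟩ := EReal.lt_iff_exists_real_btwn.1 hb
    exact ⟨_, ⟨c, NegligibleNet.zero.mem_orderSet c, rfl⟩, hc⟩
  simp [expNegVal, this]

/-! ### The ring of complex generalized numbers -/

/-- Moderate nets of complex numbers. -/
def moderateC : Subring (Eps → ℂ) where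
  carrier := {a | ModerateNet fun ε => ‖a ε‖}
  zero_mem' := by simpa using ModerateNet.const 0
  one_mem' := by simpa using ModerateNet.const 1
  add_mem' {a b} ha hb := (ModerateNet.add ha hb).mono fun ε => by
    simpa using norm_add_le (a ε) (b ε)
  mul_mem' {a b} ha hb := (ModerateNet.mul ha hb).mono fun ε => by simp
  neg_mem' {a} ha := by simpa using ha

/-- Negligible nets of complex numbers. -/
def negligibleC : Ideal moderateC where
  carrier := {a | NegligibleNet fun ε => ‖(a : Eps → ℂ) ε‖}
  zero_mem' := by simpa using NegligibleNet.zero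
  add_mem' {a b} ha hb := (NegligibleNet.add ha hb).mono fun ε => by
    simpa using norm_add_le ((a : Eps → ℂ) ε) ((b : Eps → ℂ) ε)
  smul_mem' c a ha := (ModerateNet.mul_negligible c.2 ha).mono fun ε => by simp

/-- The ring of complex generalized numbers. -/
def CTilde : Type := moderateC ⧸ negligibleC

instance : CommRing CTilde := inferInstanceAs (CommRing (moderateC ⧸ negligibleC))

/-- The class of a moderate net of complex numbers. -/
def CTilde.mk : moderateC →+* CTilde := Ideal.Quotient.mk negligibleC

/-- `z = [(a ε)_ε]`; this includes that the net `a` is moderate. -/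
def CTilde.Represents (a : Eps → ℂ) (z : CTilde) : Prop :=
  ∃ h : a ∈ moderateC, CTilde.mk ⟨a, h⟩ = z

/-- The ultra-pseudo-norm `|z|_e = e ^ (- val z)`. -/
def absE (z : CTilde) : ℝ :=
  Quotient.liftOn' z (fun a => expNegVal fun ε => ‖(a : Eps → ℂ) ε‖) fun a b hab => by
    have hd : NegligibleNet fun ε => ‖(a : Eps → ℂ) ε - (b : Eps → ℂ) ε‖ :=
      (Submodule.quotientRel_def negligibleC).1 hab
    refine expNegVal_congr hd (fun ε => ?_) (fun ε => ?_)
    · simpa using norm_le_insert' ((a : Eps → ℂ) ε) ((b : Eps → ℂ) ε)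
    · simpa using norm_le_insert ((a : Eps → ℂ) ε) ((b : Eps → ℂ) ε)

theorem CTilde.mk_surjective : Function.Surjective CTilde.mk := Ideal.Quotient.mk_surjective

theorem absE_mk (a : moderateC) : absE (CTilde.mk a) = expNegVal fun ε => ‖(a : Eps → ℂ) ε‖ := rfl

theorem absE_zero : absE 0 = 0 := by
  rw [← map_zero CTilde.mk, absE_mk]
  simpa using expNegVal_zero

theorem absE_neg (z : CTilde) : absE (-z) = absE z := by
  obtain ⟨a, rfl⟩ := CTilde.mk_surjective z
  rw [← map_neg, absE_mk, absE_mk]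
  simp

theorem absE_nonneg (z : CTilde) : 0 ≤ absE z := by
  obtain ⟨a, rfl⟩ := CTilde.mk_surjective z
  exact expNegVal_nonneg _

theorem absE_add_le (z w : CTilde) : absE (z + w) ≤ max (absE z) (absE w) := by
  obtain ⟨a, rfl⟩ := CTilde.mk_surjective z
  obtain ⟨b, rfl⟩ := CTilde.mk_surjective w
  rw [← map_add, absE_mk, absE_mk, absE_mk]
  exact expNegVal_le_max a.2 b.2 fun ε => by
    simpa using norm_add_le ((a : Eps → ℂ) ε) ((b : Eps → ℂ) ε)

/-- The sharp topology and uniformity of the generalized numbers, given by `|z - w|_e`. -/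
instance : PseudoMetricSpace CTilde where
  dist z w := absE (z - w)
  dist_self z := by rw [sub_self, absE_zero]
  dist_comm z w := by rw [← absE_neg, neg_sub]
  dist_triangle x y z := by
    have h := absE_add_le (x - y) (y - z)
    rw [sub_add_sub_cancel] at h
    exact h.trans (max_le_add_of_nonneg (absE_nonneg _) (absE_nonneg _))

/-! ### The `C̃`-modules based on a locally convex space, and their sharp topology -/

section GE

variable {E ι : Type} [AddCommGroup E] [Module ℂ E]

/-- Moderate nets in a space `E` with seminorms `p i`. -/
def moderate (p : ι → Seminorm ℂ E) : Submodule moderateC (Eps → E) where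
  carrier := {u | ∀ i, ModerateNet fun ε => p i (u ε)}
  zero_mem' i := by simpa using ModerateNet.const 0
  add_mem' {u v} hu hv i := (ModerateNet.add (hu i) (hv i)).mono fun ε => by
    simpa [abs_of_nonneg (apply_nonneg _ _)] using map_add_le_add (p i) (u ε) (v ε)
  smul_mem' c u hu i := (ModerateNet.mul c.2 (hu i)).mono fun ε => by
    rw [abs_of_nonneg (apply_nonneg _ _), ← map_smul_eq_mul]
    exact le_rfl

/-- Negligible nets in a space `E` with seminorms `p i`. -/
def negligible (p : ι → Seminorm ℂ E) : Submodule moderateC (moderate p) where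
  carrier := {u | ∀ i, NegligibleNet fun ε => p i ((u : Eps → E) ε)}
  zero_mem' i := by simpa using NegligibleNet.zero
  add_mem' {u v} hu hv i := (NegligibleNet.add (hu i) (hv i)).mono fun ε => by
    simpa [abs_of_nonneg (apply_nonneg _ _)] using
      map_add_le_add (p i) ((u : Eps → E) ε) ((v : Eps → E) ε)
  smul_mem' c u hu i := (ModerateNet.mul_negligible c.2 (hu i)).mono fun ε => by
    rw [abs_of_nonneg (apply_nonneg _ _), ← map_smul_eq_mul]
    exact le_rfl

/-- The space of generalized functions based on `(E, p)`: moderate modulo negligible nets. -/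
def GE (p : ι → Seminorm ℂ E) : Type := moderate p ⧸ negligible p

variable {p : ι → Seminorm ℂ E}

instance : AddCommGroup (GE p) := inferInstanceAs (AddCommGroup (moderate p ⧸ negligible p))

instance : Module moderateC (GE p) :=
  inferInstanceAs (Module moderateC (moderate p ⧸ negligible p))

/-- The class of a moderate net. -/
def GE.mk : moderate p →ₗ[moderateC] GE p := (negligible p).mkQ

theorem GE.mk_surjective : Function.Surjective (GE.mk (p := p)) := (negligible p).mkQ_surjective

theorem GE.isTorsionBySet : Module.IsTorsionBySet moderateC (GE p) negligibleC := by
  intro x a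
  obtain ⟨u, rfl⟩ := GE.mk_surjective x
  rw [← map_smul]
  refine (Submodule.Quotient.mk_eq_zero (negligible p)).2 fun i => ?_
  obtain ⟨M, hM⟩ := u.2 i
  intro q
  refine ((a.2 (M + q)).mul hM).congr (fun ε => ?_) (fun ε => ?_)
  · exact (map_smul_eq_mul (p i) _ _).symm
  · have h0 := ε.2.1
    rw [pow_add]
    field_simp

/-- The module structure over the generalized numbers: `[(c ε)] • [(u ε)] = [(c ε • u ε)]`. -/
instance : Module CTilde (GE p) := Module.IsTorsionBySet.module GE.isTorsionBySet

/-- `x = [(u ε)_ε]`; this includes that the net `u` is moderate. -/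
def GE.Represents (u : Eps → E) (x : GE p) : Prop :=
  ∃ h : u ∈ moderate p, GE.mk ⟨u, h⟩ = x

/-- The ultra-pseudo-seminorm `e ^ (- val_{p i} x)`. -/
def GE.ups (i : ι) (x : GE p) : ℝ :=
  Quotient.liftOn' x (fun u => expNegVal fun ε => p i ((u : Eps → E) ε)) fun u v huv => by
    have hd : NegligibleNet fun ε => p i ((u : Eps → E) ε - (v : Eps → E) ε) :=
      (Submodule.quotientRel_def (negligible p)).1 huv i
    refine expNegVal_congr hd (fun ε => ?_) (fun ε => ?_)
    · rw [abs_of_nonneg (apply_nonneg _ _)]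
      simpa using map_add_le_add (p i) ((v : Eps → E) ε) ((u : Eps → E) ε - (v : Eps → E) ε)
    · rw [abs_of_nonneg (apply_nonneg _ _), map_sub_rev]
      simpa using map_add_le_add (p i) ((u : Eps → E) ε) ((v : Eps → E) ε - (u : Eps → E) ε)

end GE

/-- The topology determined by a family of ultra-pseudo-seminorms. -/
abbrev upsTopology {M κ : Type} [AddCommGroup M] (P : κ → M → ℝ) : TopologicalSpace M :=
  TopologicalSpace.generateFrom
    {V | ∃ (k : κ) (x : M) (r : ℝ), 0 < r ∧ V = {y | P k (y - x) < r}}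

/-- Boundedness with respect to a family of ultra-pseudo-seminorms. -/
def UpsBounded {M κ : Type} (P : κ → M → ℝ) (B : Set M) : Prop :=
  ∀ k, BddAbove (P k '' B)

instance {E ι : Type} [AddCommGroup E] [Module ℂ E] {p : ι → Seminorm ℂ E} :
    TopologicalSpace (GE p) :=
  upsTopology (GE.ups (p := p))

/-- Ultra-pseudo-seminorms on a `C̃`-module. -/
structure UltraPseudoSeminorm (M : Type) [AddCommGroup M] [Module CTilde M] where
  /-- The underlying function. -/
  toFun : M → ℝ
  nonneg : ∀ u, 0 ≤ toFun u
  map_zero : toFun 0 = 0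
  smul_le : ∀ (c : CTilde) (u : M), toFun (c • u) ≤ absE c * toFun u
  add_le : ∀ u v : M, toFun (u + v) ≤ max (toFun u) (toFun v)

/-- The topology of uniform convergence on bounded subsets on the dual of a `C̃`-module `M` whose
bounded sets are those of the family `P`. -/
abbrev strongTopology {M κ : Type} [AddCommGroup M] [Module CTilde M] [TopologicalSpace M]
    (P : κ → M → ℝ) : TopologicalSpace (M →L[CTilde] CTilde) :=
  TopologicalSpace.induced
    (fun T => UniformOnFun.ofFun {B : Set M | UpsBounded P B} (T : M → CTilde)) inferInstance

/-- Nets of continuous linear functionals `T ε` on `(E, p)` with the continuity property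
`|T ε u| ≤ ε^(-N) max_{i ∈ s} p i u`, uniformly for small `ε`. -/
def ModerateFunctionalNet {E ι : Type} [AddCommGroup E] [Module ℂ E] (p : ι → Seminorm ℂ E)
    (T : Eps → E →ₗ[ℂ] ℂ) : Prop :=
  (∀ ε, ∃ (s : Finset ι) (C : ℝ), ∀ u, ‖T ε u‖ ≤ C * s.sup p u) ∧
  ∃ (s : Finset ι) (N : ℕ) (η : Eps), ∀ u, ∀ ε : Eps, ε ≤ η →
    ‖T ε u‖ ≤ ((ε : ℝ) ^ N)⁻¹ * s.sup p u

/-- The functional `T` is given by the net `(T' ε)`: `T [(u ε)] = [(T' ε (u ε))]`. -/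
def GE.DefinedBy {E ι : Type} [AddCommGroup E] [Module ℂ E] {p : ι → Seminorm ℂ E}
    (T : GE p →L[CTilde] CTilde) (T' : Eps → E →ₗ[ℂ] ℂ) : Prop :=
  ModerateFunctionalNet p T' ∧ ∀ (x : GE p) (u : Eps → E), GE.Represents u x →
    CTilde.Represents (fun ε => T' ε (u ε)) (T x)

/-- Basic functionals on the space of generalized functions based on `(E, p)`. -/
def GE.IsBasic {E ι : Type} [AddCommGroup E] [Module ℂ E] {p : ι → Seminorm ℂ E}
    (T : GE p →L[CTilde] CTilde) : Prop :=
  ∃ T' : Eps → E →ₗ[ℂ] ℂ, GE.DefinedBy T T'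

/-! ### The algebra `G(ℝⁿ)` -/

/-- `ℝⁿ`. -/
abbrev Rn (n : ℕ) : Type := EuclideanSpace ℝ (Fin n)

/-- The space of smooth complex-valued functions on `ℝⁿ`. -/
def Smooth (n : ℕ) : Submodule ℂ (Rn n → ℂ) where
  carrier := {f | ContDiff ℝ ((⊤ : ℕ∞) : WithTop ℕ∞) f}
  zero_mem' := (contDiff_const : ContDiff ℝ ((⊤ : ℕ∞) : WithTop ℕ∞) fun _ : Rn n => (0 : ℂ))
  add_mem' {f g} hf hg := by
    have hf : ContDiff ℝ ((⊤ : ℕ∞) : WithTop ℕ∞) f := hf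
    have hg : ContDiff ℝ ((⊤ : ℕ∞) : WithTop ℕ∞) g := hg
    exact hf.add hg
  smul_mem' c f hf := by
    have hf : ContDiff ℝ ((⊤ : ℕ∞) : WithTop ℕ∞) f := hf
    exact hf.const_smul c

/-- The values `‖D^m f x‖`, `x ∈ K`, `m ≤ i`. -/
def derivSet {n : ℕ} (K : Set (Rn n)) (i : ℕ) (f : Rn n → ℂ) : Set ℝ :=
  {r | ∃ x ∈ K, ∃ m ≤ i, r = ‖iteratedFDeriv ℝ m f x‖}

theorem derivSet_bddAbove {n : ℕ} {K : Set (Rn n)} (hK : IsCompact K) (i : ℕ) (f : Smooth n) :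
    BddAbove (derivSet K i (f : Rn n → ℂ)) := by
  have h : derivSet K i (f : Rn n → ℂ) =
      ⋃ m ∈ Set.Iic i, (fun x => ‖iteratedFDeriv ℝ m (f : Rn n → ℂ) x‖) '' K := by
    ext r
    simp only [derivSet, Set.mem_ofPred_eq, Set.mem_iUnion, Set.mem_image, Set.mem_Iic]
    constructor
    · rintro ⟨x, hx, m, hm, rfl⟩
      exact ⟨m, hm, x, hx, rfl⟩
    · rintro ⟨m, hm, x, hx, rfl⟩
      exact ⟨x, hx, m, hm, rfl⟩
  rw [h]
  refine (Set.finite_Iic i).bddAbove_biUnion.2 fun m _ => ?_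
  have hf : ContDiff ℝ ((⊤ : ℕ∞) : WithTop ℕ∞) (f : Rn n → ℂ) := f.2
  exact (hK.image (hf.continuous_iteratedFDeriv (by exact_mod_cast le_top)).norm).bddAbove

theorem derivSet_sSup_nonneg {n : ℕ} (K : Set (Rn n)) (i : ℕ) (f : Rn n → ℂ) :
    0 ≤ sSup (derivSet K i f) := by
  refine Real.sSup_nonneg ?_
  rintro _ ⟨x, -, m, -, rfl⟩
  exact norm_nonneg _

/-- The seminorm `p_{K,i}(f) = sup {‖D^m f x‖ : x ∈ K, m ≤ i}`, where `D^m f x` is the `m`-th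
Fréchet derivative. It is equivalent to the supremum of all `|∂^α f x|`, `x ∈ K`, `|α| ≤ i`, with
constants that depend only on `i` and `n`; hence it has the same valuations. -/
def smoothSeminorm (n : ℕ) (Ki : TopologicalSpace.Compacts (Rn n) × ℕ) :
    Seminorm ℂ (Smooth n) :=
  Seminorm.ofSMulLE (fun f => sSup (derivSet (Ki.1 : Set (Rn n)) Ki.2 (f : Rn n → ℂ)))
    (by
      refine le_antisymm (Real.sSup_le ?_ le_rfl) (derivSet_sSup_nonneg _ _ _)
      rintro _ ⟨x, -, m, -, rfl⟩
      have h : ((0 : Smooth n) : Rn n → ℂ) = fun _ => 0 := rfl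
      rw [h, iteratedFDeriv_fun_zero]
      simp)
    (fun f g => by
      refine Real.sSup_le ?_ (add_nonneg (derivSet_sSup_nonneg _ _ _) (derivSet_sSup_nonneg _ _ _))
      rintro _ ⟨x, hx, m, hm, rfl⟩
      have hf : ContDiff ℝ ((⊤ : ℕ∞) : WithTop ℕ∞) (f : Rn n → ℂ) := f.2
      have hg : ContDiff ℝ ((⊤ : ℕ∞) : WithTop ℕ∞) (g : Rn n → ℂ) := g.2
      have hm' : ((m : ℕ∞) : WithTop ℕ∞) ≤ ((⊤ : ℕ∞) : WithTop ℕ∞) := by exact_mod_cast le_top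
      have h := iteratedFDeriv_add_apply (x := x) (hf.of_le hm').contDiffAt
        (hg.of_le hm').contDiffAt
      have h' : ((f + g : Smooth n) : Rn n → ℂ) = (f : Rn n → ℂ) + (g : Rn n → ℂ) := rfl
      rw [h']
      refine (congrArg norm h).le.trans ((norm_add_le _ _).trans (add_le_add ?_ ?_))
      · exact le_csSup (derivSet_bddAbove Ki.1.isCompact _ f) ⟨x, hx, m, hm, rfl⟩
      · exact le_csSup (derivSet_bddAbove Ki.1.isCompact _ g) ⟨x, hx, m, hm, rfl⟩)
    (fun c f => by
      refine Real.sSup_le ?_ (mul_nonneg (norm_nonneg _) (derivSet_sSup_nonneg _ _ _))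
      rintro _ ⟨x, hx, m, hm, rfl⟩
      have hf : ContDiff ℝ ((⊤ : ℕ∞) : WithTop ℕ∞) (f : Rn n → ℂ) := f.2
      have hm' : ((m : ℕ∞) : WithTop ℕ∞) ≤ ((⊤ : ℕ∞) : WithTop ℕ∞) := by exact_mod_cast le_top
      have h := iteratedFDeriv_const_smul_apply (x := x) (a := c) (hf.of_le hm').contDiffAt
      have h' : ((c • f : Smooth n) : Rn n → ℂ) = c • (f : Rn n → ℂ) := rfl
      rw [h']
      refine (congrArg norm h).le.trans ?_
      rw [norm_smul]
      exact mul_le_mul_of_nonneg_left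
        (le_csSup (derivSet_bddAbove Ki.1.isCompact _ f) ⟨x, hx, m, hm, rfl⟩) (norm_nonneg _))

/-- The Colombeau algebra `G(ℝⁿ)`. -/
abbrev G (n : ℕ) : Type := GE (smoothSeminorm n)

/-- The generalized function `u` vanishes on the open set `V`, i.e. `u|_V = 0` in `G(V)`. -/
def VanishesOn {n : ℕ} (u : G n) (V : Set (Rn n)) : Prop :=
  ∀ f : Eps → Smooth n, GE.Represents f u →
    ∀ (K : TopologicalSpace.Compacts (Rn n)) (i : ℕ), (K : Set (Rn n)) ⊆ V →
      NegligibleNet fun ε => smoothSeminorm n (K, i) (f ε)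

/-- The support of a generalized function: the complement of the largest open set on which it
vanishes. -/
def supp {n : ℕ} (u : G n) : Set (Rn n) :=
  {x | ∀ V : Set (Rn n), IsOpen V → x ∈ V → ¬ VanishesOn u V}

/-! ### The algebra `G_c(ℝⁿ)` -/

/-- The space of test functions on `ℝⁿ`. -/
abbrev Test (n : ℕ) : Type := 𝓓((⊤ : TopologicalSpace.Opens (Rn n)), ℂ)

/-- A test function as a smooth function. -/
def Test.toSmooth {n : ℕ} (f : Test n) : Smooth n := ⟨f, f.contDiff⟩

/-- The net `f` of test functions has its supports in one compact set, is moderate, and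
represents `u`. -/
def RepresentsCompact {n : ℕ} (f : Eps → Test n) (u : G n) : Prop :=
  (∃ K : Set (Rn n), IsCompact K ∧ ∀ ε, tsupport (f ε) ⊆ K) ∧
    GE.Represents (fun ε => (f ε).toSmooth) u

section

variable {E ι : Type} [AddCommGroup E] [Module ℂ E] {p : ι → Seminorm ℂ E}

theorem GE.Represents.zero : GE.Represents (p := p) (0 : Eps → E) 0 :=
  ⟨(moderate p).zero_mem, map_zero GE.mk⟩

theorem GE.Represents.add {f g : Eps → E} {u v : GE p} (hf : GE.Represents f u)
    (hg : GE.Represents g v) : GE.Represents (f + g) (u + v) := by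
  obtain ⟨hf, rfl⟩ := hf
  obtain ⟨hg, rfl⟩ := hg
  exact ⟨(moderate p).add_mem hf hg, map_add GE.mk ⟨f, hf⟩ ⟨g, hg⟩⟩

theorem GE.Represents.smul (a : moderateC) {f : Eps → E} {u : GE p} (hf : GE.Represents f u) :
    GE.Represents (fun ε => (a : Eps → ℂ) ε • f ε) (CTilde.mk a • u) := by
  obtain ⟨hf, rfl⟩ := hf
  exact ⟨(moderate p).smul_mem a hf, map_smul GE.mk a ⟨f, hf⟩⟩

end

theorem RepresentsCompact.zero {n : ℕ} : RepresentsCompact (fun _ => 0) (0 : G n) := by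
  refine ⟨⟨∅, isCompact_empty, fun ε => ?_⟩, ?_⟩
  · exact (tsupport_eq_empty_iff.2 rfl).subset
  · have h : (fun _ : Eps => (0 : Test n).toSmooth) = 0 := rfl
    rw [h]
    exact GE.Represents.zero

theorem RepresentsCompact.add {n : ℕ} {f g : Eps → Test n} {u v : G n}
    (hf : RepresentsCompact f u) (hg : RepresentsCompact g v) :
    RepresentsCompact (fun ε => f ε + g ε) (u + v) := by
  obtain ⟨⟨K, hK, hfK⟩, hf⟩ := hf
  obtain ⟨⟨L, hL, hgL⟩, hg⟩ := hg
  refine ⟨⟨K ∪ L, hK.union hL, fun ε => ?_⟩, ?_⟩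
  · exact (tsupport_add (f ε) (g ε)).trans (Set.union_subset_union (hfK ε) (hgL ε))
  · have h : (fun ε => (f ε + g ε).toSmooth) =
        (fun ε => (f ε).toSmooth) + fun ε => (g ε).toSmooth := rfl
    rw [h]
    exact hf.add hg

theorem RepresentsCompact.smul {n : ℕ} (a : moderateC) {f : Eps → Test n} {u : G n}
    (hf : RepresentsCompact f u) :
    RepresentsCompact (fun ε => (a : Eps → ℂ) ε • f ε) (CTilde.mk a • u) := by
  obtain ⟨⟨K, hK, hfK⟩, hf⟩ := hf
  refine ⟨⟨K, hK, fun ε => ?_⟩, ?_⟩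
  · exact (tsupport_smul_subset_right (fun _ => (a : Eps → ℂ) ε) (f ε)).trans (hfK ε)
  · have h : (fun ε => ((a : Eps → ℂ) ε • f ε).toSmooth) =
        fun ε => (a : Eps → ℂ) ε • (f ε).toSmooth := rfl
    rw [h]
    exact hf.smul a

/-- The generalized functions with compact support, as a submodule of `G(ℝⁿ)`: the classes of
moderate nets of test functions with supports in a common compact set. -/
def GcSubmodule (n : ℕ) : Submodule CTilde (G n) where
  carrier := {u | ∃ f : Eps → Test n, RepresentsCompact f u}
  zero_mem' := ⟨_, RepresentsCompact.zero⟩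
  add_mem' := fun ⟨_, hf⟩ ⟨_, hg⟩ => ⟨_, hf.add hg⟩
  smul_mem' := fun c _ ⟨_, hf⟩ => by
    obtain ⟨a, rfl⟩ := CTilde.mk_surjective c
    exact ⟨_, hf.smul a⟩

/-- The Colombeau algebra `G_c(ℝⁿ)` of generalized functions with compact support. It does not
carry the subspace topology of `G(ℝⁿ)`. -/
def Gc (n : ℕ) : Type := GcSubmodule n

instance (n : ℕ) : AddCommGroup (Gc n) := inferInstanceAs (AddCommGroup (GcSubmodule n))

instance (n : ℕ) : Module CTilde (Gc n) := inferInstanceAs (Module CTilde (GcSubmodule n))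

/-- The inclusion of `G_c(ℝⁿ)` in `G(ℝⁿ)`. -/
def Gc.toG {n : ℕ} : Gc n →ₗ[CTilde] G n := (GcSubmodule n).subtype

/-- A compact neighbourhood of a compact set. -/
def nhd {n : ℕ} (K : TopologicalSpace.Compacts (Rn n)) : TopologicalSpace.Compacts (Rn n) :=
  ⟨Metric.cthickening 1 (K : Set (Rn n)), K.isCompact.cthickening⟩

/-- The ultra-pseudo-seminorms on `G_c(ℝⁿ)` whose restriction to each
`G_K(ℝⁿ) = {u ∈ G_c(ℝⁿ) : supp u ⊆ K}` is continuous, where `G_K(ℝⁿ)` has the topology of the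
ultra-pseudo-seminorms `e ^ (- val_{p_{K',i}} u)`, `i ∈ ℕ`, for a compact neighbourhood `K'` of
`K`; they do not depend on `K'`. -/
def GcSeminorms (n : ℕ) : Type :=
  {Q : UltraPseudoSeminorm (Gc n) // ∀ K : TopologicalSpace.Compacts (Rn n),
    ∃ (i : ℕ) (C : ℝ), ∀ u : Gc n, supp (Gc.toG u) ⊆ K →
      Q.toFun u ≤ C * GE.ups (nhd K, i) (Gc.toG u)}

/-- The family of ultra-pseudo-seminorms that determines the topology of `G_c(ℝⁿ)`. -/
def Gc.ups {n : ℕ} (Q : GcSeminorms n) (u : Gc n) : ℝ := Q.1.toFun u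

/-- The locally convex inductive limit topology of the spaces `G_K(ℝⁿ)`. -/
instance (n : ℕ) : TopologicalSpace (Gc n) := upsTopology (Gc.ups (n := n))

/-- The functional `T` on `G_c(ℝⁿ)` is given by the net of distributions `(T' ε)`, which has the
continuity property of a basic functional: `T [(f ε)] = [(T' ε (f ε))]`. -/
def Gc.DefinedBy {n : ℕ} (T : Gc n →L[CTilde] CTilde) (T' : Eps → Test n →L[ℂ] ℂ) : Prop :=
  (∀ K : TopologicalSpace.Compacts (Rn n), ∃ (j N : ℕ) (η : Eps),
    ∀ f : Test n, tsupport f ⊆ (K : Set (Rn n)) → ∀ ε : Eps, ε ≤ η →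
      ‖T' ε f‖ ≤ ((ε : ℝ) ^ N)⁻¹ * smoothSeminorm n (K, j) f.toSmooth) ∧
  ∀ (u : Gc n) (f : Eps → Test n), RepresentsCompact f (Gc.toG u) →
    CTilde.Represents (fun ε => T' ε (f ε)) (T u)

/-- Basic functionals on `G_c(ℝⁿ)`. -/
def Gc.IsBasic {n : ℕ} (T : Gc n →L[CTilde] CTilde) : Prop :=
  ∃ T' : Eps → Test n →L[ℂ] ℂ, Gc.DefinedBy T T'

/-! ### The algebras based on `𝓢(ℝⁿ)` and of tempered generalized functions -/

/-- The seminorm `p_h(f) = max {sup_x ‖x‖^k ‖D^m f x‖ : k, m ≤ h}`. It is equivalent to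
`sup {(1 + |x|)^h |∂^α f x| : x ∈ ℝⁿ, |α| ≤ h}`, hence has the same valuations. -/
def schwartzSup (n h : ℕ) : Seminorm ℂ 𝓢(Rn n, ℂ) :=
  (Finset.Iic (h, h)).sup (schwartzSeminormFamily ℂ (Rn n) ℂ)

/-- The algebra of generalized functions based on `𝓢(ℝⁿ)`. -/
abbrev GS (n : ℕ) : Type := GE (schwartzSup n)

/-- `τ`-moderate nets of smooth functions all of whose derivatives have polynomial growth. -/
def moderateTau (n : ℕ) : AddSubgroup (Eps → Rn n → ℂ) where
  carrier := {u | (∀ ε, (u ε).HasTemperateGrowth) ∧ ∀ m : ℕ, ∃ (N : ℕ) (C : ℝ),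
    ∀ᶠ ε in toZero, ∀ x, ‖iteratedFDeriv ℝ m (u ε) x‖ ≤ C * (1 + ‖x‖) ^ N * ((ε : ℝ) ^ N)⁻¹}
  zero_mem' := by
    refine ⟨fun ε => Function.HasTemperateGrowth.zero, fun m => ⟨0, 0, ?_⟩⟩
    simp
  add_mem' := by
    rintro u v ⟨hu, hu'⟩ ⟨hv, hv'⟩
    refine ⟨fun ε => (hu ε).add (hv ε), fun m => ?_⟩
    obtain ⟨N, C, h⟩ := hu' m
    obtain ⟨M, D, h'⟩ := hv' m
    refine ⟨max N M, |C| + |D|, ?_⟩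
    filter_upwards [h, h'] with ε h h' x
    have hm : ((m : ℕ∞) : WithTop ℕ∞) ≤ ((⊤ : ℕ∞) : WithTop ℕ∞) := by exact_mod_cast le_top
    have e := iteratedFDeriv_add_apply (x := x) ((hu ε).1.of_le hm).contDiffAt
      ((hv ε).1.of_le hm).contDiffAt
    have key : ∀ (A : ℝ) (k : ℕ), k ≤ max N M → A * (1 + ‖x‖) ^ k * ((ε : ℝ) ^ k)⁻¹ ≤
        |A| * ((1 + ‖x‖) ^ max N M * ((ε : ℝ) ^ max N M)⁻¹) := by
      intro A k hk
      have h0 := ε.2.1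
      have h1 : (1 + ‖x‖) ^ k ≤ (1 + ‖x‖) ^ max N M :=
        pow_le_pow_right₀ (by linarith [norm_nonneg x]) hk
      have h2 : ((ε : ℝ) ^ k)⁻¹ ≤ ((ε : ℝ) ^ max N M)⁻¹ :=
        inv_anti₀ (by positivity) (pow_le_pow_of_le_one h0.le ε.2.2 hk)
      rw [mul_assoc]
      exact mul_le_mul (le_abs_self A) (mul_le_mul h1 h2 (by positivity) (by positivity))
        (by positivity) (abs_nonneg A)
    calc ‖iteratedFDeriv ℝ m ((u + v) ε) x‖
        ≤ ‖iteratedFDeriv ℝ m (u ε) x‖ + ‖iteratedFDeriv ℝ m (v ε) x‖ :=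
          (congrArg norm e).le.trans (norm_add_le _ _)
      _ ≤ _ := add_le_add ((h x).trans (key C N (le_max_left _ _)))
          ((h' x).trans (key D M (le_max_right _ _)))
      _ = _ := by ring
  neg_mem' := by
    rintro u ⟨hu, hu'⟩
    refine ⟨fun ε => (hu ε).neg, fun m => ?_⟩
    obtain ⟨N, C, h⟩ := hu' m
    refine ⟨N, C, ?_⟩
    filter_upwards [h] with ε h x
    rw [Pi.neg_apply, iteratedFDeriv_neg_apply, norm_neg]
    exact h x

/-- `τ`-negligible nets. -/
def negligibleTau (n : ℕ) : AddSubgroup (moderateTau n) where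
  carrier := {u | ∀ m : ℕ, ∃ N : ℕ, ∀ q : ℕ, ∃ C : ℝ, ∀ᶠ ε in toZero, ∀ x,
    ‖iteratedFDeriv ℝ m ((u : Eps → Rn n → ℂ) ε) x‖ ≤ C * (1 + ‖x‖) ^ N * (ε : ℝ) ^ q}
  zero_mem' := by
    refine fun m => ⟨0, fun q => ⟨0, Eventually.of_forall fun ε x => ?_⟩⟩
    simp
  add_mem' := by
    rintro u v hu hv m
    obtain ⟨N, hu'⟩ := hu m
    obtain ⟨M, hv'⟩ := hv m
    refine ⟨max N M, fun q => ?_⟩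
    obtain ⟨C, h⟩ := hu' q
    obtain ⟨D, h'⟩ := hv' q
    refine ⟨|C| + |D|, ?_⟩
    filter_upwards [h, h'] with ε h h' x
    have hm : ((m : ℕ∞) : WithTop ℕ∞) ≤ ((⊤ : ℕ∞) : WithTop ℕ∞) := by exact_mod_cast le_top
    have e := iteratedFDeriv_add_apply (x := x) ((u.2.1 ε).1.of_le hm).contDiffAt
      ((v.2.1 ε).1.of_le hm).contDiffAt
    have key : ∀ (A : ℝ) (k : ℕ), k ≤ max N M → A * (1 + ‖x‖) ^ k * (ε : ℝ) ^ q ≤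
        |A| * ((1 + ‖x‖) ^ max N M * (ε : ℝ) ^ q) := by
      intro A k hk
      have h0 := ε.2.1
      have h1 : (1 + ‖x‖) ^ k ≤ (1 + ‖x‖) ^ max N M :=
        pow_le_pow_right₀ (by linarith [norm_nonneg x]) hk
      rw [mul_assoc]
      exact mul_le_mul (le_abs_self A) (mul_le_mul_of_nonneg_right h1 (by positivity))
        (by positivity) (abs_nonneg A)
    calc ‖iteratedFDeriv ℝ m (((u + v : moderateTau n) : Eps → Rn n → ℂ) ε) x‖
        ≤ ‖iteratedFDeriv ℝ m ((u : Eps → Rn n → ℂ) ε) x‖ +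
            ‖iteratedFDeriv ℝ m ((v : Eps → Rn n → ℂ) ε) x‖ :=
          (congrArg norm e).le.trans (norm_add_le _ _)
      _ ≤ _ := add_le_add ((h x).trans (key C N (le_max_left _ _)))
          ((h' x).trans (key D M (le_max_right _ _)))
      _ = _ := by ring
  neg_mem' := by
    rintro u hu m
    obtain ⟨N, hu'⟩ := hu m
    refine ⟨N, fun q => ?_⟩
    obtain ⟨C, h⟩ := hu' q
    refine ⟨C, ?_⟩
    filter_upwards [h] with ε h x
    rw [AddSubgroup.coe_neg, Pi.neg_apply, iteratedFDeriv_neg_apply, norm_neg]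
    exact h x

/-- The space of tempered generalized functions on `ℝⁿ`. -/
def GTau (n : ℕ) : Type := moderateTau n ⧸ negligibleTau n

/-- `w = [(g ε)_ε]`; this includes that the net `g` is `τ`-moderate. -/
def GTau.Represents {n : ℕ} (g : Eps → Rn n → ℂ) (w : GTau n) : Prop :=
  ∃ h : g ∈ moderateTau n, (QuotientAddGroup.mk ⟨g, h⟩ : moderateTau n ⧸ negligibleTau n) = w

/-! ### The mollifiers -/

/-- The test function `y ↦ δ^(-n) ρ(y / δ)`, for `δ > 0`. -/
def scale {n : ℕ} (ρ : Test n) (δ : ℝ) (hδ : 0 < δ) : Test n where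
  toFun y := ((δ ^ n)⁻¹ : ℝ) • ρ (δ⁻¹ • y)
  contDiff' := (ρ.contDiff.comp (contDiff_const_smul δ⁻¹)).const_smul _
  hasCompactSupport' :=
    (ρ.hasCompactSupport.comp_homeomorph (Homeomorph.smulOfNeZero δ⁻¹ (inv_ne_zero hδ.ne'))).smul_left
      (f := fun _ => ((δ ^ n)⁻¹ : ℝ))
  tsupport_subset' := Set.subset_univ _

/-- The net `(ρ_{ε^q})_ε`. -/
def mollifierNet {n : ℕ} (ρ : Test n) (q : ℕ) (ε : Eps) : Test n :=
  scale ρ ((ε : ℝ) ^ q) (pow_pos ε.2.1 q)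

/-- A test function as a Schwartz function. -/
def Test.toSchwartz {n : ℕ} (f : Test n) : 𝓢(Rn n, ℂ) :=
  f.hasCompactSupport.toSchwartzMap f.contDiff

/-! ### The functions `f(x - ·)` -/

/-- The test function `y ↦ f (x - y)`. -/
def Test.reflect {n : ℕ} (x : Rn n) (f : Test n) : Test n where
  toFun y := f (x - y)
  contDiff' := f.contDiff.comp (contDiff_const.sub contDiff_id)
  hasCompactSupport' := f.hasCompactSupport.comp_homeomorph (Homeomorph.subLeft x)
  tsupport_subset' := Set.subset_univ _

/-- The smooth function `y ↦ f (x - y)`. -/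
def Smooth.reflect {n : ℕ} (x : Rn n) (f : Smooth n) : Smooth n :=
  ⟨fun y => (f : Rn n → ℂ) (x - y), by
    have hf : ContDiff ℝ ((⊤ : ℕ∞) : WithTop ℕ∞) (f : Rn n → ℂ) := f.2
    exact hf.comp (contDiff_const.sub contDiff_id)⟩

/-- The Schwartz function `y ↦ f (x - y)`. -/
def schwartzReflect {n : ℕ} (x : Rn n) (f : 𝓢(Rn n, ℂ)) : 𝓢(Rn n, ℂ) :=
  SchwartzMap.compSubConstCLM ℂ x
    (SchwartzMap.compCLMOfContinuousLinearEquiv ℂ (ContinuousLinearEquiv.neg ℝ) f)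

theorem schwartzReflect_apply {n : ℕ} (x y : Rn n) (f : 𝓢(Rn n, ℂ)) :
    schwartzReflect x f y = f (x - y) := by
  simp [schwartzReflect]

/-! ### Convolution with a basic functional: `(u ∗ T)(x) = T(u(x - ·))` -/

/-- `w ∈ G(ℝⁿ)` is the convolution `u ∗ T` of `u ∈ G_c(ℝⁿ)` and a basic functional `T` on
`G_c(ℝⁿ)`: `w = [(x ↦ T' ε (f ε (x - ·)))_ε]` for all nets that represent `T` and `u`. -/
def Gc.IsConv {n : ℕ} (u : Gc n) (T : Gc n →L[CTilde] CTilde) (w : G n) : Prop :=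
  ∀ (T' : Eps → Test n →L[ℂ] ℂ) (f : Eps → Test n),
    Gc.DefinedBy T T' → RepresentsCompact f (Gc.toG u) →
    ∃ g : Eps → Smooth n, (∀ ε x, (g ε : Rn n → ℂ) x = T' ε ((f ε).reflect x)) ∧
      GE.Represents g w

/-- `w ∈ G(ℝⁿ)` is the convolution `u ∗ T` of `u ∈ G(ℝⁿ)` and a basic functional `T` on `G(ℝⁿ)`. -/
def G.IsConv {n : ℕ} (u : G n) (T : G n →L[CTilde] CTilde) (w : G n) : Prop :=
  ∀ (T' : Eps → Smooth n →ₗ[ℂ] ℂ) (f : Eps → Smooth n),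
    GE.DefinedBy T T' → GE.Represents f u →
    ∃ g : Eps → Smooth n, (∀ ε x, (g ε : Rn n → ℂ) x = T' ε (Smooth.reflect x (f ε))) ∧
      GE.Represents g w

/-- The tempered generalized function `w` is the convolution `u ∗ T` of a generalized function `u`
based on `𝓢(ℝⁿ)` and a basic functional `T` on these. -/
def GS.IsConv {n : ℕ} (u : GS n) (T : GS n →L[CTilde] CTilde) (w : GTau n) : Prop :=
  ∀ (T' : Eps → 𝓢(Rn n, ℂ) →ₗ[ℂ] ℂ) (f : Eps → 𝓢(Rn n, ℂ)),
    GE.DefinedBy T T' → GE.Represents f u →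
    GTau.Represents (fun ε x => T' ε (schwartzReflect x (f ε))) w

/-! ### Generalized functions as functionals: `v ↦ ∫ w v` -/

/-- `S` is the functional `v ↦ ∫ w(x) v(x) dx` on `G_c(ℝⁿ)` given by `w ∈ G(ℝⁿ)`. -/
def Gc.IsIntegralFunctional {n : ℕ} (w : G n) (S : Gc n →L[CTilde] CTilde) : Prop :=
  ∀ (v : Gc n) (g : Eps → Smooth n) (f : Eps → Test n),
    GE.Represents g w → RepresentsCompact f (Gc.toG v) →
    CTilde.Represents (fun ε => ∫ x, (g ε : Rn n → ℂ) x * f ε x) (S v)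

/-- `S` is the functional `v ↦ ∫ w(x) v(x) dx` on `G(ℝⁿ)` given by `w ∈ G_c(ℝⁿ)`. -/
def G.IsIntegralFunctional {n : ℕ} (w : Gc n) (S : G n →L[CTilde] CTilde) : Prop :=
  ∀ (v : G n) (g : Eps → Test n) (f : Eps → Smooth n),
    RepresentsCompact g (Gc.toG w) → GE.Represents f v →
    CTilde.Represents (fun ε => ∫ x, g ε x * (f ε : Rn n → ℂ) x) (S v)

/-- `S` is the functional `v ↦ ∫ w(x) v(x) dx` on the generalized functions based on `𝓢(ℝⁿ)`
given by a tempered generalized function `w`. -/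
def GS.IsIntegralFunctional {n : ℕ} (w : GTau n) (S : GS n →L[CTilde] CTilde) : Prop :=
  ∀ (v : GS n) (g : Eps → Rn n → ℂ) (f : Eps → 𝓢(Rn n, ℂ)),
    GTau.Represents g w → GE.Represents f v →
    CTilde.Represents (fun ε => ∫ x, g ε x * f ε x) (S v)

end Colombeau

end

open Colombeau

/-!
A basic functional `T` is given by a net `T' ε` of distributions which, for small `ε`, is bounded by
`ε ^ (-N)` times one seminorm of order `h`. The convolution is the net of functions
`x ↦ T' ε (u ε (x - ·))`, and convolving a distribution with `ρ_δ` changes its values by `O(δ)`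
times the seminorm of order `h + 1`. For `δ = ε ^ q` the difference of the regularized functional
and `T` is hence `O(ε ^ (q - N))`, so that it is at most `e ^ (N - q)` times one
ultra-pseudo-seminorm. This is uniform convergence on bounded sets, with rate `e ^ (-q)`.

All three cases are reduced to nets of functionals on the Schwartz space. On a ball, the convolution
with a functional on `G_c` is the convolution with `φ ↦ T' ε (χ φ)` for a cutoff function `χ` that
is `1` on a larger ball (`cutNet`). A functional on `G` is restricted to `𝓢(ℝⁿ)` (`restrictNet`),
and smooth functions are cut off outside the compact set on which it depends. For a functional `T`
on `𝓢(ℝⁿ)` bounded by a seminorm of order `h`, three facts are needed.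

* The function `x ↦ T (f (x - ·))` is smooth, its derivatives are those of `f` with `T` applied, and
  they grow at most like `(1 + ‖x‖) ^ h` (`norm_iteratedFDeriv_map_schwartzReflect_le`).
* `∫ T (f (x - ·)) g x dx = T (∫ f (x - ·) g x dx)` (`exists_convolution_eq`). The functional is
  extended by Hahn–Banach to a Banach space of families of bounded functions, the weighted
  derivatives, where it commutes with the Bochner integral (`map_integral_eq_integral_map`).
* `‖∫ T (ρ_δ (x - ·)) g x dx - T g‖` is at most a constant times `δ` times the seminorm of `g` of
  order `h + 1` (`norm_integral_map_scale_sub_le`), by the mean value theorem and `∫ ρ = 1`.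

The class of the convolution is independent of the net that represents `T`: if two nets represent
the same functional, their difference maps moderate nets to negligible ones; testing with the net
of worst points and directions gives negligible derivatives for `‖x‖ ≤ ε ^ (-k)`, and for larger
`‖x‖` one more power of `1 + ‖x‖` beats the powers of `ε`
(`TemperedNet.tauNegligible_of_map_negligible`).

In `G_c` an element with support in `K` has a representative with supports in a ball depending only
on `K` (`exists_representative_of_supp_subset`), and the weighted supremum
`sup_q e ^ q |(T_q - T) u|_e` is itself a continuous ultra-pseudo-seminorm, so that bounded sets of
the inductive limit need not be described (`Gc.tendsto_strongTopology`).
-/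

noncomputable section

namespace Colombeau

section

/-! ### Asymptotics of nets -/

theorem eventually_le (η : Eps) : ∀ᶠ ε in toZero, ε ≤ η := by
  have h : ∀ᶠ x in 𝓝 (0 : ℝ), x ≤ (η : ℝ) := (eventually_lt_nhds η.2.1).mono fun _ h => h.le
  exact (h.comap ((↑) : Eps → ℝ)).mono fun _ h => h

theorem eventually_coe_lt {c : ℝ} (hc : 0 < c) : ∀ᶠ ε : Eps in toZero, (ε : ℝ) < c :=
  (eventually_lt_nhds hc).comap ((↑) : Eps → ℝ)

theorem eps_pos (ε : Eps) : (0 : ℝ) < ε := ε.2.1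

theorem eps_le_one (ε : Eps) : (ε : ℝ) ≤ 1 := ε.2.2

theorem one_le_inv_eps_pow (ε : Eps) (N : ℕ) : 1 ≤ ((ε : ℝ) ^ N)⁻¹ :=
  (one_le_inv₀ (pow_pos (eps_pos ε) N)).2 (pow_le_one₀ (eps_pos ε).le (eps_le_one ε))

theorem inv_eps_pow_mono (ε : Eps) {M N : ℕ} (h : M ≤ N) :
    ((ε : ℝ) ^ M)⁻¹ ≤ ((ε : ℝ) ^ N)⁻¹ :=
  inv_anti₀ (pow_pos (eps_pos ε) N) (pow_le_pow_of_le_one (eps_pos ε).le (eps_le_one ε) h)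

theorem moderateNet_iff {f : Eps → ℝ} (hf : ∀ ε, 0 ≤ f ε) :
    ModerateNet f ↔ ∃ (N : ℕ) (C : ℝ), 0 ≤ C ∧ ∀ᶠ ε in toZero, f ε ≤ C * ((ε : ℝ) ^ N)⁻¹ := by
  refine exists_congr fun N => ?_
  constructor
  · intro h
    obtain ⟨C, hC, h⟩ := h.exists_nonneg
    refine ⟨C, hC, h.bound.mono fun ε h => ?_⟩
    have h0 := eps_pos ε
    rwa [Real.norm_of_nonneg (hf ε), Real.norm_of_nonneg (by positivity)] at h
  · rintro ⟨C, -, h⟩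
    refine Asymptotics.IsBigO.of_bound C (h.mono fun ε h => ?_)
    have h0 := eps_pos ε
    rwa [Real.norm_of_nonneg (hf ε), Real.norm_of_nonneg (by positivity)]

theorem negligibleNet_iff {f : Eps → ℝ} (hf : ∀ ε, 0 ≤ f ε) :
    NegligibleNet f ↔ ∀ q : ℕ, ∃ C : ℝ, 0 ≤ C ∧ ∀ᶠ ε in toZero, f ε ≤ C * (ε : ℝ) ^ q := by
  refine forall_congr' fun q => ?_
  constructor
  · intro h
    obtain ⟨C, hC, h⟩ := h.exists_nonneg
    refine ⟨C, hC, h.bound.mono fun ε h => ?_⟩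
    have h0 := eps_pos ε
    rwa [Real.norm_of_nonneg (hf ε), Real.norm_of_nonneg (by positivity)] at h
  · rintro ⟨C, -, h⟩
    refine Asymptotics.IsBigO.of_bound C (h.mono fun ε h => ?_)
    have h0 := eps_pos ε
    rwa [Real.norm_of_nonneg (hf ε), Real.norm_of_nonneg (by positivity)]

theorem ModerateNet.of_eventually_le {f g : Eps → ℝ} (hg : ModerateNet g)
    (h : ∀ᶠ ε in toZero, |f ε| ≤ g ε) : ModerateNet f := by
  obtain ⟨N, hN⟩ := hg
  refine ⟨N, (Asymptotics.IsBigO.of_bound 1 (h.mono fun ε h => ?_)).trans hN⟩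
  simpa using h.trans (le_abs_self _)

theorem NegligibleNet.of_eventually_le {f g : Eps → ℝ} (hg : NegligibleNet g)
    (h : ∀ᶠ ε in toZero, |f ε| ≤ g ε) : NegligibleNet f := fun q =>
  (Asymptotics.IsBigO.of_bound 1 (h.mono fun ε h => by
    simpa using h.trans (le_abs_self _))).trans (hg q)

theorem ModerateNet.inv_pow (N : ℕ) : ModerateNet fun ε => ((ε : ℝ) ^ N)⁻¹ :=
  ⟨N, Asymptotics.isBigO_refl _ _⟩

theorem ModerateNet.const_mul {f : Eps → ℝ} (c : ℝ) (hf : ModerateNet f) :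
    ModerateNet fun ε => c * f ε := (ModerateNet.const c).mul hf

theorem NegligibleNet.const_mul {f : Eps → ℝ} (c : ℝ) (hf : NegligibleNet f) :
    NegligibleNet fun ε => c * f ε := (ModerateNet.const c).mul_negligible hf

/-! ### The valuation and products -/

theorem expNegVal_ne_top {f : Eps → ℝ} (hf : ModerateNet f) : EReal.exp (-netVal f) ≠ ⊤ := by
  simpa using netVal_ne_bot hf

/-- A factor `ε ^ c` shifts the valuation by `c`; negligible terms do not matter. -/
theorem expNegVal_le_exp_mul {f g d : Eps → ℝ} (c C : ℝ) (hg : ModerateNet g)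
    (hd : NegligibleNet d) (h : ∀ᶠ ε in toZero, |f ε| ≤ C * (ε : ℝ) ^ c * g ε + d ε) :
    expNegVal f ≤ Real.exp (-c) * expNegVal g := by
  have key : ∀ b ∈ orderSet g, b + c ∈ orderSet f := by
    intro b hb
    have h1 : (fun ε : Eps => C * (ε : ℝ) ^ c * g ε) =O[toZero] fun ε : Eps =>
        (ε : ℝ) ^ (b + c) := by
      refine (((Asymptotics.isBigO_refl (fun ε : Eps => (ε : ℝ) ^ c) toZero).const_mul_left
        C).mul hb).congr_right fun ε => ?_
      rw [← Real.rpow_add (eps_pos ε), add_comm]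
    refine (Asymptotics.IsBigO.of_bound 1 (h.mono fun ε h => ?_)).trans
      (h1.add (hd.mem_orderSet _))
    simpa using h.trans (le_abs_self _)
  have hval : netVal g + c ≤ netVal f := by
    rw [← EReal.le_sub_iff_add_le (by simp) (by simp)]
    refine sSup_le ?_
    rintro _ ⟨b, hb, rfl⟩
    rw [EReal.le_sub_iff_add_le (by simp) (by simp)]
    exact le_sSup ⟨b + c, key b hb, by simp⟩
  have : EReal.exp (-netVal f) ≤ ENNReal.ofReal (Real.exp (-c)) * EReal.exp (-netVal g) := by
    rw [← EReal.exp_coe, ← EReal.exp_add]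
    refine EReal.exp_monotone ?_
    refine (EReal.neg_le_neg_iff.2 hval).trans (le_of_eq ?_)
    rw [EReal.neg_add (by simp) (by simp), EReal.coe_neg, sub_eq_add_neg, add_comm]
  refine (ENNReal.toReal_mono (ENNReal.mul_ne_top ENNReal.ofReal_ne_top
    (expNegVal_ne_top hg)) this).trans ?_
  rw [ENNReal.toReal_mul, ENNReal.toReal_ofReal (Real.exp_pos _).le]
  rfl

theorem expNegVal_mul_le {f g : Eps → ℝ} (hf : ModerateNet f) (hg : ModerateNet g) :
    expNegVal (fun ε => f ε * g ε) ≤ expNegVal f * expNegVal g := by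
  have key : ∀ a ∈ orderSet f, ∀ b ∈ orderSet g, a + b ∈ orderSet fun ε => f ε * g ε := by
    intro a ha b hb
    refine (Asymptotics.IsBigO.mul ha hb).congr_right fun ε => ?_
    rw [← Real.rpow_add (eps_pos ε)]
  have hval : netVal f + netVal g ≤ netVal fun ε => f ε * g ε := by
    refine EReal.add_le_of_forall_lt fun a ha b hb => ?_
    obtain ⟨_, ⟨a', ha', rfl⟩, haa⟩ := lt_sSup_iff.1 ha
    obtain ⟨_, ⟨b', hb', rfl⟩, hbb⟩ := lt_sSup_iff.1 hb
    exact (add_le_add haa.le hbb.le).trans (le_sSup ⟨a' + b', key a' ha' b' hb', by simp⟩)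
  have : EReal.exp (-netVal fun ε => f ε * g ε) ≤
      EReal.exp (-netVal f) * EReal.exp (-netVal g) := by
    rw [← EReal.exp_add]
    refine EReal.exp_monotone ((EReal.neg_le_neg_iff.2 hval).trans (le_of_eq ?_))
    rw [EReal.neg_add (Or.inl (netVal_ne_bot hf)) (Or.inr (netVal_ne_bot hg)), sub_eq_add_neg]
  refine (ENNReal.toReal_mono (ENNReal.mul_ne_top (expNegVal_ne_top hf)
    (expNegVal_ne_top hg)) this).trans ?_
  rw [ENNReal.toReal_mul]
  rfl

theorem absE_mul_le (z w : CTilde) : absE (z * w) ≤ absE z * absE w := by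
  obtain ⟨a, rfl⟩ := CTilde.mk_surjective z
  obtain ⟨b, rfl⟩ := CTilde.mk_surjective w
  rw [← map_mul, absE_mk, absE_mk, absE_mk]
  simpa using expNegVal_mul_le a.2 b.2

/-! ### Representatives -/

namespace CTilde

theorem represents_mk (a : moderateC) : Represents (a : Eps → ℂ) (mk a) := ⟨a.2, rfl⟩

theorem represents_iff_of_represents {a b : Eps → ℂ} {z : CTilde} (ha : Represents a z) :
    Represents b z ↔ NegligibleNet fun ε => ‖a ε - b ε‖ := by
  obtain ⟨ha, rfl⟩ := ha
  constructor
  · rintro ⟨hb, h⟩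
    exact Ideal.Quotient.eq.1 h.symm
  · intro h
    have hb : b ∈ moderateC := by
      refine (ModerateNet.add ha (g := fun ε => ‖a ε - b ε‖) ?_).mono fun ε => ?_
      · exact (ModerateNet.const 1).of_eventually_le (by
          obtain ⟨C, -, h⟩ := (negligibleNet_iff fun _ => norm_nonneg _).1 h 1
          filter_upwards [h, eventually_coe_lt (show (0 : ℝ) < (|C| + 1)⁻¹ by positivity)] with
            ε h hε
          rw [abs_of_nonneg (norm_nonneg _)]
          refine h.trans ?_
          have h0 := eps_pos ε
          have : (|C| + 1) * ε ≤ 1 := by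
            rw [lt_inv_comm₀ h0 (by positivity)] at hε
            have := mul_le_mul_of_nonneg_right hε.le h0.le
            rwa [inv_mul_cancel₀ h0.ne'] at this
          nlinarith [le_abs_self C])
      · simpa using norm_le_norm_add_norm_sub (a ε) (b ε)
    exact ⟨hb, (Ideal.Quotient.eq.2 (show (⟨a, ha⟩ - ⟨b, hb⟩ : moderateC) ∈ negligibleC
      from h)).symm⟩

theorem Represents.absE_eq {a : Eps → ℂ} {z : CTilde} (h : Represents a z) :
    absE z = expNegVal fun ε => ‖a ε‖ := by
  obtain ⟨ha, rfl⟩ := h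
  rfl

theorem Represents.add {a b : Eps → ℂ} {z w : CTilde} (ha : Represents a z)
    (hb : Represents b w) : Represents (fun ε => a ε + b ε) (z + w) := by
  obtain ⟨ha, rfl⟩ := ha
  obtain ⟨hb, rfl⟩ := hb
  exact ⟨add_mem ha hb, map_add mk ⟨a, ha⟩ ⟨b, hb⟩⟩

theorem Represents.sub {a b : Eps → ℂ} {z w : CTilde} (ha : Represents a z)
    (hb : Represents b w) : Represents (fun ε => a ε - b ε) (z - w) := by
  obtain ⟨ha, rfl⟩ := ha
  obtain ⟨hb, rfl⟩ := hb
  exact ⟨sub_mem ha hb, map_sub mk ⟨a, ha⟩ ⟨b, hb⟩⟩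

theorem Represents.mul {a b : Eps → ℂ} {z w : CTilde} (ha : Represents a z)
    (hb : Represents b w) : Represents (fun ε => a ε * b ε) (z * w) := by
  obtain ⟨ha, rfl⟩ := ha
  obtain ⟨hb, rfl⟩ := hb
  exact ⟨mul_mem ha hb, map_mul mk ⟨a, ha⟩ ⟨b, hb⟩⟩

theorem Represents.unique {a : Eps → ℂ} {z w : CTilde} (hz : Represents a z)
    (hw : Represents a w) : z = w := by
  obtain ⟨_, rfl⟩ := hz
  obtain ⟨_, rfl⟩ := hw
  rfl

theorem exists_represents {a : Eps → ℂ} (h : ModerateNet fun ε => ‖a ε‖) :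
    ∃ z, Represents a z := ⟨_, h, rfl⟩

end CTilde

section GE

variable {E ι : Type} [AddCommGroup E] [Module ℂ E] {p : ι → Seminorm ℂ E}

theorem GE.exists_representative (x : GE p) : ∃ u : Eps → E, GE.Represents u x := by
  obtain ⟨u, rfl⟩ := GE.mk_surjective x
  exact ⟨u, u.2, rfl⟩

theorem GE.Represents.negligible_sub {u v : Eps → E} {x : GE p} (hu : GE.Represents u x)
    (hv : GE.Represents v x) (i : ι) : NegligibleNet fun ε => p i (u ε - v ε) := by
  obtain ⟨hu, rfl⟩ := hu
  obtain ⟨hv, h⟩ := hv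
  exact (Submodule.Quotient.eq (negligible p)).1 h.symm i

theorem GE.Represents.congr {u v : Eps → E} {x : GE p} (hu : GE.Represents u x)
    (hv : v ∈ Colombeau.moderate p) (h : ∀ i, NegligibleNet fun ε => p i (u ε - v ε)) :
    GE.Represents v x := by
  obtain ⟨hu, rfl⟩ := hu
  exact ⟨hv, ((Submodule.Quotient.eq (negligible p) (x := ⟨u, hu⟩) (y := ⟨v, hv⟩)).2 h).symm⟩

theorem GE.Represents.ups_eq {u : Eps → E} {x : GE p} (hu : GE.Represents u x) (i : ι) :
    GE.ups i x = expNegVal fun ε => p i (u ε) := by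
  obtain ⟨hu, rfl⟩ := hu
  rfl

end GE

/-! ### Functionals given by nets -/

/-- A net of linear functionals that sends representatives of the elements of `M` to moderate nets,
uniquely up to negligible nets, induces a linear functional on `M`. -/
theorem exists_linearMap_of_net {M X : Type} [AddCommGroup M] [Module CTilde M] [AddCommGroup X]
    [Module ℂ X] (R : (Eps → X) → M → Prop) (hsurj : ∀ x, ∃ u, R u x)
    (hadd : ∀ u v x y, R u x → R v y → R (fun ε => u ε + v ε) (x + y))
    (hsmul : ∀ (a : moderateC) u x, R u x →
      R (fun ε => (a : Eps → ℂ) ε • u ε) (CTilde.mk a • x))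
    (L : Eps → X →ₗ[ℂ] ℂ) (hmod : ∀ u x, R u x → ModerateNet fun ε => ‖L ε (u ε)‖)
    (hneg : ∀ u v x, R u x → R v x → NegligibleNet fun ε => ‖L ε (u ε - v ε)‖) :
    ∃ S : M →ₗ[CTilde] CTilde, ∀ x u, R u x →
      CTilde.Represents (fun ε => L ε (u ε)) (S x) := by
  choose r hr using hsurj
  choose s hs using fun x => CTilde.exists_represents (hmod _ _ (hr x))
  have key : ∀ x u, R u x → CTilde.Represents (fun ε => L ε (u ε)) (s x) := fun x u hu =>
    (CTilde.represents_iff_of_represents (hs x)).2 (by simpa using hneg _ _ _ (hr x) hu)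
  refine ⟨{ toFun := s, map_add' := fun x y => ?_, map_smul' := fun c x => ?_ }, key⟩
  · have h := key _ _ (hadd _ _ _ _ (hr x) (hr y))
    simp only [map_add] at h
    exact h.unique ((hs x).add (hs y))
  · obtain ⟨a, rfl⟩ := CTilde.mk_surjective c
    have h := key _ _ (hsmul a _ _ (hr x))
    simp only [map_smul, smul_eq_mul] at h
    exact h.unique ((CTilde.represents_mk a).mul (hs x))

section Ups

variable {M κ : Type} [AddCommGroup M] [Module CTilde M] (P : κ → M → ℝ)

theorem continuous_of_absE_le (S : M →ₗ[CTilde] CTilde) (k : κ) (C : ℝ)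
    (h : ∀ u, absE (S u) ≤ C * P k u) (hP : ∀ u, 0 ≤ P k u) (h0 : P k 0 = 0) :
    @Continuous _ _ (upsTopology P) _ S := by
  let _ := upsTopology P
  refine continuous_iff_continuousAt.2 fun u => ?_
  refine Metric.tendsto_nhds.2 fun r hr => ?_
  have hmem : {y | P k (y - u) < r / (|C| + 1)} ∈ 𝓝 u := by
    refine IsOpen.mem_nhds (TopologicalSpace.isOpen_generateFrom_of_mem
      ⟨k, u, r / (|C| + 1), by positivity, rfl⟩) ?_
    simp only [Set.mem_ofPred_eq, sub_self, h0]
    positivity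
  filter_upwards [hmem] with y hy
  have hy : P k (y - u) < r / (|C| + 1) := hy
  change absE (S y - S u) < r
  rw [← map_sub]
  rw [lt_div_iff₀ (by positivity)] at hy
  have := h (y - u)
  nlinarith [le_abs_self C, hP (y - u)]

/-- A rate of convergence `e ^ (-q)` with respect to a single ultra-pseudo-seminorm implies
convergence uniformly on bounded sets. -/
theorem tendsto_strongTopology [TopologicalSpace M] (S : ℕ → M →L[CTilde] CTilde)
    (T : M →L[CTilde] CTilde) (k : κ) (C : ℝ) (hP0 : ∀ u, 0 ≤ P k u)
    (h : ∀ q u, absE (S q u - T u) ≤ C * Real.exp (-q) * P k u) :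
    Tendsto S atTop (@nhds _ (strongTopology P) T) := by
  rw [nhds_induced, tendsto_comap_iff]
  refine UniformOnFun.tendsto_iff_tendstoUniformlyOn.2 fun B hB => ?_
  obtain ⟨b, hb⟩ := hB k
  refine Metric.tendstoUniformlyOn_iff.2 fun r hr => ?_
  have hlim : Tendsto (fun q : ℕ => |C| * Real.exp (-q) * |b|) atTop (𝓝 0) := by
    have h1 : Tendsto (fun q : ℕ => Real.exp (-(q : ℝ))) atTop (𝓝 0) :=
      Real.tendsto_exp_neg_atTop_nhds_zero.comp tendsto_natCast_atTop_atTop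
    simpa using (h1.const_mul |C|).mul_const |b|
  filter_upwards [hlim.eventually (gt_mem_nhds hr)] with q hq u hu
  change absE (T u - S q u) < r
  rw [← absE_neg, neg_sub]
  refine lt_of_le_of_lt ?_ hq
  have hP : P k u ≤ |b| := (hb ⟨u, hu, rfl⟩).trans (le_abs_self b)
  refine (h q u).trans ?_
  have h0 := hP0 u
  gcongr
  exact le_abs_self C

end Ups

/-- A net of functionals bounded by `ε ^ (-N)` times one seminorm induces a continuous
functional. -/
theorem GE.exists_functional {E ι : Type} [AddCommGroup E] [Module ℂ E] {p : ι → Seminorm ℂ E}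
    (L : Eps → E →ₗ[ℂ] ℂ) (i : ι) (N : ℕ) (C : ℝ)
    (hL : ∀ᶠ ε : Eps in toZero, ∀ u, ‖L ε u‖ ≤ C * ((ε : ℝ) ^ N)⁻¹ * p i u) :
    ∃ S : GE p →L[CTilde] CTilde, ∀ x u, GE.Represents u x →
      CTilde.Represents (fun ε => L ε (u ε)) (S x) := by
  obtain ⟨S, hS⟩ := exists_linearMap_of_net (GE.Represents (p := p)) GE.exists_representative
    (fun u v x y hu hv => hu.add hv) (fun a u x hu => hu.smul a) L
    (fun u x hu => (((ModerateNet.inv_pow N).const_mul C).mul (hu.1 i)).of_eventually_le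
      (hL.mono fun ε h => by rw [abs_norm]; exact h _))
    (fun u v x hu hv => (((ModerateNet.inv_pow N).const_mul C).mul_negligible
      (hu.negligible_sub hv i)).of_eventually_le (hL.mono fun ε h => by
        rw [abs_norm]; exact h _))
  refine ⟨⟨S, continuous_of_absE_le GE.ups S i (Real.exp N) (fun x => ?_) (fun x => ?_) ?_⟩, hS⟩
  · obtain ⟨u, hu⟩ := GE.exists_representative x
    rw [(hS x u hu).absE_eq, hu.ups_eq i]
    have := expNegVal_le_exp_mul (f := fun ε => ‖L ε (u ε)‖) (-(N : ℝ)) C (hu.1 i)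
      NegligibleNet.zero (hL.mono fun ε h => ?_)
    · simpa using this
    · rw [abs_norm, Real.rpow_neg (eps_pos ε).le, Real.rpow_natCast, add_zero]
      exact h _
  · obtain ⟨u, hu⟩ := GE.exists_representative x
    rw [hu.ups_eq i]
    exact expNegVal_nonneg _
  · rw [GE.Represents.zero.ups_eq i]
    simpa using expNegVal_zero

end

section

/-! ### Integrals of families of Schwartz functions -/

section IteratedFDerivIntegral

variable {α E F : Type*} [MeasurableSpace α] {μ : Measure α} [NormedAddCommGroup E]
  [NormedSpace ℝ E] [NormedAddCommGroup F] [NormedSpace ℝ F]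

theorem iteratedFDeriv_integral (Ψ : α → E → F)
    (hs : ∀ a, ContDiff ℝ ((⊤ : ℕ∞) : WithTop ℕ∞) (Ψ a)) (b : ℕ → α → ℝ)
    (hb : ∀ m, Integrable (b m) μ) (hle : ∀ m a y, ‖iteratedFDeriv ℝ m (Ψ a) y‖ ≤ b m a)
    (hmeas : ∀ m y, AEStronglyMeasurable (fun a => iteratedFDeriv ℝ m (Ψ a) y) μ) (m : ℕ) :
    iteratedFDeriv ℝ m (fun y => ∫ a, Ψ a y ∂μ) =
      fun y => ∫ a, iteratedFDeriv ℝ m (Ψ a) y ∂μ := by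
  induction m with
  | zero =>
    ext1 y
    simp only [iteratedFDeriv_zero_eq_comp, Function.comp_apply]
    exact ((continuousMultilinearCurryFin0 ℝ E F).symm.toContinuousLinearEquiv.integral_comp_comm
      fun a => Ψ a y).symm
  | succ m ih =>
    have hfd : ∀ a y, fderiv ℝ (iteratedFDeriv ℝ m (Ψ a)) y =
        continuousMultilinearCurryLeftEquiv ℝ (fun _ : Fin (m + 1) => E) F
          (iteratedFDeriv ℝ (m + 1) (Ψ a) y) := fun a y => by
      simp [iteratedFDeriv_succ_eq_comp_left]
    ext1 y
    have hd : HasFDerivAt (fun y => ∫ a, iteratedFDeriv ℝ m (Ψ a) y ∂μ)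
        (∫ a, fderiv ℝ (iteratedFDeriv ℝ m (Ψ a)) y ∂μ) y := by
      refine hasFDerivAt_integral_of_dominated_of_fderiv_le (bound := b (m + 1))
        (F := fun y a => iteratedFDeriv ℝ m (Ψ a) y)
        (F' := fun y a => fderiv ℝ (iteratedFDeriv ℝ m (Ψ a)) y) univ_mem
        (Eventually.of_forall fun y => hmeas m y)
        ((hb m).mono' (hmeas m y) (Eventually.of_forall fun a => hle m a y)) ?_
        (Eventually.of_forall fun a y _ => ?_) (hb (m + 1))
        (Eventually.of_forall fun a y _ => ?_)
      · simp only [hfd]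
        exact (LinearIsometryEquiv.continuous _).comp_aestronglyMeasurable (hmeas (m + 1) y)
      · rw [norm_fderiv_iteratedFDeriv]
        exact hle (m + 1) a y
      · exact (((hs a).differentiable_iteratedFDeriv
          (by exact_mod_cast ENat.natCast_lt_top m)) y).hasFDerivAt
    rw [iteratedFDeriv_succ_eq_comp_left, Function.comp_apply, ih, hd.fderiv]
    simp only [iteratedFDeriv_succ_eq_comp_left, Function.comp_apply]
    exact (ContinuousLinearEquiv.integral_comp_comm (𝕜 := ℝ) (μ := μ)
      (E := E →L[ℝ] ContinuousMultilinearMap ℝ (fun _ : Fin m => E) F)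
      (F := ContinuousMultilinearMap ℝ (fun _ : Fin (m + 1) => E) F)
      (continuousMultilinearCurryLeftEquiv ℝ
        (fun _ : Fin (m + 1) => E) F).symm.toContinuousLinearEquiv
      fun a => fderiv ℝ (iteratedFDeriv ℝ m (Ψ a)) y).symm

end IteratedFDerivIntegral

section HahnBanach

/-- A functional that is bounded by the norm of `Φ v` factors through `Φ`. -/
theorem exists_factor_of_le {V X : Type*} [AddCommGroup V] [Module ℂ V] [NormedAddCommGroup X]
    [NormedSpace ℂ X] (Φ : V →ₗ[ℂ] X) (T : V →ₗ[ℂ] ℂ) (C : ℝ) (h : ∀ v, ‖T v‖ ≤ C * ‖Φ v‖) :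
    ∃ S : X →L[ℂ] ℂ, ∀ v, S (Φ v) = T v := by
  have hker : LinearMap.ker Φ ≤ LinearMap.ker T := fun v hv => by
    have := h v
    rw [LinearMap.mem_ker.1 hv, norm_zero, mul_zero, norm_le_zero_iff] at this
    exact this
  let f : LinearMap.range Φ →ₗ[ℂ] ℂ :=
    ((LinearMap.ker Φ).liftQ T hker).comp Φ.quotKerEquivRange.symm.toLinearMap
  have hf : ∀ v, f ⟨Φ v, v, rfl⟩ = T v := fun v => by
    have : Φ.quotKerEquivRange.symm ⟨Φ v, v, rfl⟩ = (LinearMap.ker Φ).mkQ v :=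
      (LinearEquiv.symm_apply_eq _).2 rfl
    simp [f, this]
  obtain ⟨S, hS, -⟩ := exists_extension_norm_eq (LinearMap.range Φ) (f.mkContinuous C (by
    rintro ⟨_, v, rfl⟩
    rw [hf]
    exact h v))
  exact ⟨S, fun v => (hS ⟨Φ v, v, rfl⟩).trans (hf v)⟩

end HahnBanach

variable {n : ℕ}

theorem le_schwartzSup {h k m : ℕ} (hk : k ≤ h) (hm : m ≤ h) (f : 𝓢(Rn n, ℂ)) (x : Rn n) :
    ‖x‖ ^ k * ‖iteratedFDeriv ℝ m f x‖ ≤ schwartzSup n h f := by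
  refine (SchwartzMap.le_seminorm ℂ k m f x).trans ?_
  have : schwartzSeminormFamily ℂ (Rn n) ℂ (k, m) ≤ schwartzSup n h :=
    Finset.le_sup (f := schwartzSeminormFamily ℂ (Rn n) ℂ)
      (Finset.mem_Iic.2 (Prod.mk_le_mk.2 ⟨hk, hm⟩))
  exact this f

theorem norm_iteratedFDeriv_le_schwartzSup {h m : ℕ} (hm : m ≤ h) (f : 𝓢(Rn n, ℂ)) (x : Rn n) :
    ‖iteratedFDeriv ℝ m f x‖ ≤ schwartzSup n h f := by
  simpa using le_schwartzSup (Nat.zero_le h) hm f x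

theorem one_add_pow_le_schwartzSup {h k m : ℕ} (hk : k ≤ h) (hm : m ≤ h) (f : 𝓢(Rn n, ℂ))
    (x : Rn n) : (1 + ‖x‖) ^ k * ‖iteratedFDeriv ℝ m f x‖ ≤ 2 ^ h * schwartzSup n h f :=
  SchwartzMap.one_add_le_sup_seminorm_apply (m := (h, h)) hk hm f x

theorem schwartzSup_le {h : ℕ} {f : 𝓢(Rn n, ℂ)} {M : ℝ} (hM : 0 ≤ M)
    (H : ∀ k ≤ h, ∀ m ≤ h, ∀ x, ‖x‖ ^ k * ‖iteratedFDeriv ℝ m f x‖ ≤ M) :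
    schwartzSup n h f ≤ M := by
  refine Seminorm.finset_sup_apply_le hM fun i hi => ?_
  obtain ⟨hk, hm⟩ := Prod.mk_le_mk.1 (Finset.mem_Iic.1 hi)
  exact SchwartzMap.seminorm_le_bound ℂ _ _ f hM (H i.1 hk i.2 hm)

theorem schwartzSup_mono {h h' : ℕ} (hh : h ≤ h') (f : 𝓢(Rn n, ℂ)) :
    schwartzSup n h f ≤ schwartzSup n h' f :=
  schwartzSup_le (apply_nonneg _ _) fun _ hk _ hm x =>
    le_schwartzSup (hk.trans hh) (hm.trans hh) f x

open scoped BoundedContinuousFunction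

/-- The Banach space of bounded continuous functions with values in the `m`-linear forms. It is a
separate type, with only the structure that is used, so that instances are found quickly in
products over `m`. -/
def BoundedForms (n m : ℕ) : Type :=
  Rn n →ᵇ ContinuousMultilinearMap ℝ (fun _ : Fin m => Rn n) ℂ

instance (n m : ℕ) : NormedAddCommGroup (BoundedForms n m) :=
  inferInstanceAs (NormedAddCommGroup
    (Rn n →ᵇ ContinuousMultilinearMap ℝ (fun _ : Fin m => Rn n) ℂ))

instance (n m : ℕ) : NormedSpace ℂ (BoundedForms n m) :=
  inferInstanceAs (NormedSpace ℂ (Rn n →ᵇ ContinuousMultilinearMap ℝ (fun _ : Fin m => Rn n) ℂ))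

instance (n m : ℕ) : CompleteSpace (BoundedForms n m) :=
  inferInstanceAs (CompleteSpace (Rn n →ᵇ ContinuousMultilinearMap ℝ (fun _ : Fin m => Rn n) ℂ))

/-- Evaluation at a point. -/
def BoundedForms.eval {n m : ℕ} (y : Rn n) :
    BoundedForms n m →L[ℂ] ContinuousMultilinearMap ℝ (fun _ : Fin m => Rn n) ℂ :=
  (BoundedContinuousFunction.evalCLM ℂ y :
    (Rn n →ᵇ ContinuousMultilinearMap ℝ (fun _ : Fin m => Rn n) ℂ) →L[ℂ] _)

theorem BoundedForms.norm_eval_le {n m : ℕ} (g : BoundedForms n m) (y : Rn n) :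
    ‖BoundedForms.eval y g‖ ≤ ‖g‖ :=
  BoundedContinuousFunction.norm_coe_le_norm
    (g : Rn n →ᵇ ContinuousMultilinearMap ℝ (fun _ : Fin m => Rn n) ℂ) y

theorem BoundedForms.norm_le {n m : ℕ} {g : BoundedForms n m} {C : ℝ} (hC : 0 ≤ C)
    (h : ∀ y, ‖BoundedForms.eval y g‖ ≤ C) : ‖g‖ ≤ C :=
  (BoundedContinuousFunction.norm_le hC
    (f := (g : Rn n →ᵇ ContinuousMultilinearMap ℝ (fun _ : Fin m => Rn n) ℂ))).2 h

theorem BoundedForms.ext {n m : ℕ} {g g' : BoundedForms n m}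
    (h : ∀ y, BoundedForms.eval y g = BoundedForms.eval y g') : g = g' :=
  BoundedContinuousFunction.ext h

/-- The map `f ↦ (y ↦ ‖y‖ ^ k • D^m f y)` into the bounded continuous functions. -/
def weightedDeriv (n k m : ℕ) : 𝓢(Rn n, ℂ) →L[ℂ] BoundedForms n m :=
  (SchwartzMap.mkCLMtoNormedSpace
    (fun f => BoundedContinuousFunction.ofNormedAddCommGroup
      (fun y => ‖y‖ ^ k • iteratedFDeriv ℝ m f y)
      ((continuous_norm.pow k).smul
        ((f.smooth ⊤).continuous_iteratedFDeriv (by exact_mod_cast le_top)))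
      (SchwartzMap.seminorm ℂ k m f) (fun y => by
        rw [norm_smul, norm_pow, norm_norm]
        exact SchwartzMap.le_seminorm ℂ k m f y))
    (fun f g => by
      ext1 y
      have := iteratedFDeriv_add_apply (x := y) (f.contDiffAt m) (g.contDiffAt m)
      simp only [BoundedContinuousFunction.coe_ofNormedAddCommGroup,
        BoundedContinuousFunction.coe_add, Pi.add_apply, ← smul_add]
      exact congrArg _ this)
    (fun a f => by
      ext1 y
      have := iteratedFDeriv_const_smul_apply (x := y) (a := a) (f.contDiffAt m)
      simp only [BoundedContinuousFunction.coe_ofNormedAddCommGroup,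
        BoundedContinuousFunction.coe_smul, RingHom.id_apply, smul_comm a (‖y‖ ^ k)]
      exact congrArg _ this)
    ⟨{(k, m)}, 1, zero_le_one, fun f => by
      rw [Finset.sup_singleton, one_mul]
      refine BoundedContinuousFunction.norm_ofNormedAddCommGroup_le _ (apply_nonneg _ _) _⟩ :
    𝓢(Rn n, ℂ) →L[ℂ] (Rn n →ᵇ ContinuousMultilinearMap ℝ (fun _ : Fin m => Rn n) ℂ))

theorem eval_weightedDeriv (k m : ℕ) (f : 𝓢(Rn n, ℂ)) (y : Rn n) :
    BoundedForms.eval y (weightedDeriv n k m f) = ‖y‖ ^ k • iteratedFDeriv ℝ m f y := rfl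

/-- The map `f ↦ (y ↦ ‖y‖ ^ k • D^m f y)_{k, m ≤ h}`; it realizes `schwartzSup n h` as the norm of
a Banach space. -/
def weightedDerivs (n h : ℕ) :
    𝓢(Rn n, ℂ) →L[ℂ] ((i : Fin (h + 1) × Fin (h + 1)) → BoundedForms n i.2) :=
  ContinuousLinearMap.pi fun i => weightedDeriv n i.1 i.2

theorem schwartzSup_le_norm_weightedDerivs (h : ℕ) (f : 𝓢(Rn n, ℂ)) :
    schwartzSup n h f ≤ ‖weightedDerivs n h f‖ := by
  refine schwartzSup_le (norm_nonneg _) fun k hk m hm x => ?_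
  have h1 : ‖x‖ ^ k * ‖iteratedFDeriv ℝ m f x‖ = ‖BoundedForms.eval x (weightedDeriv n k m f)‖ := by
    rw [eval_weightedDeriv, norm_smul, norm_pow, norm_norm]
  rw [h1]
  refine (BoundedForms.norm_eval_le _ x).trans ?_
  exact norm_le_pi_norm (weightedDerivs n h f) (⟨k, by omega⟩, ⟨m, by omega⟩)

theorem norm_weightedDerivs_le (h : ℕ) (f : 𝓢(Rn n, ℂ)) :
    ‖weightedDerivs n h f‖ ≤ schwartzSup n h f := by
  refine (pi_norm_le_iff_of_nonneg (apply_nonneg _ _)).2 fun i => ?_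
  refine BoundedForms.norm_le (apply_nonneg _ _) fun y => ?_
  change ‖BoundedForms.eval y (weightedDeriv n i.1 i.2 f)‖ ≤ _
  rw [eval_weightedDeriv, norm_smul, norm_pow, norm_norm]
  exact le_schwartzSup (by omega) (by omega) f y

theorem weightedDerivs_apply (h : ℕ) (f : 𝓢(Rn n, ℂ)) (i : Fin (h + 1) × Fin (h + 1)) :
    weightedDerivs n h f i = weightedDeriv n i.1 i.2 f := rfl

section

variable {α : Type*} [TopologicalSpace α] [SecondCountableTopology α] [MeasurableSpace α]
  [OpensMeasurableSpace α] {μ : Measure α} {Ψ : α → 𝓢(Rn n, ℂ)} {c : 𝓢(Rn n, ℂ)}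

theorem iteratedFDeriv_eq_integral (hΨ : Continuous Ψ)
    (hint : ∀ h, Integrable (fun a => schwartzSup n h (Ψ a)) μ)
    (hc : ∀ y, c y = ∫ a, Ψ a y ∂μ) (m : ℕ) (y : Rn n) :
    iteratedFDeriv ℝ m c y = ∫ a, iteratedFDeriv ℝ m (Ψ a) y ∂μ := by
  have hc' : (c : Rn n → ℂ) = fun y => ∫ a, Ψ a y ∂μ := funext hc
  rw [hc', iteratedFDeriv_integral (fun a => Ψ a) (fun a => (Ψ a).smooth ⊤)
    (fun m a => schwartzSup n m (Ψ a)) hint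
    (fun m a y => norm_iteratedFDeriv_le_schwartzSup le_rfl (Ψ a) y)]
  intro m y
  have h3 : Continuous fun a => BoundedForms.eval y (weightedDeriv n 0 m (Ψ a)) :=
    (BoundedForms.eval y).continuous.comp ((weightedDeriv n 0 m).continuous.comp hΨ)
  simp only [eval_weightedDeriv, pow_zero, one_smul] at h3
  exact h3.aestronglyMeasurable

theorem weightedDeriv_eq_integral (hΨ : Continuous Ψ)
    (hint : ∀ h, Integrable (fun a => schwartzSup n h (Ψ a)) μ)
    (hc : ∀ y, c y = ∫ a, Ψ a y ∂μ) {k m : ℕ}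
    (hi : Integrable (fun a => weightedDeriv n k m (Ψ a)) μ) :
    weightedDeriv n k m c = ∫ a, weightedDeriv n k m (Ψ a) ∂μ := by
  refine BoundedForms.ext fun y => ?_
  rw [← (BoundedForms.eval y).integral_comp_comm hi]
  simp only [eval_weightedDeriv]
  rw [integral_smul, iteratedFDeriv_eq_integral hΨ hint hc]

/-- A tempered functional commutes with the integral of a continuous family of Schwartz functions
with integrable seminorms. The functional is extended to a Banach space of bounded continuous
functions, where the Bochner integral is available. -/
theorem map_integral_eq_integral_map {T : 𝓢(Rn n, ℂ) →ₗ[ℂ] ℂ} {C : ℝ} {h : ℕ}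
    (hT : ∀ φ, ‖T φ‖ ≤ C * schwartzSup n h φ) (hΨ : Continuous Ψ)
    (hint : ∀ h, Integrable (fun a => schwartzSup n h (Ψ a)) μ)
    (hc : ∀ y, c y = ∫ a, Ψ a y ∂μ) : T c = ∫ a, T (Ψ a) ∂μ := by
  obtain ⟨S, hS⟩ := exists_factor_of_le (weightedDerivs n h).toLinearMap T |C| (fun v =>
    (hT v).trans (mul_le_mul (le_abs_self C) (schwartzSup_le_norm_weightedDerivs h v)
      (apply_nonneg _ _) (abs_nonneg C)))
  have hS : ∀ v, S (weightedDerivs n h v) = T v := hS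
  have hint' : Integrable (fun a => weightedDerivs n h (Ψ a)) μ :=
    (hint h).mono' ((weightedDerivs n h).continuous.comp hΨ).aestronglyMeasurable
      (Eventually.of_forall fun a => norm_weightedDerivs_le h (Ψ a))
  have key : weightedDerivs n h c = ∫ a, weightedDerivs n h (Ψ a) ∂μ := by
    ext1 i
    let P : ((i : Fin (h + 1) × Fin (h + 1)) → BoundedForms n i.2) →L[ℂ] BoundedForms n i.2 :=
      ContinuousLinearMap.proj i
    have hi : Integrable (fun a => weightedDeriv n i.1 i.2 (Ψ a)) μ := P.integrable_comp hint'
    have h1 : ∫ a, weightedDeriv n i.1 i.2 (Ψ a) ∂μ = P (∫ a, weightedDerivs n h (Ψ a) ∂μ) :=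
      P.integral_comp_comm hint'
    rw [weightedDerivs_apply, weightedDeriv_eq_integral hΨ hint hc hi, h1]
    rfl
  rw [← hS c, key, ← S.integral_comp_comm hint']
  exact integral_congr_ae (Eventually.of_forall fun a => hS (Ψ a))

end

end

section

/-! ### Translations, reflections and derivatives of Schwartz functions -/

open LineDeriv

variable {n : ℕ}

/-- The translate `y ↦ f (y - v)`. -/
abbrev translate (v : Rn n) (f : 𝓢(Rn n, ℂ)) : 𝓢(Rn n, ℂ) := SchwartzMap.compSubConstCLM ℂ v f

theorem norm_iteratedFDeriv_schwartzReflect (x y : Rn n) (f : 𝓢(Rn n, ℂ)) (m : ℕ) :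
    ‖iteratedFDeriv ℝ m (schwartzReflect x f) y‖ = ‖iteratedFDeriv ℝ m f (x - y)‖ := by
  have h : (schwartzReflect x f : Rn n → ℂ) =
      fun y => ((f : Rn n → ℂ) ∘ LinearIsometryEquiv.neg ℝ) (y - x) := by
    ext y
    rw [schwartzReflect_apply]
    simp
  rw [h, iteratedFDeriv_comp_sub, LinearIsometryEquiv.norm_iteratedFDeriv_comp_right]
  simp

theorem iteratedFDeriv_translate (v y : Rn n) (f : 𝓢(Rn n, ℂ)) (m : ℕ) :
    iteratedFDeriv ℝ m (translate v f) y = iteratedFDeriv ℝ m f (y - v) :=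
  iteratedFDeriv_comp_sub m v y

theorem schwartzSup_schwartzReflect_le (x : Rn n) (f : 𝓢(Rn n, ℂ)) (h : ℕ) :
    schwartzSup n h (schwartzReflect x f) ≤ 2 ^ h * (1 + ‖x‖) ^ h * schwartzSup n h f := by
  refine schwartzSup_le (by positivity) fun k hk m hm y => ?_
  rw [norm_iteratedFDeriv_schwartzReflect]
  have h1 : ‖y‖ ≤ (1 + ‖x‖) * (1 + ‖x - y‖) := by
    have : ‖y‖ ≤ ‖x‖ + ‖x - y‖ := by simpa using norm_sub_le x (x - y)
    nlinarith [norm_nonneg x, norm_nonneg (x - y), mul_nonneg (norm_nonneg x) (norm_nonneg (x - y))]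
  calc ‖y‖ ^ k * ‖iteratedFDeriv ℝ m f (x - y)‖
      ≤ ((1 + ‖x‖) * (1 + ‖x - y‖)) ^ k * ‖iteratedFDeriv ℝ m f (x - y)‖ := by gcongr
    _ = (1 + ‖x‖) ^ k * ((1 + ‖x - y‖) ^ k * ‖iteratedFDeriv ℝ m f (x - y)‖) := by
        rw [mul_pow]
        ring
    _ ≤ (1 + ‖x‖) ^ h * (2 ^ h * schwartzSup n h f) := by
        refine mul_le_mul ?_ (one_add_pow_le_schwartzSup hk hm f _) (by positivity)
          (by positivity)
        exact pow_le_pow_right₀ (by linarith [norm_nonneg x]) hk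
    _ = _ := by ring

theorem schwartzSup_lineDeriv_le (v : Rn n) (f : 𝓢(Rn n, ℂ)) (h : ℕ) :
    schwartzSup n h (∂_{v} f) ≤ ‖v‖ * schwartzSup n (h + 1) f := by
  refine schwartzSup_le (by positivity) fun k hk m hm y => ?_
  have h1 : ‖iteratedFDeriv ℝ m (∂_{v} f : 𝓢(Rn n, ℂ)) y‖ ≤ ‖v‖ * ‖iteratedFDeriv ℝ (m + 1) f y‖ := by
    rw [← norm_iteratedFDeriv_fderiv]
    refine norm_iteratedFDeriv_clm_apply_const (f := fderiv ℝ f) (N := ((m : ℕ∞) : WithTop ℕ∞))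
      ?_ le_rfl
    exact (SchwartzMap.fderivCLM ℝ (Rn n) ℂ f).contDiffAt m
  calc ‖y‖ ^ k * ‖iteratedFDeriv ℝ m (∂_{v} f : 𝓢(Rn n, ℂ)) y‖
      ≤ ‖y‖ ^ k * (‖v‖ * ‖iteratedFDeriv ℝ (m + 1) f y‖) := by gcongr
    _ = ‖v‖ * (‖y‖ ^ k * ‖iteratedFDeriv ℝ (m + 1) f y‖) := by ring
    _ ≤ _ := by
        gcongr
        exact le_schwartzSup (by omega) (by omega) f y

theorem schwartzSup_iteratedLineDeriv_le {m : ℕ} (v : Fin m → Rn n) (f : 𝓢(Rn n, ℂ)) (h : ℕ) :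
    schwartzSup n h (∂^{v} f) ≤ (∏ i, ‖v i‖) * schwartzSup n (h + m) f := by
  induction m generalizing h with
  | zero => simp
  | succ m ih =>
    rw [iteratedLineDerivOp_succ_left, Fin.prod_univ_succ, mul_assoc]
    refine (schwartzSup_lineDeriv_le _ _ _).trans ?_
    gcongr
    have := ih (Fin.tail v) (h + 1)
    rwa [add_assoc, add_comm 1 m] at this

/-- The mean value inequality for translations. -/
theorem schwartzSup_translate_sub_le {R : ℝ} {v : Rn n} (hv : ‖v‖ ≤ R) (f : 𝓢(Rn n, ℂ)) (h : ℕ) :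
    schwartzSup n h (translate v f - f) ≤
      (1 + R) ^ h * 2 ^ (h + 1) * ‖v‖ * schwartzSup n (h + 1) f := by
  have hR : 0 ≤ R := (norm_nonneg v).trans hv
  refine schwartzSup_le (by positivity) fun k hk m hm y => ?_
  have e : iteratedFDeriv ℝ m (translate v f - f : 𝓢(Rn n, ℂ)) y =
      iteratedFDeriv ℝ m f (y - v) - iteratedFDeriv ℝ m f y := by
    rw [← iteratedFDeriv_translate]
    exact iteratedFDeriv_sub_apply ((translate v f).contDiffAt m) (f.contDiffAt m)
  have hb : ∀ z ∈ segment ℝ y (y - v), ‖fderiv ℝ (iteratedFDeriv ℝ m f) z‖ ≤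
      (1 + R) ^ k * 2 ^ (h + 1) * schwartzSup n (h + 1) f / (1 + ‖y‖) ^ k := by
    intro z hz
    rw [norm_fderiv_iteratedFDeriv, le_div_iff₀ (by positivity)]
    have hz' : ‖y‖ ≤ R + ‖z‖ := by
      obtain ⟨t, ht, rfl⟩ := (segment_eq_image' ℝ y (y - v) ▸ hz :
        z ∈ (fun θ : ℝ => y + θ • (y - v - y)) '' Set.Icc 0 1)
      have h1 : y = t • v + (y + t • (y - v - y)) := by
        rw [show y - v - y = -v by abel, smul_neg]
        abel
      have h2 : ‖t • v‖ ≤ R := by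
        rw [norm_smul, Real.norm_of_nonneg ht.1]
        nlinarith [ht.1, ht.2, norm_nonneg v]
      calc ‖y‖ = ‖t • v + (y + t • (y - v - y))‖ := by rw [← h1]
        _ ≤ ‖t • v‖ + ‖y + t • (y - v - y)‖ := norm_add_le _ _
        _ ≤ _ := by gcongr
    have h3 : 1 + ‖y‖ ≤ (1 + R) * (1 + ‖z‖) := by
      nlinarith [norm_nonneg z, mul_nonneg hR (norm_nonneg z)]
    calc ‖iteratedFDeriv ℝ (m + 1) f z‖ * (1 + ‖y‖) ^ k
        ≤ ‖iteratedFDeriv ℝ (m + 1) f z‖ * ((1 + R) * (1 + ‖z‖)) ^ k := by gcongr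
      _ = (1 + R) ^ k * ((1 + ‖z‖) ^ k * ‖iteratedFDeriv ℝ (m + 1) f z‖) := by
          rw [mul_pow]
          ring
      _ ≤ (1 + R) ^ k * (2 ^ (h + 1) * schwartzSup n (h + 1) f) :=
          mul_le_mul_of_nonneg_left (one_add_pow_le_schwartzSup (by omega) (by omega) f z)
            (by positivity)
      _ = _ := by ring
  have hmv := (convex_segment y (y - v)).norm_image_sub_le_of_norm_fderiv_le
    (𝕜 := ℝ) (f := iteratedFDeriv ℝ m f)
    (fun z _ => ((f.smooth ⊤).differentiable_iteratedFDeriv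
      (by exact_mod_cast ENat.natCast_lt_top m)) z) hb
    (left_mem_segment ℝ y (y - v)) (right_mem_segment ℝ y (y - v))
  rw [sub_sub_cancel_left, norm_neg] at hmv
  rw [e]
  calc ‖y‖ ^ k * ‖iteratedFDeriv ℝ m f (y - v) - iteratedFDeriv ℝ m f y‖
      ≤ (1 + ‖y‖) ^ k * ((1 + R) ^ k * 2 ^ (h + 1) * schwartzSup n (h + 1) f / (1 + ‖y‖) ^ k *
          ‖v‖) := by
        gcongr
        linarith
    _ = (1 + R) ^ k * 2 ^ (h + 1) * ‖v‖ * schwartzSup n (h + 1) f := by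
        field_simp
    _ ≤ _ := by
        gcongr ?_ * _ * _ * _
        exact pow_le_pow_right₀ (by linarith) hk

theorem schwartzReflect_add (x v : Rn n) (f : 𝓢(Rn n, ℂ)) :
    schwartzReflect (x + v) f = translate v (schwartzReflect x f) := by
  ext y
  simp only [SchwartzMap.compSubConstCLM_apply, schwartzReflect_apply]
  congr 1
  abel

theorem lineDeriv_schwartzReflect (x v : Rn n) (f : 𝓢(Rn n, ℂ)) :
    ∂_{v} (schwartzReflect x f) = -schwartzReflect x (∂_{v} f) := by
  ext y
  rw [SchwartzMap.lineDerivOp_apply_eq_fderiv, neg_apply, schwartzReflect_apply,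
    SchwartzMap.lineDerivOp_apply_eq_fderiv]
  have h : (schwartzReflect x f : Rn n → ℂ) = fun y => f (x - y) := by
    ext y
    rw [schwartzReflect_apply]
  have h' := (f.hasFDerivAt (x - y)).comp y ((hasFDerivAt_id y).const_sub x)
  have h'' : HasFDerivAt (fun y => f (x - y)) _ y := h'
  rw [h, h''.fderiv]
  simp

theorem continuous_translate {α : Type*} [TopologicalSpace α] {v : α → Rn n} (hv : Continuous v)
    (f : 𝓢(Rn n, ℂ)) : Continuous fun a => translate (v a) f := by
  refine continuous_iff_continuousAt.2 fun a => ?_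
  refine ((schwartz_withSeminorms ℂ (Rn n) ℂ).tendsto_nhds _ _).2 fun i r hr => ?_
  set h := max i.1 i.2
  set K := (1 + 1) ^ h * 2 ^ (h + 1) * schwartzSup n (h + 1) (translate (v a) f) with hK
  have hK0 : 0 ≤ K := by positivity
  have h1 : Tendsto (fun b => ‖v b - v a‖) (𝓝 a) (𝓝 0) := by
    have := (hv.tendsto a).sub_const (v a)
    rw [sub_self] at this
    simpa using this.norm
  filter_upwards [h1.eventually (gt_mem_nhds (show (0 : ℝ) < min 1 (r / (K + 1)) by positivity))]
    with b hb
  have hb1 := hb.le.trans (min_le_left _ _)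
  have hb2 : ‖v b - v a‖ < r / (K + 1) := hb.trans_le (min_le_right _ _)
  have e : translate (v b) f = translate (v b - v a) (translate (v a) f) := by
    rw [translate, translate, translate, SchwartzMap.compSubConstCLM_comp, add_sub_cancel]
  rw [e]
  refine lt_of_le_of_lt ?_ (lt_of_le_of_lt
    (schwartzSup_translate_sub_le hb1 (translate (v a) f) h) ?_)
  · refine SchwartzMap.seminorm_le_bound ℂ _ _ _ (apply_nonneg _ _) fun x => ?_
    exact le_schwartzSup (le_max_left _ _) (le_max_right _ _) _ x
  · rw [lt_div_iff₀ (by positivity)] at hb2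
    have : (1 + 1 : ℝ) ^ h * 2 ^ (h + 1) * ‖v b - v a‖ *
      schwartzSup n (h + 1) (translate (v a) f) = ‖v b - v a‖ * K := by rw [hK]; ring
    rw [this]
    nlinarith [norm_nonneg (v b - v a)]

theorem continuous_schwartzReflect (f : 𝓢(Rn n, ℂ)) : Continuous fun x => schwartzReflect x f := by
  have : (fun x => schwartzReflect x f) = fun x => translate x (schwartzReflect 0 f) := by
    ext1 x
    rw [← schwartzReflect_add, zero_add]
  rw [this]
  exact continuous_translate continuous_id _

theorem continuous_schwartzSup (h : ℕ) : Continuous (schwartzSup n h) := by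
  exact Seminorm.continuous_finsetSup fun i _ =>
    (schwartz_withSeminorms ℂ (Rn n) ℂ).continuous_seminorm i

theorem schwartzReflect_map_add (x : Rn n) (f g : 𝓢(Rn n, ℂ)) :
    schwartzReflect x (f + g) = schwartzReflect x f + schwartzReflect x g := by
  ext y
  simp [schwartzReflect_apply]

theorem schwartzReflect_map_sub (x : Rn n) (f g : 𝓢(Rn n, ℂ)) :
    schwartzReflect x (f - g) = schwartzReflect x f - schwartzReflect x g := by
  ext y
  simp [schwartzReflect_apply]

theorem schwartzReflect_map_smul (x : Rn n) (r : ℝ) (f : 𝓢(Rn n, ℂ)) :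
    schwartzReflect x (r • f) = r • schwartzReflect x f := by
  ext y
  simp [schwartzReflect_apply]

/-! ### Convolution of a tempered functional and a Schwartz function -/

section Functional

variable {T : 𝓢(Rn n, ℂ) →ₗ[ℂ] ℂ} {C : ℝ} {h : ℕ}

/-- First order Taylor estimate for translations, tested with a tempered functional. -/
theorem norm_map_translate_sub_add_le (hT : ∀ φ, ‖T φ‖ ≤ C * schwartzSup n h φ) {v : Rn n}
    (hv : ‖v‖ ≤ 1) (φ : 𝓢(Rn n, ℂ)) : ‖T (translate v φ - φ + ∂_{v} φ)‖ ≤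
      |C| * ((1 + 1) ^ h * 2 ^ (h + 1) * schwartzSup n (h + 2) φ) * ‖v‖ ^ 2 := by
  set Ψ : ℝ → 𝓢(Rn n, ℂ) := fun t => ∂_{v} φ - translate (t • v) (∂_{v} φ) with hΨdef
  have hΨ : Continuous Ψ := continuous_const.sub
    (continuous_translate (continuous_id.smul continuous_const) _)
  have hc : ∀ y, (translate v φ - φ + ∂_{v} φ) y = ∫ t in Set.Ioc (0 : ℝ) 1, Ψ t y := by
    intro y
    have hd : ∀ t : ℝ, HasDerivAt (fun t : ℝ => t • (∂_{v} φ) y + φ (y - t • v)) (Ψ t y) t := by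
      intro t
      have h1 : HasDerivAt (fun t : ℝ => y - t • v) (-((1 : ℝ) • v)) t :=
        ((hasDerivAt_id t).smul_const v).const_sub y
      have h2 := (φ.hasFDerivAt (y - t • v)).comp_hasDerivAt t h1
      have h3 := ((hasDerivAt_id t).smul_const ((∂_{v} φ) y)).add h2
      refine h3.congr_deriv ?_
      simp [hΨdef, SchwartzMap.lineDerivOp_apply_eq_fderiv, sub_eq_add_neg]
    have hcont : Continuous fun t => Ψ t y := by
      simp only [hΨdef, sub_apply, SchwartzMap.compSubConstCLM_apply]
      exact continuous_const.sub ((∂_{v} φ).continuous.comp (by fun_prop))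
    have := intervalIntegral.integral_eq_sub_of_hasDerivAt (a := 0) (b := 1) (fun t _ => hd t)
      (hcont.intervalIntegrable _ _)
    rw [← intervalIntegral.integral_of_le zero_le_one, this]
    simp
    ring
  have hint : ∀ h, Integrable (fun t => schwartzSup n h (Ψ t))
      (volume.restrict (Set.Ioc (0 : ℝ) 1)) := fun h =>
    ((continuous_schwartzSup h).comp hΨ).integrableOn_Ioc
  rw [map_integral_eq_integral_map hT hΨ hint hc]
  have hb : ∀ t ∈ Set.Ioc (0 : ℝ) 1, ‖T (Ψ t)‖ ≤
      |C| * ((1 + 1) ^ h * 2 ^ (h + 1) * schwartzSup n (h + 2) φ) * ‖v‖ ^ 2 := by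
    intro t ht
    have htv : ‖t • v‖ ≤ ‖v‖ := by
      rw [norm_smul, Real.norm_of_nonneg ht.1.le]
      exact mul_le_of_le_one_left (norm_nonneg v) ht.2
    have h1 := schwartzSup_translate_sub_le (htv.trans hv) (∂_{v} φ) h
    have h2 := schwartzSup_lineDeriv_le v φ (h + 1)
    have h3 : schwartzSup n h (Ψ t) = schwartzSup n h (translate (t • v) (∂_{v} φ) - ∂_{v} φ) :=
      map_sub_rev _ _ _
    calc ‖T (Ψ t)‖ ≤ |C| * schwartzSup n h (Ψ t) :=
          (hT _).trans (mul_le_mul_of_nonneg_right (le_abs_self C) (apply_nonneg _ _))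
      _ ≤ |C| * ((1 + 1) ^ h * 2 ^ (h + 1) * ‖v‖ * (‖v‖ * schwartzSup n (h + 2) φ)) := by
          rw [h3]
          refine mul_le_mul_of_nonneg_left (h1.trans ?_) (abs_nonneg C)
          gcongr
      _ = _ := by ring
  have := norm_setIntegral_le_of_norm_le_const (μ := volume) (s := Set.Ioc (0 : ℝ) 1)
    (by simp) hb
  simpa using this

theorem hasFDerivAt_map_schwartzReflect (hT : ∀ φ, ‖T φ‖ ≤ C * schwartzSup n h φ)
    (f : 𝓢(Rn n, ℂ)) (x : Rn n) : ∃ L : Rn n →L[ℝ] ℂ,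
      (∀ v, L v = T (schwartzReflect x (∂_{v} f))) ∧
      HasFDerivAt (fun x => T (schwartzReflect x f)) L x := by
  let L₀ : Rn n →ₗ[ℝ] ℂ :=
    { toFun := fun v => T (schwartzReflect x (∂_{v} f))
      map_add' := fun v w => by rw [lineDerivOp_left_add, schwartzReflect_map_add, map_add]
      map_smul' := fun r v => by
        rw [lineDerivOp_left_smul, schwartzReflect_map_smul, T.map_smul_of_tower, RingHom.id_apply] }
  refine ⟨L₀.toContinuousLinearMap, fun v => rfl, ?_⟩
  rw [hasFDerivAt_iff_isLittleO_nhds_zero]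
  set φ := schwartzReflect x f with hφ
  set K := |C| * ((1 + 1) ^ h * 2 ^ (h + 1) * schwartzSup n (h + 2) φ)
  have hO : (fun v => T (schwartzReflect (x + v) f) - T (schwartzReflect x f) -
      L₀.toContinuousLinearMap v) =O[𝓝 0] fun v => ‖v‖ ^ 2 := by
    refine Asymptotics.IsBigO.of_bound K ?_
    filter_upwards [Metric.closedBall_mem_nhds (0 : Rn n) one_pos] with v hv
    have e : T (schwartzReflect (x + v) f) - T (schwartzReflect x f) -
        L₀.toContinuousLinearMap v = T (translate v φ - φ + ∂_{v} φ) := by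
      change _ - _ - T (schwartzReflect x (∂_{v} f)) = _
      rw [hφ, lineDeriv_schwartzReflect, schwartzReflect_add, map_add, map_sub, map_neg,
        sub_eq_add_neg _ (T (schwartzReflect x (∂_{v} f)))]
    rw [e, norm_pow, norm_norm]
    exact norm_map_translate_sub_add_le hT (by simpa using hv) φ
  refine hO.trans_isLittleO ?_
  have := Asymptotics.isLittleO_norm_pow_id (E' := Rn n) one_lt_two
  exact this

theorem fderiv_map_schwartzReflect (hT : ∀ φ, ‖T φ‖ ≤ C * schwartzSup n h φ)
    (f : 𝓢(Rn n, ℂ)) (x v : Rn n) : fderiv ℝ (fun x => T (schwartzReflect x f)) x v =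
      T (schwartzReflect x (∂_{v} f)) := by
  obtain ⟨L, hL, hd⟩ := hasFDerivAt_map_schwartzReflect hT f x
  rw [hd.fderiv, hL]

theorem contDiff_map_schwartzReflect (hT : ∀ φ, ‖T φ‖ ≤ C * schwartzSup n h φ)
    (f : 𝓢(Rn n, ℂ)) :
    ContDiff ℝ ((⊤ : ℕ∞) : WithTop ℕ∞) fun x => T (schwartzReflect x f) := by
  refine contDiff_infty.2 fun m => ?_
  induction m generalizing f with
  | zero =>
    refine contDiff_zero.2 (continuous_iff_continuousAt.2 fun x => ?_)
    obtain ⟨L, -, hd⟩ := hasFDerivAt_map_schwartzReflect hT f x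
    exact hd.continuousAt
  | succ m ih =>
    push_cast
    refine contDiff_succ_iff_fderiv_apply.2 ⟨fun x => ?_, by simp, fun v => ?_⟩
    · obtain ⟨L, -, hd⟩ := hasFDerivAt_map_schwartzReflect hT f x
      exact hd.differentiableAt
    · simp only [fderiv_map_schwartzReflect hT]
      exact ih _

theorem iteratedFDeriv_map_schwartzReflect (hT : ∀ φ, ‖T φ‖ ≤ C * schwartzSup n h φ)
    (f : 𝓢(Rn n, ℂ)) {m : ℕ} (x : Rn n) (v : Fin m → Rn n) :
    iteratedFDeriv ℝ m (fun x => T (schwartzReflect x f)) x v =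
      T (schwartzReflect x (∂^{v} f)) := by
  induction m generalizing x with
  | zero => simp
  | succ m ih =>
    rw [iteratedFDeriv_succ_apply_left, ← fderiv_continuousMultilinear_apply_const_apply]
    · simp only [ih]
      rw [fderiv_map_schwartzReflect hT, iteratedLineDerivOp_succ_left]
    · exact (contDiff_map_schwartzReflect hT f).differentiable_iteratedFDeriv
        (mod_cast ENat.natCast_lt_top m) x

theorem norm_iteratedFDeriv_map_schwartzReflect_le (hT : ∀ φ, ‖T φ‖ ≤ C * schwartzSup n h φ)
    (f : 𝓢(Rn n, ℂ)) (m : ℕ) (x : Rn n) :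
    ‖iteratedFDeriv ℝ m (fun x => T (schwartzReflect x f)) x‖ ≤
      |C| * (2 ^ h * (1 + ‖x‖) ^ h * schwartzSup n (h + m) f) := by
  refine ContinuousMultilinearMap.opNorm_le_bound (by positivity) fun v => ?_
  rw [iteratedFDeriv_map_schwartzReflect hT]
  calc ‖T (schwartzReflect x (∂^{v} f))‖
      ≤ |C| * schwartzSup n h (schwartzReflect x (∂^{v} f)) :=
        (hT _).trans (mul_le_mul_of_nonneg_right (le_abs_self C) (apply_nonneg _ _))
    _ ≤ |C| * (2 ^ h * (1 + ‖x‖) ^ h * ((∏ i, ‖v i‖) * schwartzSup n (h + m) f)) := by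
        gcongr
        refine (schwartzSup_schwartzReflect_le _ _ _).trans ?_
        gcongr
        exact schwartzSup_iteratedLineDeriv_le v f h
    _ = _ := by ring

/-- Associativity of the convolution of a functional and two Schwartz functions. -/
theorem exists_convolution_eq (hT : ∀ φ, ‖T φ‖ ≤ C * schwartzSup n h φ) (f g : 𝓢(Rn n, ℂ)) :
    ∃ c : 𝓢(Rn n, ℂ), (∀ y, c y = ∫ x, f x * g (x - y)) ∧
      T c = ∫ x, T (schwartzReflect x g) * f x := by
  set c := SchwartzMap.convolution (ContinuousLinearMap.mul ℂ ℂ) f (schwartzReflect 0 g)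
  have hc : ∀ y, c y = ∫ x, f x * g (x - y) := fun y => by
    refine (SchwartzMap.convolution_apply _ _ _ _).trans ?_
    simp [convolution, schwartzReflect_apply]
  refine ⟨c, hc, ?_⟩
  have hΨ : Continuous fun x => f x • schwartzReflect x g :=
    f.continuous.smul (continuous_schwartzReflect g)
  rw [map_integral_eq_integral_map hT hΨ (μ := volume)]
  · simp [mul_comm]
  · intro h
    have hi : Integrable (fun x => 2 ^ h * schwartzSup n h g *
        (2 ^ (h - 1) * (‖x‖ ^ 0 * ‖f x‖ + ‖x‖ ^ h * ‖f x‖))) :=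
      (((f.integrable_pow_mul volume 0).add (f.integrable_pow_mul volume h)).const_mul _).const_mul _
    refine hi.mono' ((continuous_schwartzSup h).comp hΨ).aestronglyMeasurable
      (Eventually.of_forall fun x => ?_)
    rw [Real.norm_of_nonneg (apply_nonneg _ _), map_smul_eq_mul]
    have h1 := schwartzSup_schwartzReflect_le x g h
    have h2 : (1 + ‖x‖) ^ h ≤ 2 ^ (h - 1) * (1 ^ h + ‖x‖ ^ h) :=
      add_pow_le zero_le_one (norm_nonneg x) h
    calc ‖f x‖ * schwartzSup n h (schwartzReflect x g)
        ≤ ‖f x‖ * (2 ^ h * (2 ^ (h - 1) * (1 ^ h + ‖x‖ ^ h)) * schwartzSup n h g) := by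
          gcongr
          refine h1.trans ?_
          gcongr
      _ = _ := by ring
  · intro y
    rw [hc]
    simp [schwartzReflect_apply]

/-- Regularization by `ρ_δ` changes the value of a tempered functional by `O(δ)`. -/
theorem norm_integral_map_scale_sub_le (hT : ∀ φ, ‖T φ‖ ≤ C * schwartzSup n h φ) {ρ : Test n}
    (hρ : ∫ y, ρ y = 1) {R : ℝ} (hR : ∀ y ∈ tsupport ρ, ‖y‖ ≤ R) {δ : ℝ} (hδ : 0 < δ)
    (hδ1 : δ ≤ 1) (f : 𝓢(Rn n, ℂ)) :
    ‖(∫ x, T (schwartzReflect x (scale ρ δ hδ).toSchwartz) * f x) - T f‖ ≤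
      |C| * ((1 + R) ^ h * 2 ^ (h + 1) * R * ∫ y, ‖ρ y‖) * δ * schwartzSup n (h + 1) f := by
  obtain ⟨c, hc, hTc⟩ := exists_convolution_eq hT f (scale ρ δ hδ).toSchwartz
  rw [← hTc, ← map_sub]
  -- As `∫ ρ = 1`, the regularization of `f` minus `f` is `∫ ρ z (f (· + δ z) - f) dz`.
  set Ψ : Rn n → 𝓢(Rn n, ℂ) := fun z => ρ z • (translate (-(δ • z)) f - f)
  have hΨ : Continuous Ψ := ρ.continuous.smul
    ((continuous_translate (continuous_id.const_smul δ).neg f).sub continuous_const)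
  have hint : ∀ h, Integrable (fun z => schwartzSup n h (Ψ z)) := fun h => by
    refine ((continuous_schwartzSup h).comp hΨ).integrable_of_hasCompactSupport ?_
    refine ρ.hasCompactSupport.mono fun z hz => ?_
    contrapose! hz
    simp only [Function.mem_support, not_not] at hz ⊢
    simp [Ψ, hz]
  have hρi : Integrable ρ := ρ.continuous.integrable_of_hasCompactSupport ρ.hasCompactSupport
  have hc' : ∀ y, (c - f) y = ∫ z, Ψ z y := fun y => by
    have e1 : ∫ x, f x * (scale ρ δ hδ).toSchwartz (x - y) = ∫ z, ρ z * f (y + δ • z) := by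
      have h1 : ∫ x, f x * (scale ρ δ hδ).toSchwartz (x - y) =
          ∫ x, f (x + y) * (scale ρ δ hδ).toSchwartz x := by
        rw [← integral_add_right_eq_self (fun x => f x * (scale ρ δ hδ).toSchwartz (x - y)) y]
        simp
      have h2 := Measure.integral_comp_inv_smul (μ := (volume : Measure (Rn n)))
        (fun z => ρ z * f (y + δ • z)) δ
      have h3 : ∀ x : Rn n, f (x + y) * (scale ρ δ hδ).toSchwartz x =
          ((δ ^ n)⁻¹ : ℝ) • (ρ (δ⁻¹ • x) * f (y + δ • δ⁻¹ • x)) := fun x => by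
        rw [smul_inv_smul₀ hδ.ne', add_comm y x]
        change f (x + y) * (((δ ^ n)⁻¹ : ℝ) • ρ (δ⁻¹ • x)) = _
        rw [mul_smul_comm, mul_comm]
      rw [h1]
      simp only [h3]
      rw [integral_smul, h2, finrank_euclideanSpace, Fintype.card_fin, abs_of_pos (by positivity),
        inv_smul_smul₀ (by positivity)]
    have e2 : ∀ z, Ψ z y = ρ z * f (y + δ • z) - ρ z * f y := fun z => by
      simp [Ψ, mul_sub]
    have hi : Integrable fun z => ρ z * f (y + δ • z) :=
      (ρ.continuous.mul (f.continuous.comp (by fun_prop))).integrable_of_hasCompactSupport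
        ρ.hasCompactSupport.mul_right
    simp only [e2]
    rw [integral_sub hi (hρi.mul_const _), integral_mul_const, hρ, sub_apply, hc, e1, one_mul]
  rw [map_integral_eq_integral_map hT hΨ hint hc']
  have hb : ∀ z, ‖T (Ψ z)‖ ≤
      |C| * ((1 + R) ^ h * 2 ^ (h + 1) * R) * δ * schwartzSup n (h + 1) f * ‖ρ z‖ := by
    intro z
    by_cases hz : z ∈ tsupport ρ
    · have hzR := hR z hz
      have h1 : ‖-(δ • z)‖ ≤ δ * R := by
        rw [norm_neg, norm_smul, Real.norm_of_nonneg hδ.le]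
        gcongr
      have h2 : δ * R ≤ R := mul_le_of_le_one_left ((norm_nonneg z).trans hzR) hδ1
      have hR0 : 0 ≤ R := (norm_nonneg z).trans hzR
      calc ‖T (Ψ z)‖ ≤ |C| * schwartzSup n h (Ψ z) :=
            (hT _).trans (mul_le_mul_of_nonneg_right (le_abs_self C) (apply_nonneg _ _))
        _ = |C| * (‖ρ z‖ * schwartzSup n h (translate (-(δ • z)) f - f)) := by
            rw [map_smul_eq_mul]
        _ ≤ |C| * (‖ρ z‖ * ((1 + R) ^ h * 2 ^ (h + 1) * (δ * R) * schwartzSup n (h + 1) f)) := by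
            gcongr
            refine (schwartzSup_translate_sub_le (h1.trans h2) f h).trans ?_
            gcongr
        _ = _ := by ring
    · have : ρ z = 0 := image_eq_zero_of_notMem_tsupport hz
      simp [Ψ, this]
  refine (norm_integral_le_of_norm_le (hρi.norm.const_mul _)
    (Eventually.of_forall hb)).trans (le_of_eq ?_)
  rw [integral_const_mul]
  ring

end Functional

end

section

/-! ### Nets of tempered functionals -/

open LineDeriv

variable {n : ℕ}

/-- Nets of tempered functionals that are bounded by `ε ^ (-N)` times a Schwartz seminorm for
small `ε`. -/
def TemperedNet (T : Eps → 𝓢(Rn n, ℂ) →ₗ[ℂ] ℂ) : Prop :=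
  (∀ ε, ∃ (h : ℕ) (C : ℝ), ∀ φ, ‖T ε φ‖ ≤ C * schwartzSup n h φ) ∧
  ∃ (h N : ℕ) (C : ℝ), 0 ≤ C ∧ ∀ᶠ ε : Eps in toZero, ∀ φ,
    ‖T ε φ‖ ≤ C * ((ε : ℝ) ^ N)⁻¹ * schwartzSup n h φ

/-- The condition that defines `negligibleTau`. -/
def TauNegligible (g : Eps → Rn n → ℂ) : Prop :=
  ∀ m : ℕ, ∃ N : ℕ, ∀ q : ℕ, ∃ C : ℝ, ∀ᶠ ε in toZero, ∀ x,
    ‖iteratedFDeriv ℝ m (g ε) x‖ ≤ C * (1 + ‖x‖) ^ N * (ε : ℝ) ^ q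

theorem finset_sup_schwartzSup_le (s : Finset ℕ) (φ : 𝓢(Rn n, ℂ)) :
    s.sup (schwartzSup n) φ ≤ schwartzSup n (s.sup id) φ :=
  Seminorm.finset_sup_apply_le (apply_nonneg _ _) fun _ hi =>
    schwartzSup_mono (Finset.le_sup (f := id) hi) φ

theorem ModerateFunctionalNet.temperedNet {T : Eps → 𝓢(Rn n, ℂ) →ₗ[ℂ] ℂ}
    (hT : ModerateFunctionalNet (schwartzSup n) T) : TemperedNet T := by
  obtain ⟨h1, s, N, η, h2⟩ := hT
  refine ⟨fun ε => ?_, s.sup id, N, 1, zero_le_one, ?_⟩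
  · obtain ⟨s, C, h⟩ := h1 ε
    refine ⟨s.sup id, |C|, fun φ => (h φ).trans ?_⟩
    exact mul_le_mul (le_abs_self C) (finset_sup_schwartzSup_le s φ) (apply_nonneg _ _)
      (abs_nonneg C)
  · filter_upwards [eventually_le η] with ε hε φ
    have h0 := eps_pos ε
    rw [one_mul]
    refine (h2 φ ε hε).trans ?_
    gcongr
    exact finset_sup_schwartzSup_le s φ

theorem TemperedNet.sub {T T' : Eps → 𝓢(Rn n, ℂ) →ₗ[ℂ] ℂ} (hT : TemperedNet T)
    (hT' : TemperedNet T') : TemperedNet fun ε => T ε - T' ε := by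
  obtain ⟨h1, h, N, C, hC, h2⟩ := hT
  obtain ⟨h1', h', N', C', hC', h2'⟩ := hT'
  refine ⟨fun ε => ?_, max h h', max N N', C + C', add_nonneg hC hC', ?_⟩
  · obtain ⟨k, D, hk⟩ := h1 ε
    obtain ⟨k', D', hk'⟩ := h1' ε
    refine ⟨max k k', |D| + |D'|, fun φ => (norm_sub_le _ _).trans ?_⟩
    rw [add_mul]
    refine add_le_add ((hk φ).trans ?_) ((hk' φ).trans ?_)
    · exact mul_le_mul (le_abs_self _) (schwartzSup_mono (le_max_left _ _) φ) (apply_nonneg _ _)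
        (abs_nonneg _)
    · exact mul_le_mul (le_abs_self _) (schwartzSup_mono (le_max_right _ _) φ) (apply_nonneg _ _)
        (abs_nonneg _)
  · filter_upwards [h2, h2'] with ε h2 h2' φ
    have h0 := eps_pos ε
    refine (norm_sub_le _ _).trans ?_
    rw [add_mul, add_mul]
    refine add_le_add ((h2 φ).trans ?_) ((h2' φ).trans ?_)
    · exact mul_le_mul (mul_le_mul_of_nonneg_left (inv_eps_pow_mono ε (le_max_left _ _)) hC)
        (schwartzSup_mono (le_max_left _ _) φ) (apply_nonneg _ _) (by positivity)
    · exact mul_le_mul (mul_le_mul_of_nonneg_left (inv_eps_pow_mono ε (le_max_right _ _)) hC')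
        (schwartzSup_mono (le_max_right _ _) φ) (apply_nonneg _ _) (by positivity)

theorem TauNegligible.add {f g : Eps → Rn n → ℂ} (hf : TauNegligible f) (hg : TauNegligible g)
    (hf' : ∀ ε, ContDiff ℝ ((⊤ : ℕ∞) : WithTop ℕ∞) (f ε))
    (hg' : ∀ ε, ContDiff ℝ ((⊤ : ℕ∞) : WithTop ℕ∞) (g ε)) :
    TauNegligible fun ε => f ε + g ε := by
  intro m
  obtain ⟨N, hN⟩ := hf m
  obtain ⟨M, hM⟩ := hg m
  refine ⟨max N M, fun q => ?_⟩
  obtain ⟨C, hC⟩ := hN q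
  obtain ⟨D, hD⟩ := hM q
  refine ⟨|C| + |D|, ?_⟩
  filter_upwards [hC, hD] with ε hC hD x
  have hm : ((m : ℕ∞) : WithTop ℕ∞) ≤ ((⊤ : ℕ∞) : WithTop ℕ∞) := by exact_mod_cast le_top
  have e := iteratedFDeriv_add_apply (x := x) ((hf' ε).of_le hm).contDiffAt
    ((hg' ε).of_le hm).contDiffAt
  have h0 := eps_pos ε
  have key : ∀ (A : ℝ) (k : ℕ), k ≤ max N M → A * (1 + ‖x‖) ^ k * (ε : ℝ) ^ q ≤
      |A| * (1 + ‖x‖) ^ max N M * (ε : ℝ) ^ q := by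
    intro A k hk
    gcongr
    · exact le_abs_self A
    · linarith [norm_nonneg x]
  refine (congrArg norm e).le.trans ((norm_add_le _ _).trans ?_)
  rw [add_mul, add_mul]
  exact add_le_add ((hC x).trans (key C N (le_max_left _ _)))
    ((hD x).trans (key D M (le_max_right _ _)))

theorem TemperedNet.contDiff {T : Eps → 𝓢(Rn n, ℂ) →ₗ[ℂ] ℂ} (hT : TemperedNet T)
    (f : Eps → 𝓢(Rn n, ℂ)) (ε : Eps) :
    ContDiff ℝ ((⊤ : ℕ∞) : WithTop ℕ∞) fun x => T ε (schwartzReflect x (f ε)) := by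
  obtain ⟨h, C, hC⟩ := hT.1 ε
  exact contDiff_map_schwartzReflect hC (f ε)

theorem TemperedNet.mem_moderateTau {T : Eps → 𝓢(Rn n, ℂ) →ₗ[ℂ] ℂ} (hT : TemperedNet T)
    {f : Eps → 𝓢(Rn n, ℂ)} (hf : f ∈ moderate (schwartzSup n)) :
    (fun ε x => T ε (schwartzReflect x (f ε))) ∈ moderateTau n := by
  refine ⟨fun ε => ⟨hT.contDiff f ε, fun m => ?_⟩, fun m => ?_⟩
  · obtain ⟨h, C, hC⟩ := hT.1 ε
    refine ⟨h, |C| * (2 ^ h * schwartzSup n (h + m) (f ε)), fun x => ?_⟩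
    refine (norm_iteratedFDeriv_map_schwartzReflect_le hC (f ε) m x).trans (le_of_eq ?_)
    ring
  · obtain ⟨h, N, C, hC, hb⟩ := hT.2
    obtain ⟨M, D, hD, hfb⟩ := (moderateNet_iff fun _ => apply_nonneg _ _).1 (hf (h + m))
    refine ⟨h + (N + M), C * (2 ^ h * D), ?_⟩
    filter_upwards [hb, hfb] with ε hb hfb x
    have h0 := eps_pos ε
    refine (norm_iteratedFDeriv_map_schwartzReflect_le hb (f ε) m x).trans ?_
    rw [abs_of_nonneg (by positivity)]
    calc C * ((ε : ℝ) ^ N)⁻¹ * (2 ^ h * (1 + ‖x‖) ^ h * schwartzSup n (h + m) (f ε))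
        ≤ C * ((ε : ℝ) ^ N)⁻¹ * (2 ^ h * (1 + ‖x‖) ^ h * (D * ((ε : ℝ) ^ M)⁻¹)) := by gcongr
      _ = C * (2 ^ h * D) * (1 + ‖x‖) ^ h * ((ε : ℝ) ^ (N + M))⁻¹ := by
          rw [pow_add, mul_inv]
          ring
      _ ≤ _ := by
          gcongr ?_ * ?_ * ?_
          · exact pow_le_pow_right₀ (by linarith [norm_nonneg x]) (by omega)
          · exact inv_eps_pow_mono ε (by omega)

theorem TemperedNet.tauNegligible_of_negligible {T : Eps → 𝓢(Rn n, ℂ) →ₗ[ℂ] ℂ}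
    (hT : TemperedNet T) {f : Eps → 𝓢(Rn n, ℂ)}
    (hf : ∀ h, NegligibleNet fun ε => schwartzSup n h (f ε)) :
    TauNegligible fun ε x => T ε (schwartzReflect x (f ε)) := by
  intro m
  obtain ⟨h, N, C, hC, hb⟩ := hT.2
  refine ⟨h, fun q => ?_⟩
  obtain ⟨D, hD, hfb⟩ := (negligibleNet_iff fun _ => apply_nonneg _ _).1 (hf (h + m)) (N + q)
  refine ⟨C * (2 ^ h * D), ?_⟩
  filter_upwards [hb, hfb] with ε hb hfb x
  have h0 := eps_pos ε
  refine (norm_iteratedFDeriv_map_schwartzReflect_le hb (f ε) m x).trans ?_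
  rw [abs_of_nonneg (by positivity)]
  calc C * ((ε : ℝ) ^ N)⁻¹ * (2 ^ h * (1 + ‖x‖) ^ h * schwartzSup n (h + m) (f ε))
      ≤ C * ((ε : ℝ) ^ N)⁻¹ * (2 ^ h * (1 + ‖x‖) ^ h * (D * (ε : ℝ) ^ (N + q))) := by gcongr
    _ = C * (2 ^ h * D) * (1 + ‖x‖) ^ h * (ε : ℝ) ^ q := by
        rw [pow_add]
        field_simp

theorem opNorm_le_of_unit {m : ℕ} (A : ContinuousMultilinearMap ℝ (fun _ : Fin m => Rn n) ℂ)
    {M : ℝ} (hM : 0 ≤ M) (h : ∀ v, (∀ i, ‖v i‖ ≤ 1) → ‖A v‖ ≤ M) : ‖A‖ ≤ M := by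
  refine ContinuousMultilinearMap.opNorm_le_bound hM fun v => ?_
  by_cases hv : ∃ i, v i = 0
  · obtain ⟨i, hi⟩ := hv
    rw [A.map_coord_zero i hi, norm_zero]
    positivity
  · push Not at hv
    have hv' : ∀ i, ‖v i‖ ≠ 0 := fun i => norm_ne_zero_iff.2 (hv i)
    have e : v = fun i => ‖v i‖ • (‖v i‖⁻¹ • v i) := by
      ext1 i
      rw [smul_inv_smul₀ (hv' i)]
    have h1 : ‖A fun i => ‖v i‖⁻¹ • v i‖ ≤ M := h _ fun i => by
      rw [norm_smul, norm_inv, norm_norm, inv_mul_cancel₀ (hv' i)]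
    calc ‖A v‖ = ‖A fun i => ‖v i‖ • (‖v i‖⁻¹ • v i)‖ := by rw [← e]
      _ = (∏ i, ‖v i‖) * ‖A fun i => ‖v i‖⁻¹ • v i‖ := by
          rw [A.map_smul_univ, norm_smul, Real.norm_of_nonneg (by positivity)]
      _ ≤ _ := by
          rw [mul_comm]
          gcongr

/-- If a tempered net maps moderate nets to negligible nets, then its convolution with a moderate
net is negligible. For `‖x‖ ≤ ε ^ (-k)` one tests with a worst point and worst directions; for
larger `‖x‖` one additional power of `1 + ‖x‖` compensates every power of `ε`. -/
theorem TemperedNet.tauNegligible_of_map_negligible {T : Eps → 𝓢(Rn n, ℂ) →ₗ[ℂ] ℂ}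
    (hT : TemperedNet T)
    (hneg : ∀ f ∈ moderate (schwartzSup n), NegligibleNet fun ε => ‖T ε (f ε)‖)
    {f : Eps → 𝓢(Rn n, ℂ)} (hf : f ∈ moderate (schwartzSup n)) :
    TauNegligible fun ε x => T ε (schwartzReflect x (f ε)) := by
  intro m
  obtain ⟨h, N, C, hC, hb⟩ := hT.2
  obtain ⟨M, D, hD, hfb⟩ := (moderateNet_iff fun _ => apply_nonneg _ _).1 (hf (h + m))
  refine ⟨h + 1, fun q => ?_⟩
  set k := q + (N + M) with hk
  -- A point and unit directions at which the bound `ε ^ q` fails, if there are any.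
  have hch : ∀ ε : Eps, ∃ (x : Rn n) (v : Fin m → Rn n), ‖x‖ ≤ ((ε : ℝ) ^ k)⁻¹ ∧
      (∀ i, ‖v i‖ ≤ 1) ∧ ((∃ (x : Rn n) (v : Fin m → Rn n), ‖x‖ ≤ ((ε : ℝ) ^ k)⁻¹ ∧
        (∀ i, ‖v i‖ ≤ 1) ∧ (ε : ℝ) ^ q < ‖T ε (schwartzReflect x (∂^{v} (f ε)))‖) →
        (ε : ℝ) ^ q < ‖T ε (schwartzReflect x (∂^{v} (f ε)))‖) := by
    intro ε
    by_cases H : ∃ (x : Rn n) (v : Fin m → Rn n), ‖x‖ ≤ ((ε : ℝ) ^ k)⁻¹ ∧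
        (∀ i, ‖v i‖ ≤ 1) ∧ (ε : ℝ) ^ q < ‖T ε (schwartzReflect x (∂^{v} (f ε)))‖
    · obtain ⟨x, v, hx, hv, h⟩ := H
      exact ⟨x, v, hx, hv, fun _ => h⟩
    · have h0 := eps_pos ε
      exact ⟨0, 0, by simp; positivity, by simp, fun h => absurd h H⟩
  choose X V hX hV hXV using hch
  -- The choices give a moderate net because `‖X ε‖` is at most a power of `1 / ε`.
  have hmod : (fun ε => schwartzReflect (X ε) (∂^{V ε} (f ε))) ∈ moderate (schwartzSup n) := by
    intro h'
    have h1 : ModerateNet fun ε : Eps =>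
        2 ^ h' * (2 ^ h' * ((ε : ℝ) ^ (k * h'))⁻¹) * schwartzSup n (h' + m) (f ε) :=
      (((ModerateNet.inv_pow (k * h')).const_mul _).const_mul _).mul (hf (h' + m))
    refine h1.mono fun ε => ?_
    have h0 := eps_pos ε
    rw [abs_of_nonneg (apply_nonneg _ _)]
    refine (schwartzSup_schwartzReflect_le _ _ _).trans ?_
    have h2 : (1 + ‖X ε‖) ^ h' ≤ 2 ^ h' * ((ε : ℝ) ^ (k * h'))⁻¹ := by
      rw [pow_mul, ← inv_pow, ← mul_pow]
      gcongr
      linarith [hX ε, one_le_inv_eps_pow ε k]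
    have h3 : schwartzSup n h' (∂^{V ε} (f ε)) ≤ schwartzSup n (h' + m) (f ε) :=
      (schwartzSup_iteratedLineDeriv_le _ _ _).trans (mul_le_of_le_one_left (apply_nonneg _ _)
        (Finset.prod_le_one (fun _ _ => norm_nonneg _) fun i _ => hV ε i))
    gcongr
  obtain ⟨B, hB, hTb⟩ := (negligibleNet_iff fun _ => norm_nonneg _).1 (hneg _ hmod) (q + 1)
  refine ⟨1 + C * (2 ^ h * D), ?_⟩
  filter_upwards [hb, hfb, hTb, eventually_coe_lt (show (0 : ℝ) < (B + 1)⁻¹ by positivity)] with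
    ε hb hfb hTb hε x
  have h0 := eps_pos ε
  have hone : 1 ≤ (1 + ‖x‖) ^ (h + 1) := one_le_pow₀ (by linarith [norm_nonneg x])
  rcases le_or_gt ‖x‖ ((ε : ℝ) ^ k)⁻¹ with hx | hx
  · have hgood : ∀ v : Fin m → Rn n, (∀ i, ‖v i‖ ≤ 1) →
        ‖T ε (schwartzReflect x (∂^{v} (f ε)))‖ ≤ (ε : ℝ) ^ q := by
      intro v hv
      by_contra! hcon
      have h1 := hXV ε ⟨x, v, hx, hv, hcon⟩
      have h2 : (B + 1) * ε ≤ 1 := by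
        have := mul_le_mul_of_nonneg_left hε.le (show 0 ≤ B + 1 by positivity)
        rwa [mul_inv_cancel₀ (by positivity)] at this
      have h3 : B * (ε : ℝ) ^ (q + 1) ≤ (ε : ℝ) ^ q := by
        rw [pow_succ]
        have : 0 < (ε : ℝ) ^ q := by positivity
        nlinarith
      linarith
    refine (opNorm_le_of_unit _ (by positivity) (M := (ε : ℝ) ^ q) fun v hv => ?_).trans ?_
    · rw [iteratedFDeriv_map_schwartzReflect hb]
      exact hgood v hv
    · have : (1 : ℝ) ≤ (1 + C * (2 ^ h * D)) * (1 + ‖x‖) ^ (h + 1) :=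
        one_le_mul_of_one_le_of_one_le (by linarith [show 0 ≤ C * (2 ^ h * D) by positivity]) hone
      exact le_mul_of_one_le_left (by positivity) this
  · refine (norm_iteratedFDeriv_map_schwartzReflect_le hb (f ε) m x).trans ?_
    rw [abs_of_nonneg (by positivity)]
    -- `k` is chosen such that this factor turns `ε ^ (-N) ε ^ (-M)` into `ε ^ q`.
    have h1 : 1 ≤ (1 + ‖x‖) * (ε : ℝ) ^ k := by
      have := mul_le_mul_of_nonneg_right hx.le (show 0 ≤ (ε : ℝ) ^ k by positivity)
      rw [inv_mul_cancel₀ (by positivity)] at this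
      nlinarith [show 0 < (ε : ℝ) ^ k by positivity]
    calc C * ((ε : ℝ) ^ N)⁻¹ * (2 ^ h * (1 + ‖x‖) ^ h * schwartzSup n (h + m) (f ε))
        ≤ C * ((ε : ℝ) ^ N)⁻¹ * (2 ^ h * (1 + ‖x‖) ^ h * (D * ((ε : ℝ) ^ M)⁻¹)) := by gcongr
      _ = C * (2 ^ h * D) * (1 + ‖x‖) ^ h * (((ε : ℝ) ^ N)⁻¹ * ((ε : ℝ) ^ M)⁻¹) * 1 := by ring
      _ ≤ C * (2 ^ h * D) * (1 + ‖x‖) ^ h * (((ε : ℝ) ^ N)⁻¹ * ((ε : ℝ) ^ M)⁻¹) *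
            ((1 + ‖x‖) * (ε : ℝ) ^ k) := by gcongr
      _ = C * (2 ^ h * D) * (1 + ‖x‖) ^ (h + 1) * (ε : ℝ) ^ q := by
          rw [hk, pow_add (ε : ℝ), pow_add (ε : ℝ) N M]
          field_simp
          ring
      _ ≤ _ := by
          gcongr
          linarith

/-- The class of the convolution does not depend on the representatives. -/
theorem TemperedNet.tauNegligible_sub {T T' : Eps → 𝓢(Rn n, ℂ) →ₗ[ℂ] ℂ} (hT : TemperedNet T)
    (hT' : TemperedNet T')
    (hneg : ∀ f ∈ moderate (schwartzSup n), NegligibleNet fun ε => ‖T ε (f ε) - T' ε (f ε)‖)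
    {f f' : Eps → 𝓢(Rn n, ℂ)} (hf : f ∈ moderate (schwartzSup n))
    (hff' : ∀ h, NegligibleNet fun ε => schwartzSup n h (f ε - f' ε)) :
    TauNegligible fun ε x =>
      T ε (schwartzReflect x (f ε)) - T' ε (schwartzReflect x (f' ε)) := by
  have h1 := (hT.sub hT').tauNegligible_of_map_negligible hneg hf
  have h2 := hT'.tauNegligible_of_negligible hff'
  have h3 := h1.add h2 ((hT.sub hT').contDiff f) (hT'.contDiff fun ε => f ε - f' ε)
  convert h3 using 3 with ε x
  simp [schwartzReflect_map_sub]

/-! ### Mollifiers -/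

theorem schwartzSup_scale_le (ρ : Test n) {δ : ℝ} (hδ : 0 < δ) (hδ1 : δ ≤ 1) (h : ℕ) :
    schwartzSup n h (scale ρ δ hδ).toSchwartz ≤ (δ ^ (n + h))⁻¹ * schwartzSup n h ρ.toSchwartz := by
  refine schwartzSup_le (by positivity) fun k hk m hm x => ?_
  have hρ : ContDiff ℝ m ρ := ρ.contDiff.of_le (by exact_mod_cast le_top)
  have e : iteratedFDeriv ℝ m (scale ρ δ hδ).toSchwartz x =
      ((δ ^ n)⁻¹ : ℝ) • (δ⁻¹ ^ m • iteratedFDeriv ℝ m ρ (δ⁻¹ • x)) := by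
    have h1 := iteratedFDeriv_const_smul_apply (x := x) (a := ((δ ^ n)⁻¹ : ℝ))
      (hρ.comp (contDiff_const_smul δ⁻¹)).contDiffAt
    refine h1.trans ?_
    have h2 := congrFun (iteratedFDeriv_comp_const_smul δ⁻¹ hρ) x
    exact congrArg _ h2
  have hx : ‖x‖ ≤ ‖δ⁻¹ • x‖ := by
    rw [norm_smul, norm_inv, Real.norm_of_nonneg hδ.le]
    exact le_mul_of_one_le_left (norm_nonneg x) ((one_le_inv₀ hδ).2 hδ1)
  rw [e, norm_smul, norm_smul, Real.norm_of_nonneg (by positivity),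
    Real.norm_of_nonneg (by positivity)]
  have hm' : δ⁻¹ ^ m ≤ (δ ^ h)⁻¹ := by
    rw [← inv_pow]
    exact pow_le_pow_right₀ ((one_le_inv₀ hδ).2 hδ1) hm
  calc ‖x‖ ^ k * ((δ ^ n)⁻¹ * (δ⁻¹ ^ m * ‖iteratedFDeriv ℝ m ρ (δ⁻¹ • x)‖))
      ≤ ‖δ⁻¹ • x‖ ^ k * ((δ ^ n)⁻¹ * ((δ ^ h)⁻¹ * ‖iteratedFDeriv ℝ m ρ (δ⁻¹ • x)‖)) := by
        gcongr
    _ = (δ ^ (n + h))⁻¹ * (‖δ⁻¹ • x‖ ^ k * ‖iteratedFDeriv ℝ m ρ.toSchwartz (δ⁻¹ • x)‖) := by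
        rw [pow_add, mul_inv]
        change _ = _ * (_ * ‖iteratedFDeriv ℝ m ρ (δ⁻¹ • x)‖)
        ring
    _ ≤ _ := by
        gcongr
        exact le_schwartzSup hk hm _ _

theorem mollifierNet_mem_moderate (ρ : Test n) (q : ℕ) :
    (fun ε => (mollifierNet ρ q ε).toSchwartz) ∈ moderate (schwartzSup n) := by
  intro h
  refine ((ModerateNet.inv_pow (q * (n + h))).mul
    (ModerateNet.const (schwartzSup n h ρ.toSchwartz))).mono fun ε => ?_
  rw [abs_of_nonneg (apply_nonneg _ _), pow_mul]
  exact schwartzSup_scale_le ρ _ (pow_le_one₀ (eps_pos ε).le (eps_le_one ε)) h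

theorem exists_norm_le_of_mem_tsupport (ρ : Test n) :
    ∃ R : ℝ, 0 ≤ R ∧ ∀ y ∈ tsupport ρ, ‖y‖ ≤ R := by
  obtain ⟨R, hR⟩ := ρ.hasCompactSupport.isBounded.exists_norm_le
  exact ⟨max R 0, le_max_right _ _, fun y hy => (hR y hy).trans (le_max_left _ _)⟩

theorem norm_le_of_mem_tsupport_scale {ρ : Test n} {R : ℝ} (hR : ∀ y ∈ tsupport ρ, ‖y‖ ≤ R)
    {δ : ℝ} (hδ : 0 < δ) (hδ1 : δ ≤ 1) : ∀ y ∈ tsupport (scale ρ δ hδ), ‖y‖ ≤ R := by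
  have hsub : Function.support (scale ρ δ hδ) ⊆ Metric.closedBall 0 R := by
    intro y hy
    have h1 : ρ (δ⁻¹ • y) ≠ 0 := fun h => hy (by
      change ((δ ^ n)⁻¹ : ℝ) • ρ (δ⁻¹ • y) = 0
      rw [h, smul_zero])
    have h2 := hR _ (subset_tsupport _ h1)
    rw [norm_smul, norm_inv, Real.norm_of_nonneg hδ.le] at h2
    rw [mem_closedBall_zero_iff]
    exact (le_mul_of_one_le_left (norm_nonneg y) ((one_le_inv₀ hδ).2 hδ1)).trans h2
  intro y hy
  exact mem_closedBall_zero_iff.1 (closure_minimal hsub Metric.isClosed_closedBall hy)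

theorem norm_le_of_mem_tsupport_mollifierNet {ρ : Test n} {R : ℝ}
    (hR : ∀ y ∈ tsupport ρ, ‖y‖ ≤ R) (q : ℕ) (ε : Eps) :
    ∀ y ∈ tsupport (mollifierNet ρ q ε), ‖y‖ ≤ R :=
  norm_le_of_mem_tsupport_scale hR _ (pow_le_one₀ (eps_pos ε).le (eps_le_one ε))

/-- Regularization with `ρ_{ε^q}` of a tempered net gains `ε ^ q`. -/
theorem TemperedNet.exists_norm_integral_sub_le {T : Eps → 𝓢(Rn n, ℂ) →ₗ[ℂ] ℂ}
    (hT : TemperedNet T) {ρ : Test n} (hρ : ∫ y, ρ y = 1) :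
    ∃ (h N : ℕ) (C : ℝ), 0 ≤ C ∧ ∀ᶠ ε : Eps in toZero, ∀ (q : ℕ) (f : 𝓢(Rn n, ℂ)),
      ‖(∫ x, T ε (schwartzReflect x (mollifierNet ρ q ε).toSchwartz) * f x) - T ε f‖ ≤
        C * (ε : ℝ) ^ ((q : ℝ) - N) * schwartzSup n h f := by
  obtain ⟨h, N, C, hC, hb⟩ := hT.2
  obtain ⟨R, hR0, hR⟩ := exists_norm_le_of_mem_tsupport ρ
  refine ⟨h + 1, N, C * ((1 + R) ^ h * 2 ^ (h + 1) * R * ∫ y, ‖ρ y‖), ?_, ?_⟩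
  · have : 0 ≤ ∫ y, ‖ρ y‖ := integral_nonneg fun _ => norm_nonneg _
    positivity
  · filter_upwards [hb] with ε hb q f
    have h0 := eps_pos ε
    refine (norm_integral_map_scale_sub_le hb hρ hR (pow_pos h0 q)
      (pow_le_one₀ h0.le (eps_le_one ε)) f).trans (le_of_eq ?_)
    rw [abs_of_nonneg (by positivity), Real.rpow_sub h0, Real.rpow_natCast, Real.rpow_natCast,
      div_eq_mul_inv]
    ring

end

section

/-! ### Seminorms on compact sets and cutoff functions -/

open TopologicalSpace (Compacts)

variable {n : ℕ}

theorem natCast_le_infty (m : ℕ) : ((m : ℕ∞) : WithTop ℕ∞) ≤ ((⊤ : ℕ∞) : WithTop ℕ∞) := by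
  exact_mod_cast le_top

theorem Smooth.contDiff (f : Smooth n) : ContDiff ℝ ((⊤ : ℕ∞) : WithTop ℕ∞) (f : Rn n → ℂ) := f.2

theorem norm_iteratedFDeriv_le_smoothSeminorm {K : Compacts (Rn n)} {i m : ℕ} {x : Rn n}
    (hx : x ∈ (K : Set (Rn n))) (hm : m ≤ i) (f : Smooth n) :
    ‖iteratedFDeriv ℝ m (f : Rn n → ℂ) x‖ ≤ smoothSeminorm n (K, i) f :=
  le_csSup (derivSet_bddAbove K.isCompact i f) ⟨x, hx, m, hm, rfl⟩

theorem smoothSeminorm_le {K : Compacts (Rn n)} {i : ℕ} {f : Smooth n} {M : ℝ} (hM : 0 ≤ M)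
    (h : ∀ x ∈ (K : Set (Rn n)), ∀ m ≤ i, ‖iteratedFDeriv ℝ m (f : Rn n → ℂ) x‖ ≤ M) :
    smoothSeminorm n (K, i) f ≤ M := by
  refine Real.sSup_le ?_ hM
  rintro _ ⟨x, hx, m, hm, rfl⟩
  exact h x hx m hm

theorem smoothSeminorm_mono {K L : Compacts (Rn n)} {i j : ℕ}
    (hK : (K : Set (Rn n)) ⊆ (L : Set (Rn n))) (hij : i ≤ j) (f : Smooth n) :
    smoothSeminorm n (K, i) f ≤ smoothSeminorm n (L, j) f :=
  smoothSeminorm_le (apply_nonneg _ _) fun _ hx _ hm =>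
    norm_iteratedFDeriv_le_smoothSeminorm (hK hx) (hm.trans hij) f

theorem smoothSeminorm_sup_le (K L : Compacts (Rn n)) (i : ℕ) (f : Smooth n) :
    smoothSeminorm n (K ⊔ L, i) f ≤ smoothSeminorm n (K, i) f + smoothSeminorm n (L, i) f := by
  refine smoothSeminorm_le (add_nonneg (apply_nonneg _ _) (apply_nonneg _ _)) fun x hx m hm => ?_
  rw [Compacts.coe_sup] at hx
  rcases hx with hx | hx
  · exact le_add_of_le_of_nonneg (norm_iteratedFDeriv_le_smoothSeminorm hx hm f) (apply_nonneg _ _)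
  · exact le_add_of_nonneg_of_le (apply_nonneg _ _) (norm_iteratedFDeriv_le_smoothSeminorm hx hm f)

theorem finset_sup_smoothSeminorm_le (s : Finset (Compacts (Rn n) × ℕ)) (f : Smooth n) :
    s.sup (smoothSeminorm n) f ≤ smoothSeminorm n (s.sup Prod.fst, s.sup Prod.snd) f :=
  Seminorm.finset_sup_apply_le (apply_nonneg _ _) fun i hi =>
    smoothSeminorm_mono (K := i.1) (i := i.2)
      (SetLike.coe_subset_coe.2 (Finset.le_sup (f := Prod.fst) hi))
      (Finset.le_sup (f := Prod.snd) hi) f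

theorem exists_smoothSeminorm_mul_le (K : Compacts (Rn n)) (i : ℕ) (χ : Smooth n) :
    ∃ C : ℝ, 0 ≤ C ∧ ∀ f g : Smooth n, (∀ x, (g : Rn n → ℂ) x = (χ : Rn n → ℂ) x *
      (f : Rn n → ℂ) x) → smoothSeminorm n (K, i) g ≤ C * smoothSeminorm n (K, i) f := by
  refine ⟨2 ^ i * smoothSeminorm n (K, i) χ, by positivity, fun f g hg => ?_⟩
  refine smoothSeminorm_le (by positivity) fun x hx m hm => ?_
  have e : (g : Rn n → ℂ) = fun y => (χ : Rn n → ℂ) y * (f : Rn n → ℂ) y := funext hg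
  rw [e]
  refine (norm_iteratedFDeriv_mul_le (Smooth.contDiff χ) (Smooth.contDiff f) x (natCast_le_infty m)).trans ?_
  calc ∑ k ∈ Finset.range (m + 1), (m.choose k : ℝ) * ‖iteratedFDeriv ℝ k (χ : Rn n → ℂ) x‖ *
        ‖iteratedFDeriv ℝ (m - k) (f : Rn n → ℂ) x‖
      ≤ ∑ k ∈ Finset.range (m + 1), (m.choose k : ℝ) * smoothSeminorm n (K, i) χ *
        smoothSeminorm n (K, i) f := by
        refine Finset.sum_le_sum fun k hk => ?_
        have hk := Finset.mem_range_succ_iff.1 hk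
        gcongr
        · exact norm_iteratedFDeriv_le_smoothSeminorm hx (hk.trans hm) χ
        · exact norm_iteratedFDeriv_le_smoothSeminorm hx ((Nat.sub_le _ _).trans hm) f
    _ = 2 ^ m * smoothSeminorm n (K, i) χ * smoothSeminorm n (K, i) f := by
        rw [← Finset.sum_mul, ← Finset.sum_mul]
        congr 2
        exact_mod_cast Nat.sum_range_choose m
    _ ≤ _ := by
        gcongr
        norm_num

/-- A Schwartz function as a smooth function. -/
def schwartzToSmooth : 𝓢(Rn n, ℂ) →ₗ[ℂ] Smooth n where
  toFun φ := ⟨φ, φ.smooth ⊤⟩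
  map_add' _ _ := rfl
  map_smul' _ _ := rfl

theorem schwartzToSmooth_apply (φ : 𝓢(Rn n, ℂ)) (x : Rn n) :
    (schwartzToSmooth φ : Rn n → ℂ) x = φ x := rfl

theorem smoothSeminorm_schwartzToSmooth_le (K : Compacts (Rn n)) (i : ℕ) (φ : 𝓢(Rn n, ℂ)) :
    smoothSeminorm n (K, i) (schwartzToSmooth φ) ≤ schwartzSup n i φ :=
  smoothSeminorm_le (apply_nonneg _ _) fun x _ m hm => by
    have h := le_schwartzSup (k := 0) (Nat.zero_le i) hm φ x
    rwa [pow_zero, one_mul] at h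

theorem schwartzToSmooth_toSchwartz (f : Test n) : schwartzToSmooth f.toSchwartz = f.toSmooth := rfl

/-- On functions supported in a fixed compact set, the seminorms of `𝓢(ℝⁿ)` are bounded by those
of `C^∞(ℝⁿ)`. -/
theorem exists_schwartzSup_le (K : Compacts (Rn n)) (h : ℕ) : ∃ C : ℝ, 0 ≤ C ∧ ∀ f : Test n,
    tsupport f ⊆ (K : Set (Rn n)) →
      schwartzSup n h f.toSchwartz ≤ C * smoothSeminorm n (K, h) f.toSmooth := by
  obtain ⟨R, hR⟩ := K.isCompact.isBounded.exists_norm_le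
  refine ⟨(1 + |R|) ^ h, by positivity, fun f hf => ?_⟩
  refine schwartzSup_le (by positivity) fun k hk m hm x => ?_
  by_cases hx : x ∈ (K : Set (Rn n))
  · have h1 : ‖x‖ ^ k ≤ (1 + |R|) ^ h := by
      calc ‖x‖ ^ k ≤ (1 + |R|) ^ k := by
            gcongr
            linarith [hR x hx, le_abs_self R]
        _ ≤ _ := pow_le_pow_right₀ (by linarith [abs_nonneg R]) hk
    have h2 : ‖iteratedFDeriv ℝ m f.toSchwartz x‖ ≤ smoothSeminorm n (K, h) f.toSmooth :=
      norm_iteratedFDeriv_le_smoothSeminorm hx hm f.toSmooth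
    gcongr
  · have h2 : iteratedFDeriv ℝ m f.toSchwartz x = 0 := by
      by_contra hne
      exact hx (hf (support_iteratedFDeriv_subset (𝕜 := ℝ) (f := f) m hne))
    rw [h2, norm_zero, mul_zero]
    positivity

/-- The closed ball of radius `R` about the origin. -/
def closedBallC (n : ℕ) (R : ℝ) : Compacts (Rn n) :=
  ⟨Metric.closedBall 0 R, isCompact_closedBall 0 R⟩

theorem mem_closedBallC {R : ℝ} {x : Rn n} : x ∈ (closedBallC n R : Set (Rn n)) ↔ ‖x‖ ≤ R :=
  mem_closedBall_zero_iff

theorem exists_subset_closedBallC {K : Set (Rn n)} (hK : IsCompact K) :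
    ∃ R : ℝ, 0 ≤ R ∧ K ⊆ (closedBallC n R : Set (Rn n)) := by
  obtain ⟨R, hR⟩ := hK.isBounded.exists_norm_le
  exact ⟨max R 0, le_max_right _ _, fun x hx =>
    mem_closedBallC.2 ((hR x hx).trans (le_max_left _ _))⟩

/-- A bump function about the origin with inner radius `|R| + 1` and outer radius `|R| + 2`. -/
def bump (n : ℕ) (R : ℝ) : ContDiffBump (0 : Rn n) :=
  ⟨|R| + 1, |R| + 2, by positivity, by linarith⟩

/-- A smooth function that is `1` on the ball of radius `R + 1` and is supported in the ball of
radius `|R| + 2`. -/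
def cutoff (n : ℕ) (R : ℝ) : Smooth n :=
  ⟨fun x => ((bump n R x : ℝ) : ℂ), Complex.ofRealCLM.contDiff.comp (bump n R).contDiff⟩

theorem cutoff_eq_one {R : ℝ} {x : Rn n} (hx : ‖x‖ ≤ R + 1) :
    (cutoff n R : Rn n → ℂ) x = 1 := by
  have : bump n R x = 1 := (bump n R).one_of_mem_closedBall
    (mem_closedBall_zero_iff.2 (hx.trans (by simpa [bump] using le_abs_self R)))
  change ((bump n R x : ℝ) : ℂ) = 1
  rw [this, Complex.ofReal_one]

theorem tsupport_cutoff_subset (R : ℝ) :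
    tsupport (cutoff n R : Rn n → ℂ) ⊆ (closedBallC n (|R| + 2) : Set (Rn n)) := by
  have h : Function.support (cutoff n R : Rn n → ℂ) ⊆ tsupport (bump n R) := fun x hx =>
    subset_tsupport _ fun h0 => hx (by
      change ((bump n R x : ℝ) : ℂ) = 0
      rw [h0, Complex.ofReal_zero])
  refine (closure_minimal h (isClosed_tsupport _)).trans ?_
  rw [(bump n R).tsupport_eq]
  exact subset_rfl

theorem tsupport_cutoff_mul_subset (R : ℝ) (f : Smooth n) :
    tsupport (fun x => (cutoff n R : Rn n → ℂ) x * (f : Rn n → ℂ) x) ⊆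
      (closedBallC n (|R| + 2) : Set (Rn n)) :=
  (tsupport_mul_subset_left (f := (cutoff n R : Rn n → ℂ))).trans (tsupport_cutoff_subset R)

/-- Multiplication by a cutoff function, as a map from smooth functions to test functions. -/
def cut (n : ℕ) (R : ℝ) : Smooth n →ₗ[ℂ] Test n where
  toFun f :=
    { toFun := fun x => (cutoff n R : Rn n → ℂ) x * (f : Rn n → ℂ) x
      contDiff' := (Smooth.contDiff (cutoff n R)).mul (Smooth.contDiff f)
      hasCompactSupport' := (closedBallC n (|R| + 2)).isCompact.of_isClosed_subset
        (isClosed_tsupport _) (tsupport_cutoff_mul_subset R f)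
      tsupport_subset' := Set.subset_univ _ }
  map_add' f g := by
    ext x
    exact mul_add _ _ _
  map_smul' c f := by
    ext x
    exact mul_left_comm _ c _

theorem cut_apply (R : ℝ) (f : Smooth n) (x : Rn n) :
    cut n R f x = (cutoff n R : Rn n → ℂ) x * (f : Rn n → ℂ) x := rfl

theorem cut_apply_of_norm_le {R : ℝ} {x : Rn n} (hx : ‖x‖ ≤ R + 1) (f : Smooth n) :
    cut n R f x = (f : Rn n → ℂ) x := by
  rw [cut_apply, cutoff_eq_one hx, one_mul]

theorem tsupport_cut_subset (R : ℝ) (f : Smooth n) :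
    tsupport (cut n R f) ⊆ (closedBallC n (|R| + 2) : Set (Rn n)) :=
  tsupport_cutoff_mul_subset R f

theorem cut_toSmooth_eq {R : ℝ} {f : Test n}
    (hf : tsupport f ⊆ (closedBallC n (R + 1) : Set (Rn n))) : cut n R f.toSmooth = f := by
  ext x
  by_cases hx : ‖x‖ ≤ R + 1
  · exact cut_apply_of_norm_le hx _
  · have : f x = 0 := image_eq_zero_of_notMem_tsupport fun h => hx (mem_closedBallC.1 (hf h))
    rw [cut_apply, this]
    exact (congrArg _ this).trans (mul_zero _)

theorem exists_smoothSeminorm_cut_le (R : ℝ) (K : Compacts (Rn n)) (i : ℕ) :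
    ∃ C : ℝ, 0 ≤ C ∧ ∀ f : Smooth n,
      smoothSeminorm n (K, i) (cut n R f).toSmooth ≤ C * smoothSeminorm n (K, i) f := by
  obtain ⟨C, hC, h⟩ := exists_smoothSeminorm_mul_le K i (cutoff n R)
  exact ⟨C, hC, fun f => h f _ fun _ => rfl⟩

theorem exists_schwartzSup_cut_le (R : ℝ) (h : ℕ) : ∃ C : ℝ, 0 ≤ C ∧ ∀ f : Smooth n,
    schwartzSup n h (cut n R f).toSchwartz ≤
      C * smoothSeminorm n (closedBallC n (|R| + 2), h) f := by
  obtain ⟨C, hC, h1⟩ := exists_schwartzSup_le (closedBallC n (|R| + 2)) h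
  obtain ⟨D, hD, h2⟩ := exists_smoothSeminorm_cut_le R (closedBallC n (|R| + 2)) h
  refine ⟨C * D, by positivity, fun f => (h1 _ (tsupport_cut_subset R f)).trans ?_⟩
  rw [mul_assoc]
  exact mul_le_mul_of_nonneg_left (h2 f) hC

/-- A distribution is bounded by a seminorm on the functions with support in a compact set. -/
theorem exists_norm_map_le_of_tsupport_subset (T : Test n →L[ℂ] ℂ) (K : Compacts (Rn n)) :
    ∃ (j : ℕ) (C : ℝ), 0 ≤ C ∧ ∀ f : Test n, tsupport f ⊆ (K : Set (Rn n)) →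
      ‖T f‖ ≤ C * smoothSeminorm n (K, j) f.toSmooth := by
  set S : 𝓓_{K}(Rn n, ℂ) →L[ℂ] ℂ := T.comp
    (TestFunction.ofSupportedInCLM ℂ (Ω := (⊤ : TopologicalSpace.Opens (Rn n)))
      (Set.subset_univ (K : Set (Rn n)))) with hS
  obtain ⟨s, C, -, hC⟩ := Seminorm.bound_of_continuous
    (ContDiffMapSupportedIn.withSeminorms ℂ (Rn n) ℂ ⊤ K)
    ((normSeminorm ℂ ℂ).comp S.toLinearMap) (continuous_norm.comp S.continuous)
  refine ⟨s.sup id, C, C.2, fun f hf => ?_⟩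
  let F : 𝓓_{K}(Rn n, ℂ) := .of_support_subset f.contDiff ((subset_tsupport f).trans hf)
  have h1 : ‖S F‖ ≤ C * s.sup (fun i => ContDiffMapSupportedIn.seminorm ℂ (Rn n) ℂ ⊤ K i) F :=
    hC F
  have h2 : S F = T f := rfl
  rw [h2] at h1
  refine h1.trans (mul_le_mul_of_nonneg_left ?_ C.2)
  refine Seminorm.finset_sup_apply_le (apply_nonneg _ _) fun i hi => ?_
  refine (ContDiffMapSupportedIn.seminorm_top_le_iff ℂ (apply_nonneg _ _) i F).2 fun x hx => ?_
  exact norm_iteratedFDeriv_le_smoothSeminorm hx (Finset.le_sup (f := id) hi) f.toSmooth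

end

section

/-! ### Nets that are locally convolutions of tempered nets -/

open TopologicalSpace (Compacts)

variable {n : ℕ}

theorem smoothSeminorm_le_sum {K : Compacts (Rn n)} {i : ℕ} {f : Smooth n} {B : ℕ → ℝ}
    (hB : ∀ m, 0 ≤ B m) (h : ∀ m ≤ i, ∀ x ∈ (K : Set (Rn n)),
      ‖iteratedFDeriv ℝ m (f : Rn n → ℂ) x‖ ≤ B m) :
    smoothSeminorm n (K, i) f ≤ ∑ m ∈ Finset.range (i + 1), B m :=
  smoothSeminorm_le (Finset.sum_nonneg fun m _ => hB m) fun x hx m hm => (h m hm x hx).trans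
    (Finset.single_le_sum (fun m _ => hB m) (Finset.mem_range_succ_iff.2 hm))

theorem ModerateNet.sum {ι : Type} (s : Finset ι) {f : ι → Eps → ℝ}
    (h : ∀ i ∈ s, ModerateNet (f i)) : ModerateNet fun ε => ∑ i ∈ s, f i ε := by
  classical
  induction s using Finset.induction_on with
  | empty => simpa using ModerateNet.const 0
  | insert a s ha ih =>
    simp only [Finset.sum_insert ha]
    exact (h a (Finset.mem_insert_self _ _)).add
      (ih fun i hi => h i (Finset.mem_insert_of_mem hi))

theorem iteratedFDeriv_eq_of_eqOn_ball {g u : Rn n → ℂ} {R : ℝ} (h : ∀ x, ‖x‖ < R → g x = u x)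
    {x : Rn n} (hx : ‖x‖ < R) (m : ℕ) : iteratedFDeriv ℝ m g x = iteratedFDeriv ℝ m u x := by
  have hev : g =ᶠ[𝓝 x] u := by
    filter_upwards [(isOpen_lt continuous_norm continuous_const).mem_nhds hx] with y hy
    exact h y hy
  exact (hev.iteratedFDeriv (𝕜 := ℝ) m).self_of_nhds

theorem mem_moderate_of_eqOn_ball {g : Eps → Smooth n}
    (h : ∀ R : ℝ, ∃ u ∈ moderateTau n, ∀ᶠ ε in toZero, ∀ x, ‖x‖ < R →
      (g ε : Rn n → ℂ) x = u ε x) : g ∈ moderate (smoothSeminorm n) := by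
  rintro ⟨K, i⟩
  obtain ⟨R, hR0, hR⟩ := exists_subset_closedBallC K.isCompact
  obtain ⟨u, ⟨-, hu⟩, hgu⟩ := h (R + 1)
  choose N C hNC using hu
  refine ModerateNet.of_eventually_le (g := fun ε => ∑ m ∈ Finset.range (i + 1),
    |C m| * (1 + R) ^ N m * ((ε : ℝ) ^ N m)⁻¹)
    (ModerateNet.sum _ fun m _ => (ModerateNet.inv_pow (N m)).const_mul _) ?_
  filter_upwards [hgu, (Finset.eventually_all (Finset.range (i + 1))).2 fun m _ => hNC m]
    with ε hgu hb
  have h0 := eps_pos ε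
  rw [abs_of_nonneg (apply_nonneg _ _)]
  refine smoothSeminorm_le_sum (fun m => by positivity) fun m hm x hx => ?_
  have hx := mem_closedBallC.1 (hR hx)
  rw [iteratedFDeriv_eq_of_eqOn_ball hgu (by linarith)]
  refine (hb m (Finset.mem_range_succ_iff.2 hm) x).trans ?_
  gcongr
  exact le_abs_self _

theorem negligible_of_eqOn_ball {g : Eps → Smooth n}
    (h : ∀ R : ℝ, ∃ u, TauNegligible u ∧ ∀ᶠ ε in toZero, ∀ x, ‖x‖ < R →
      (g ε : Rn n → ℂ) x = u ε x) (i : Compacts (Rn n) × ℕ) :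
    NegligibleNet fun ε => smoothSeminorm n i (g ε) := by
  obtain ⟨K, i⟩ := i
  obtain ⟨R, hR0, hR⟩ := exists_subset_closedBallC K.isCompact
  obtain ⟨u, hu, hgu⟩ := h (R + 1)
  choose N hN using hu
  refine (negligibleNet_iff fun _ => apply_nonneg _ _).2 fun q => ?_
  choose C hC using fun m => hN m q
  refine ⟨∑ m ∈ Finset.range (i + 1), |C m| * (1 + R) ^ N m,
    Finset.sum_nonneg fun m _ => by positivity, ?_⟩
  filter_upwards [hgu, (Finset.eventually_all (Finset.range (i + 1))).2 fun m _ => hC m]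
    with ε hgu hb
  have h0 := eps_pos ε
  rw [Finset.sum_mul]
  refine smoothSeminorm_le_sum (fun m => by positivity) fun m hm x hx => ?_
  have hx := mem_closedBallC.1 (hR hx)
  rw [iteratedFDeriv_eq_of_eqOn_ball hgu (by linarith)]
  refine (hb m (Finset.mem_range_succ_iff.2 hm) x).trans ?_
  gcongr
  exact le_abs_self _

theorem contDiff_of_eqOn_ball {g : Rn n → ℂ} (h : ∀ R : ℝ, ∃ u : Rn n → ℂ,
    ContDiff ℝ ((⊤ : ℕ∞) : WithTop ℕ∞) u ∧ ∀ x, ‖x‖ < R → g x = u x) :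
    ContDiff ℝ ((⊤ : ℕ∞) : WithTop ℕ∞) g := by
  refine contDiff_iff_contDiffAt.2 fun x => ?_
  obtain ⟨u, hu, hgu⟩ := h (‖x‖ + 1)
  refine hu.contDiffAt.congr_of_eventuallyEq ?_
  filter_upwards [(isOpen_lt continuous_norm continuous_const).mem_nhds
    (show ‖x‖ < ‖x‖ + 1 by linarith)] with y hy
  exact hgu y hy

theorem schwartzToSmooth_mem_moderate {φ : Eps → 𝓢(Rn n, ℂ)} (hφ : φ ∈ moderate (schwartzSup n)) :
    (fun ε => schwartzToSmooth (φ ε)) ∈ moderate (smoothSeminorm n) := fun i =>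
  (hφ i.2).mono fun ε => by
    rw [abs_of_nonneg (apply_nonneg _ _)]
    exact smoothSeminorm_schwartzToSmooth_le i.1 i.2 (φ ε)

theorem cut_toSchwartz_mem_moderate {f : Eps → Smooth n} (hf : f ∈ moderate (smoothSeminorm n))
    (R : ℝ) : (fun ε => (cut n R (f ε)).toSchwartz) ∈ moderate (schwartzSup n) := fun h => by
  obtain ⟨C, hC, hb⟩ := exists_schwartzSup_cut_le (n := n) R h
  refine ((hf (closedBallC n (|R| + 2), h)).const_mul C).mono fun ε => ?_
  rw [abs_of_nonneg (apply_nonneg _ _)]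
  exact hb (f ε)

theorem negligible_cut_toSchwartz {f : Eps → Smooth n}
    (hf : ∀ i, NegligibleNet fun ε => smoothSeminorm n i (f ε)) (R : ℝ) (h : ℕ) :
    NegligibleNet fun ε => schwartzSup n h (cut n R (f ε)).toSchwartz := by
  obtain ⟨C, hC, hb⟩ := exists_schwartzSup_cut_le (n := n) R h
  refine ((hf (closedBallC n (|R| + 2), h)).const_mul C).mono fun ε => ?_
  rw [abs_of_nonneg (apply_nonneg _ _)]
  exact hb (f ε)

theorem representsCompact_cut {f : Eps → Smooth n} (hf : f ∈ moderate (smoothSeminorm n)) (R : ℝ) :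
    ∃ u : Gc n, RepresentsCompact (fun ε => cut n R (f ε)) (Gc.toG u) := by
  have hmod : (fun ε => (cut n R (f ε)).toSmooth) ∈ moderate (smoothSeminorm n) := fun i => by
    obtain ⟨C, hC, hb⟩ := exists_smoothSeminorm_cut_le R i.1 i.2
    refine ((hf i).const_mul C).mono fun ε => ?_
    rw [abs_of_nonneg (apply_nonneg _ _)]
    exact hb (f ε)
  have h : RepresentsCompact (fun ε => cut n R (f ε))
      (GE.mk ⟨fun ε => (cut n R (f ε)).toSmooth, hmod⟩) :=
    ⟨⟨_, (closedBallC n (|R| + 2)).isCompact, fun ε => tsupport_cut_subset R (f ε)⟩, hmod, rfl⟩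
  exact ⟨⟨_, _, h⟩, h⟩

/-- A net of test functions with supports in one compact set is unchanged by a suitable
cutoff. -/
theorem RepresentsCompact.exists_cut_eq {f : Eps → Test n} {u : G n} (hf : RepresentsCompact f u) :
    ∃ R : ℝ, 0 ≤ R ∧ (∀ ε, tsupport (f ε) ⊆ (closedBallC n R : Set (Rn n))) ∧
      ∀ ε, cut n R (f ε).toSmooth = f ε := by
  obtain ⟨⟨K, hK, hfK⟩, -⟩ := hf
  obtain ⟨R, hR0, hR⟩ := exists_subset_closedBallC hK
  refine ⟨R, hR0, fun ε => (hfK ε).trans hR, fun ε => cut_toSmooth_eq ?_⟩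
  exact ((hfK ε).trans hR).trans fun x hx => mem_closedBallC.2 ((mem_closedBallC.1 hx).trans
    (by linarith))

theorem RepresentsCompact.toSchwartz_mem_moderate {f : Eps → Test n} {u : G n}
    (hf : RepresentsCompact f u) : (fun ε => (f ε).toSchwartz) ∈ moderate (schwartzSup n) := by
  obtain ⟨R, -, -, hR⟩ := hf.exists_cut_eq
  simpa only [hR] using cut_toSchwartz_mem_moderate hf.2.1 R

theorem RepresentsCompact.negligible_toSchwartz_sub {f f' : Eps → Test n} {u : G n}
    (hf : RepresentsCompact f u) (hf' : RepresentsCompact f' u) (h : ℕ) :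
    NegligibleNet fun ε => schwartzSup n h ((f ε).toSchwartz - (f' ε).toSchwartz) := by
  obtain ⟨R, hR0, hR, -⟩ := hf.exists_cut_eq
  obtain ⟨R', hR0', hR', -⟩ := hf'.exists_cut_eq
  have key : ∀ ε, cut n (max R R') ((f ε).toSmooth - (f' ε).toSmooth) = f ε - f' ε := fun ε => by
    rw [map_sub, cut_toSmooth_eq, cut_toSmooth_eq]
    · exact (hR' ε).trans fun x hx => mem_closedBallC.2 ((mem_closedBallC.1 hx).trans
        (by linarith [le_max_right R R']))
    · exact (hR ε).trans fun x hx => mem_closedBallC.2 ((mem_closedBallC.1 hx).trans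
        (by linarith [le_max_left R R']))
  have := negligible_cut_toSchwartz (f := fun ε => (f ε).toSmooth - (f' ε).toSmooth)
    (fun i => hf.2.negligible_sub hf'.2 i) (max R R') h
  simp only [key] at this
  exact this

end

section

/-! ### Convolution with basic functionals on `G_c(ℝⁿ)` -/

open TopologicalSpace (Compacts)

variable {n : ℕ}

/-- The net of tempered functionals `φ ↦ T' ε (χ φ)` for a cutoff function `χ`. -/
def cutNet (T' : Eps → Test n →L[ℂ] ℂ) (R : ℝ) (ε : Eps) : 𝓢(Rn n, ℂ) →ₗ[ℂ] ℂ :=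
  (T' ε).toLinearMap ∘ₗ cut n R ∘ₗ schwartzToSmooth

theorem cutNet_apply (T' : Eps → Test n →L[ℂ] ℂ) (R : ℝ) (ε : Eps) (φ : 𝓢(Rn n, ℂ)) :
    cutNet T' R ε φ = T' ε (cut n R (schwartzToSmooth φ)) := rfl

theorem cutNet_toSchwartz (T' : Eps → Test n →L[ℂ] ℂ) {R : ℝ} (ε : Eps) {f : Test n}
    (hf : tsupport f ⊆ (closedBallC n (R + 1) : Set (Rn n))) :
    cutNet T' R ε f.toSchwartz = T' ε f := by
  rw [cutNet_apply, schwartzToSmooth_toSchwartz, cut_toSmooth_eq hf]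

theorem toSchwartz_reflect (x : Rn n) (f : Test n) :
    (f.reflect x).toSchwartz = schwartzReflect x f.toSchwartz := by
  ext y
  rw [schwartzReflect_apply]
  rfl

theorem tsupport_reflect_subset {f : Test n} {r s : ℝ}
    (hf : tsupport f ⊆ (closedBallC n r : Set (Rn n))) {x : Rn n} (hx : ‖x‖ ≤ s) :
    tsupport (f.reflect x) ⊆ (closedBallC n (s + r) : Set (Rn n)) := by
  refine closure_minimal (fun y hy => ?_) Metric.isClosed_closedBall
  have h1 : x - y ∈ tsupport f := subset_tsupport _ hy
  have h2 := mem_closedBallC.1 (hf h1)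
  refine mem_closedBallC.2 ?_
  have : ‖y‖ = ‖x - (x - y)‖ := by rw [sub_sub_cancel]
  rw [this]
  exact (norm_sub_le _ _).trans (add_le_add hx h2)

theorem cutNet_schwartzReflect (T' : Eps → Test n →L[ℂ] ℂ) {R r s : ℝ} (ε : Eps) {f : Test n}
    (hf : tsupport f ⊆ (closedBallC n r : Set (Rn n))) (hR : s + r ≤ R + 1) {x : Rn n}
    (hx : ‖x‖ ≤ s) : cutNet T' R ε (schwartzReflect x f.toSchwartz) = T' ε (f.reflect x) := by
  rw [← toSchwartz_reflect, cutNet_toSchwartz]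
  exact (tsupport_reflect_subset hf hx).trans fun y hy =>
    mem_closedBallC.2 ((mem_closedBallC.1 hy).trans hR)

/-- The moderateness of a net of distributions that is required of a basic functional. -/
def ModerateDistributionNet (T' : Eps → Test n →L[ℂ] ℂ) : Prop :=
  ∀ K : Compacts (Rn n), ∃ (j N : ℕ) (η : Eps), ∀ f : Test n, tsupport f ⊆ (K : Set (Rn n)) →
    ∀ ε : Eps, ε ≤ η → ‖T' ε f‖ ≤ ((ε : ℝ) ^ N)⁻¹ * smoothSeminorm n (K, j) f.toSmooth

theorem ModerateDistributionNet.temperedNet {T' : Eps → Test n →L[ℂ] ℂ}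
    (hT : ModerateDistributionNet T') (R : ℝ) : TemperedNet (cutNet T' R) := by
  have key : ∀ j : ℕ, ∃ C : ℝ, 0 ≤ C ∧ ∀ φ : 𝓢(Rn n, ℂ),
      smoothSeminorm n (closedBallC n (|R| + 2), j) (cut n R (schwartzToSmooth φ)).toSmooth ≤
        C * schwartzSup n j φ := fun j => by
    obtain ⟨C, hC, h⟩ := exists_smoothSeminorm_cut_le R (closedBallC n (|R| + 2)) j
    exact ⟨C, hC, fun φ => (h _).trans
      (mul_le_mul_of_nonneg_left (smoothSeminorm_schwartzToSmooth_le _ _ φ) hC)⟩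
  refine ⟨fun ε => ?_, ?_⟩
  · obtain ⟨j, C, hC, h⟩ := exists_norm_map_le_of_tsupport_subset (T' ε) (closedBallC n (|R| + 2))
    obtain ⟨D, hD, hk⟩ := key j
    refine ⟨j, C * D, fun φ => (h _ (tsupport_cut_subset R _)).trans ?_⟩
    rw [mul_assoc]
    exact mul_le_mul_of_nonneg_left (hk φ) hC
  · obtain ⟨j, N, η, h⟩ := hT (closedBallC n (|R| + 2))
    obtain ⟨D, hD, hk⟩ := key j
    refine ⟨j, N, D, hD, ?_⟩
    filter_upwards [eventually_le η] with ε hε φ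
    have h0 := eps_pos ε
    refine (h _ (tsupport_cut_subset R _) ε hε).trans ?_
    calc _ ≤ ((ε : ℝ) ^ N)⁻¹ * (D * schwartzSup n j φ) := by
          gcongr
          exact hk φ
      _ = _ := by ring

theorem Gc.DefinedBy.negligible_cutNet_sub {T : Gc n →L[CTilde] CTilde}
    {T' T'' : Eps → Test n →L[ℂ] ℂ} (h' : Gc.DefinedBy T T') (h'' : Gc.DefinedBy T T'') (R : ℝ)
    {φ : Eps → 𝓢(Rn n, ℂ)} (hφ : φ ∈ moderate (schwartzSup n)) :
    NegligibleNet fun ε => ‖cutNet T' R ε (φ ε) - cutNet T'' R ε (φ ε)‖ := by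
  obtain ⟨u, hu⟩ := representsCompact_cut (schwartzToSmooth_mem_moderate hφ) R
  exact (CTilde.represents_iff_of_represents (h'.2 u _ hu)).1 (h''.2 u _ hu)

theorem ModerateDistributionNet.contDiff_map_reflect {T' : Eps → Test n →L[ℂ] ℂ}
    (hT : ModerateDistributionNet T') (ε : Eps) (f : Test n) :
    ContDiff ℝ ((⊤ : ℕ∞) : WithTop ℕ∞) fun x => T' ε (f.reflect x) := by
  obtain ⟨r, -, hr⟩ := exists_subset_closedBallC f.hasCompactSupport
  exact contDiff_of_eqOn_ball fun s => ⟨_, (hT.temperedNet (s + r)).contDiff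
    (fun _ => f.toSchwartz) ε, fun x hx =>
      (cutNet_schwartzReflect T' (r := r) (s := s) ε hr (by linarith) hx.le).symm⟩

/-- The net of smooth functions `x ↦ T' ε (f ε (x - ·))`. -/
def ModerateDistributionNet.conv {T' : Eps → Test n →L[ℂ] ℂ} (hT : ModerateDistributionNet T')
    (f : Eps → Test n) (ε : Eps) : Smooth n :=
  ⟨fun x => T' ε ((f ε).reflect x), hT.contDiff_map_reflect ε (f ε)⟩

theorem ModerateDistributionNet.conv_mem_moderate {T' : Eps → Test n →L[ℂ] ℂ}
    (hT : ModerateDistributionNet T') {f : Eps → Test n} {u : G n} (hf : RepresentsCompact f u) :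
    hT.conv f ∈ moderate (smoothSeminorm n) := by
  obtain ⟨r, -, hr, -⟩ := hf.exists_cut_eq
  exact mem_moderate_of_eqOn_ball fun s => ⟨_, (hT.temperedNet (s + r)).mem_moderateTau
    hf.toSchwartz_mem_moderate, Eventually.of_forall fun ε x hx =>
      (cutNet_schwartzReflect T' (r := r) (s := s) ε (hr ε) (by linarith) hx.le).symm⟩

theorem Gc.DefinedBy.negligible_conv_sub {T : Gc n →L[CTilde] CTilde}
    {T' T'' : Eps → Test n →L[ℂ] ℂ} (h' : Gc.DefinedBy T T') (h'' : Gc.DefinedBy T T'')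
    (hm' : ModerateDistributionNet T') (hm'' : ModerateDistributionNet T'')
    {f f' : Eps → Test n} {u : G n} (hf : RepresentsCompact f u) (hf' : RepresentsCompact f' u)
    (i : Compacts (Rn n) × ℕ) :
    NegligibleNet fun ε => smoothSeminorm n i (hm'.conv f ε - hm''.conv f' ε) := by
  obtain ⟨r, -, hr, -⟩ := hf.exists_cut_eq
  obtain ⟨r', -, hr', -⟩ := hf'.exists_cut_eq
  refine negligible_of_eqOn_ball (fun s => ⟨_,
    (hm'.temperedNet (s + max r r')).tauNegligible_sub (hm''.temperedNet (s + max r r'))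
      (fun φ hφ => h'.negligible_cutNet_sub h'' _ hφ) hf.toSchwartz_mem_moderate
      (fun h => hf.negligible_toSchwartz_sub hf' h),
    Eventually.of_forall fun ε x hx => ?_⟩) i
  rw [cutNet_schwartzReflect T' (r := r) (s := s) ε (hr ε) (by linarith [le_max_left r r']) hx.le,
    cutNet_schwartzReflect T'' (r := r') (s := s) ε (hr' ε) (by linarith [le_max_right r r']) hx.le]
  rfl

theorem Gc.DefinedBy.isConv {T : Gc n →L[CTilde] CTilde} {T' : Eps → Test n →L[ℂ] ℂ}
    (h' : Gc.DefinedBy T T') (hm : ModerateDistributionNet T') {f : Eps → Test n} {u : Gc n}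
    (hf : RepresentsCompact f (Gc.toG u)) {w : G n} (hw : GE.Represents (hm.conv f) w) :
    Gc.IsConv u T w := by
  intro T'' f'' h'' hf''
  have hm'' : ModerateDistributionNet T'' := h''.1
  exact ⟨hm''.conv f'', fun _ _ => rfl, hw.congr (hm''.conv_mem_moderate hf'')
    (h'.negligible_conv_sub h'' hm hm'' hf hf'')⟩

/-! ### Convolution with basic functionals on `G(ℝⁿ)` -/

theorem smoothSeminorm_eq_zero {K : Compacts (Rn n)} {j : ℕ} {f : Smooth n}
    (h : ∀ x ∈ (K : Set (Rn n)), (f : Rn n → ℂ) =ᶠ[𝓝 x] 0) : smoothSeminorm n (K, j) f = 0 := by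
  refine le_antisymm (smoothSeminorm_le le_rfl fun x hx m _ => ?_) (apply_nonneg _ _)
  rw [((h x hx).iteratedFDeriv (𝕜 := ℝ) m).self_of_nhds, Pi.zero_def, iteratedFDeriv_fun_zero]
  simp

theorem map_eq_of_eqOn_ball {L : Smooth n →ₗ[ℂ] ℂ} {C r : ℝ} {j : ℕ}
    (hL : ∀ f, ‖L f‖ ≤ C * smoothSeminorm n (closedBallC n r, j) f) {f g : Smooth n}
    (h : ∀ x, ‖x‖ < r + 1 → (f : Rn n → ℂ) x = (g : Rn n → ℂ) x) : L f = L g := by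
  have h0 : smoothSeminorm n (closedBallC n r, j) (f - g) = 0 := smoothSeminorm_eq_zero fun x hx => by
    filter_upwards [(isOpen_lt continuous_norm continuous_const).mem_nhds
      (show ‖x‖ < r + 1 by linarith [mem_closedBallC.1 hx])] with y hy
    exact sub_eq_zero.2 (h y hy)
  have h1 := hL (f - g)
  rw [h0, mul_zero, map_sub] at h1
  exact sub_eq_zero.1 (norm_le_zero_iff.1 h1)

theorem ModerateFunctionalNet.exists_norm_le {T' : Eps → Smooth n →ₗ[ℂ] ℂ}
    (hT : ModerateFunctionalNet (smoothSeminorm n) T') (ε : Eps) :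
    ∃ (r : ℝ) (j : ℕ) (C : ℝ), ∀ f, ‖T' ε f‖ ≤ C * smoothSeminorm n (closedBallC n r, j) f := by
  obtain ⟨s, C, h⟩ := hT.1 ε
  obtain ⟨r, -, hr⟩ := exists_subset_closedBallC (s.sup Prod.fst).isCompact
  refine ⟨r, s.sup Prod.snd, |C|, fun f => (h f).trans ?_⟩
  exact mul_le_mul (le_abs_self C) ((finset_sup_smoothSeminorm_le s f).trans
    (smoothSeminorm_mono hr le_rfl f)) (apply_nonneg _ _) (abs_nonneg C)

theorem ModerateFunctionalNet.exists_eventually_norm_le {T' : Eps → Smooth n →ₗ[ℂ] ℂ}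
    (hT : ModerateFunctionalNet (smoothSeminorm n) T') :
    ∃ (r : ℝ) (j N : ℕ) (η : Eps), 0 ≤ r ∧ ∀ ε ≤ η, ∀ f, ‖T' ε f‖ ≤
      ((ε : ℝ) ^ N)⁻¹ * smoothSeminorm n (closedBallC n r, j) f := by
  obtain ⟨s, N, η, h⟩ := hT.2
  obtain ⟨r, hr0, hr⟩ := exists_subset_closedBallC (s.sup Prod.fst).isCompact
  refine ⟨r, s.sup Prod.snd, N, η, hr0, fun ε hε f => (h f ε hε).trans ?_⟩
  have h0 := eps_pos ε
  gcongr
  exact (finset_sup_smoothSeminorm_le s f).trans (smoothSeminorm_mono hr le_rfl f)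

/-- The restriction of a net of functionals on `C^∞(ℝⁿ)` to `𝓢(ℝⁿ)`. -/
def restrictNet (T' : Eps → Smooth n →ₗ[ℂ] ℂ) (ε : Eps) : 𝓢(Rn n, ℂ) →ₗ[ℂ] ℂ :=
  T' ε ∘ₗ schwartzToSmooth

theorem restrictNet_apply (T' : Eps → Smooth n →ₗ[ℂ] ℂ) (ε : Eps) (φ : 𝓢(Rn n, ℂ)) :
    restrictNet T' ε φ = T' ε (schwartzToSmooth φ) := rfl

theorem ModerateFunctionalNet.temperedNet_restrictNet {T' : Eps → Smooth n →ₗ[ℂ] ℂ}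
    (hT : ModerateFunctionalNet (smoothSeminorm n) T') : TemperedNet (restrictNet T') := by
  refine ⟨fun ε => ?_, ?_⟩
  · obtain ⟨r, j, C, h⟩ := hT.exists_norm_le ε
    exact ⟨j, |C|, fun φ => (h _).trans (mul_le_mul (le_abs_self C)
      (smoothSeminorm_schwartzToSmooth_le _ _ φ) (apply_nonneg _ _) (abs_nonneg C))⟩
  · obtain ⟨r, j, N, η, -, h⟩ := hT.exists_eventually_norm_le
    refine ⟨j, N, 1, zero_le_one, ?_⟩
    filter_upwards [eventually_le η] with ε hε φ
    have h0 := eps_pos ε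
    rw [one_mul]
    refine (h ε hε _).trans ?_
    gcongr
    exact smoothSeminorm_schwartzToSmooth_le _ _ φ

theorem restrictNet_cut {T' : Eps → Smooth n →ₗ[ℂ] ℂ} {ε : Eps} {C r R : ℝ} {j : ℕ}
    (h : ∀ f, ‖T' ε f‖ ≤ C * smoothSeminorm n (closedBallC n r, j) f) (hR : r ≤ R)
    (f : Smooth n) : restrictNet T' ε (cut n R f).toSchwartz = T' ε f := by
  rw [restrictNet_apply, schwartzToSmooth_toSchwartz]
  exact map_eq_of_eqOn_ball h fun x hx => cut_apply_of_norm_le (by linarith) f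

theorem Smooth.reflect_apply (x y : Rn n) (f : Smooth n) :
    (Smooth.reflect x f : Rn n → ℂ) y = (f : Rn n → ℂ) (x - y) := rfl

theorem restrictNet_schwartzReflect_cut {T' : Eps → Smooth n →ₗ[ℂ] ℂ} {ε : Eps} {C r s R : ℝ}
    {j : ℕ} (h : ∀ f, ‖T' ε f‖ ≤ C * smoothSeminorm n (closedBallC n r, j) f)
    (hR : s + r ≤ R) (f : Smooth n) {x : Rn n} (hx : ‖x‖ ≤ s) :
    restrictNet T' ε (schwartzReflect x (cut n R f).toSchwartz) = T' ε (Smooth.reflect x f) := by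
  rw [restrictNet_apply]
  refine map_eq_of_eqOn_ball h fun y hy => ?_
  rw [schwartzToSmooth_apply, schwartzReflect_apply, Smooth.reflect_apply]
  exact cut_apply_of_norm_le ((norm_sub_le x y).trans (by linarith)) f

theorem ModerateFunctionalNet.contDiff_map_reflect {T' : Eps → Smooth n →ₗ[ℂ] ℂ}
    (hT : ModerateFunctionalNet (smoothSeminorm n) T') (ε : Eps) (f : Smooth n) :
    ContDiff ℝ ((⊤ : ℕ∞) : WithTop ℕ∞) fun x => T' ε (Smooth.reflect x f) := by
  obtain ⟨r, j, C, h⟩ := hT.exists_norm_le ε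
  exact contDiff_of_eqOn_ball fun s => ⟨_, hT.temperedNet_restrictNet.contDiff
    (fun _ => (cut n (s + r) f).toSchwartz) ε, fun x hx =>
      (restrictNet_schwartzReflect_cut h le_rfl f hx.le).symm⟩

/-- The net of smooth functions `x ↦ T' ε (f ε (x - ·))`. -/
def ModerateFunctionalNet.conv {T' : Eps → Smooth n →ₗ[ℂ] ℂ}
    (hT : ModerateFunctionalNet (smoothSeminorm n) T') (f : Eps → Smooth n) (ε : Eps) : Smooth n :=
  ⟨fun x => T' ε (Smooth.reflect x (f ε)), hT.contDiff_map_reflect ε (f ε)⟩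

theorem ModerateFunctionalNet.conv_mem_moderate {T' : Eps → Smooth n →ₗ[ℂ] ℂ}
    (hT : ModerateFunctionalNet (smoothSeminorm n) T') {f : Eps → Smooth n}
    (hf : f ∈ moderate (smoothSeminorm n)) : hT.conv f ∈ moderate (smoothSeminorm n) := by
  obtain ⟨r, j, N, η, -, h⟩ := hT.exists_eventually_norm_le
  exact mem_moderate_of_eqOn_ball fun s => ⟨_, hT.temperedNet_restrictNet.mem_moderateTau
    (cut_toSchwartz_mem_moderate hf (s + r)), (eventually_le η).mono fun ε hε x hx =>
      (restrictNet_schwartzReflect_cut (h ε hε) le_rfl (f ε) hx.le).symm⟩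

theorem GE.DefinedBy.negligible_sub {E ι : Type} [AddCommGroup E] [Module ℂ E]
    {p : ι → Seminorm ℂ E} {T : GE p →L[CTilde] CTilde} {T' T'' : Eps → E →ₗ[ℂ] ℂ}
    (h' : GE.DefinedBy T T') (h'' : GE.DefinedBy T T'') {f : Eps → E} (hf : f ∈ moderate p) :
    NegligibleNet fun ε => ‖T' ε (f ε) - T'' ε (f ε)‖ :=
  (CTilde.represents_iff_of_represents (h'.2 _ f ⟨hf, rfl⟩)).1 (h''.2 _ f ⟨hf, rfl⟩)

theorem GE.DefinedBy.negligible_conv_sub {T : G n →L[CTilde] CTilde}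
    {T' T'' : Eps → Smooth n →ₗ[ℂ] ℂ} (h' : GE.DefinedBy T T') (h'' : GE.DefinedBy T T'')
    {f f' : Eps → Smooth n} {u : G n} (hf : GE.Represents f u) (hf' : GE.Represents f' u)
    (i : Compacts (Rn n) × ℕ) :
    NegligibleNet fun ε => smoothSeminorm n i (h'.1.conv f ε - h''.1.conv f' ε) := by
  obtain ⟨r, j, N, η, -, hr⟩ := h'.1.exists_eventually_norm_le
  obtain ⟨r', j', N', η', -, hr'⟩ := h''.1.exists_eventually_norm_le
  refine negligible_of_eqOn_ball (fun s => ⟨_,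
    h'.1.temperedNet_restrictNet.tauNegligible_sub h''.1.temperedNet_restrictNet
      (fun φ hφ => h'.negligible_sub h'' (schwartzToSmooth_mem_moderate hφ))
      (f' := fun ε => (cut n (s + max r r') (f' ε)).toSchwartz)
      (cut_toSchwartz_mem_moderate hf.1 (s + max r r')) (fun h => ?_), ?_⟩) i
  · have := negligible_cut_toSchwartz (f := fun ε => f ε - f' ε)
      (fun i => hf.negligible_sub hf' i) (s + max r r') h
    simp only [map_sub] at this
    exact this
  · filter_upwards [eventually_le η, eventually_le η'] with ε hε hε' x hx
    rw [restrictNet_schwartzReflect_cut (s := s) (hr ε hε) (by linarith [le_max_left r r']) _ hx.le,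
      restrictNet_schwartzReflect_cut (s := s) (hr' ε hε') (by linarith [le_max_right r r']) _ hx.le]
    rfl

theorem GE.DefinedBy.isConv {T : G n →L[CTilde] CTilde} {T' : Eps → Smooth n →ₗ[ℂ] ℂ}
    (h' : GE.DefinedBy T T') {f : Eps → Smooth n} {u w : G n} (hf : GE.Represents f u)
    (hw : GE.Represents (h'.1.conv f) w) : G.IsConv u T w := by
  intro T'' f'' h'' hf''
  exact ⟨h''.1.conv f'', fun _ _ => rfl, hw.congr (h''.1.conv_mem_moderate hf''.1)
    (h'.negligible_conv_sub h'' hf hf'')⟩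

/-! ### Convolution with basic functionals on `G_𝓢(ℝⁿ)` -/

theorem GE.DefinedBy.isConv_schwartz {T : GS n →L[CTilde] CTilde}
    {T' : Eps → 𝓢(Rn n, ℂ) →ₗ[ℂ] ℂ} (h' : GE.DefinedBy T T') {f : Eps → 𝓢(Rn n, ℂ)} {u : GS n}
    {w : GTau n} (hf : GE.Represents f u)
    (hw : GTau.Represents (fun ε x => T' ε (schwartzReflect x (f ε))) w) : GS.IsConv u T w := by
  intro T'' f'' h'' hf''
  have hmod := h''.1.temperedNet.mem_moderateTau hf''.1
  obtain ⟨hg, rfl⟩ := hw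
  refine ⟨hmod, QuotientAddGroup.eq.2 ?_⟩
  have key := h''.1.temperedNet.tauNegligible_sub h'.1.temperedNet
    (fun φ hφ => h''.negligible_sub h' hφ) hf''.1 (fun h => hf''.negligible_sub hf h)
  have : (-(⟨_, hmod⟩ : moderateTau n) + ⟨_, hg⟩) = -((⟨_, hmod⟩ : moderateTau n) - ⟨_, hg⟩) := by
    abel
  rw [this]
  exact neg_mem key

end

section

/-! ### Supports -/

open TopologicalSpace (Compacts)

variable {n : ℕ}

/-- Away from the support of `u`, the representatives of `u` are negligible. -/
theorem negligible_of_disjoint_supp {u : G n} {f : Eps → Smooth n} (hf : GE.Represents f u)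
    (L : Compacts (Rn n)) (hL : Disjoint (L : Set (Rn n)) (supp u)) (i : ℕ) :
    NegligibleNet fun ε => smoothSeminorm n (L, i) (f ε) := by
  have mono : ∀ K K' : Compacts (Rn n), (K : Set (Rn n)) ⊆ K' →
      (NegligibleNet fun ε => smoothSeminorm n (K', i) (f ε)) →
      NegligibleNet fun ε => smoothSeminorm n (K, i) (f ε) := fun K K' hK h => h.mono fun ε => by
    rw [abs_of_nonneg (apply_nonneg _ _)]
    exact smoothSeminorm_mono hK le_rfl _
  obtain ⟨K, hLK, hK⟩ : ∃ K : Compacts (Rn n), (L : Set (Rn n)) ⊆ K ∧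
      NegligibleNet fun ε => smoothSeminorm n (K, i) (f ε) := by
    refine L.isCompact.induction_on (p := fun s => ∃ K : Compacts (Rn n), s ⊆ K ∧
      NegligibleNet fun ε => smoothSeminorm n (K, i) (f ε)) ?_ ?_ ?_ ?_
    · refine ⟨⊥, Set.empty_subset _, NegligibleNet.zero.mono fun ε => ?_⟩
      rw [abs_of_nonneg (apply_nonneg _ _)]
      exact smoothSeminorm_le le_rfl fun x hx => absurd hx (Set.notMem_empty x)
    · rintro s t hst ⟨K, hK, h⟩
      exact ⟨K, hst.trans hK, h⟩
    · rintro s t ⟨K, hK, h⟩ ⟨K', hK', h'⟩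
      refine ⟨K ⊔ K', ?_, (h.add h').mono fun ε => ?_⟩
      · rw [TopologicalSpace.Compacts.coe_sup]
        exact Set.union_subset_union hK hK'
      · rw [abs_of_nonneg (apply_nonneg _ _)]
        exact smoothSeminorm_sup_le K K' i (f ε)
    · intro x hx
      have hxs : x ∉ supp u := hL.notMem_of_mem_left hx
      simp only [supp, Set.mem_ofPred_eq, not_forall, not_not] at hxs
      obtain ⟨V, hV, hxV, hu⟩ := hxs
      obtain ⟨K, hK, hxK, hKV⟩ := exists_compact_subset hV hxV
      exact ⟨K, mem_nhdsWithin_of_mem_nhds (mem_interior_iff_mem_nhds.1 hxK),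
        ⟨K, hK⟩, subset_rfl, hu f hf ⟨K, hK⟩ i hKV⟩
  exact mono L K hLK hK

theorem exists_supp_subset (u : Gc n) :
    ∃ K : Compacts (Rn n), supp (Gc.toG u) ⊆ (K : Set (Rn n)) := by
  obtain ⟨f, ⟨⟨K, hK, hfK⟩, hf⟩⟩ := u.2
  refine ⟨⟨K, hK⟩, fun x hx => ?_⟩
  by_contra hxK
  refine hx Kᶜ hK.isClosed.isOpen_compl hxK fun g hg L i hL => ?_
  have h0 : ∀ ε, smoothSeminorm n (L, i) (f ε).toSmooth = 0 := fun ε =>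
    smoothSeminorm_eq_zero fun y hy => by
      filter_upwards [hK.isClosed.isOpen_compl.mem_nhds (hL hy)] with z hz
      exact image_eq_zero_of_notMem_tsupport fun h => hz (hfK ε h)
  refine (hg.negligible_sub hf (L, i)).mono fun ε => ?_
  rw [abs_of_nonneg (apply_nonneg _ _)]
  have := map_add_le_add (smoothSeminorm n (L, i)) (g ε - (f ε).toSmooth) (f ε).toSmooth
  rwa [h0, add_zero, sub_add_cancel] at this

/-- If `u` is supported in `K`, then it has a representative with supports in a compact set that
depends on `K` only, and all its ultra-pseudo-seminorms are bounded by those on a neighbourhood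
of `K`. -/
theorem exists_representative_of_supp_subset {K : Compacts (Rn n)} {R : ℝ}
    (hK : (K : Set (Rn n)) ⊆ (closedBallC n R : Set (Rn n))) {u : Gc n}
    (hu : supp (Gc.toG u) ⊆ (K : Set (Rn n))) :
    (∃ f : Eps → Test n, RepresentsCompact f (Gc.toG u) ∧
      ∀ ε, tsupport (f ε) ⊆ (closedBallC n (|R| + 2) : Set (Rn n))) ∧
    ∀ (L : Compacts (Rn n)) (i : ℕ), GE.ups (L, i) (Gc.toG u) ≤ GE.ups (nhd K, i) (Gc.toG u) := by
  obtain ⟨f, hfc⟩ : ∃ f : Eps → Test n, RepresentsCompact f (Gc.toG u) := u.2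
  have hf := hfc.2
  refine ⟨⟨fun ε => cut n R (f ε).toSmooth, ⟨⟨_, (closedBallC n (|R| + 2)).isCompact, fun ε =>
    tsupport_cut_subset R _⟩, ?_⟩, fun ε => tsupport_cut_subset R _⟩, fun L i => ?_⟩
  · refine hf.congr (fun i => ?_) fun i => ?_
    · obtain ⟨C, -, hC⟩ := exists_smoothSeminorm_cut_le R i.1 i.2
      refine ((hf.1 i).const_mul C).mono fun ε => ?_
      rw [abs_of_nonneg (apply_nonneg _ _)]
      exact hC _
    · obtain ⟨L, i⟩ := i
      let L' : Compacts (Rn n) := ⟨L \ Metric.ball 0 (R + 1), L.isCompact.diff Metric.isOpen_ball⟩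
      have hL' : Disjoint (L' : Set (Rn n)) (supp (Gc.toG u)) := by
        refine Set.disjoint_left.2 fun x hx hxs => hx.2 ?_
        rw [mem_ball_zero_iff]
        linarith [mem_closedBallC.1 (hK (hu hxs))]
      obtain ⟨C, -, hC⟩ := exists_smoothSeminorm_cut_le R L' i
      have hneg := negligible_of_disjoint_supp hf L' hL' i
      refine (hneg.add (hneg.const_mul C)).mono fun ε => ?_
      rw [abs_of_nonneg (apply_nonneg _ _)]
      -- The difference vanishes on the ball where the cutoff function is `1`.
      have h1 : smoothSeminorm n (L, i) ((f ε).toSmooth - (cut n R (f ε).toSmooth).toSmooth) ≤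
          smoothSeminorm n (L', i) ((f ε).toSmooth - (cut n R (f ε).toSmooth).toSmooth) := by
        refine smoothSeminorm_le (apply_nonneg _ _) fun x hx m hm => ?_
        by_cases hxR : ‖x‖ < R + 1
        · have e : ∀ y, ‖y‖ < R + 1 → (((f ε).toSmooth - (cut n R (f ε).toSmooth).toSmooth :
              Smooth n) : Rn n → ℂ) y = (fun _ => 0 : Rn n → ℂ) y := fun y hy =>
            sub_eq_zero.2 (cut_apply_of_norm_le hy.le (f ε).toSmooth).symm
          rw [iteratedFDeriv_eq_of_eqOn_ball e hxR, iteratedFDeriv_fun_zero]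
          simp
        · exact norm_iteratedFDeriv_le_smoothSeminorm (K := L')
            ⟨hx, fun h => hxR (mem_ball_zero_iff.1 h)⟩ hm _
      exact h1.trans ((map_sub_le_add _ _ _).trans (add_le_add le_rfl (hC _)))
  · rw [hf.ups_eq, hf.ups_eq]
    let L' : Compacts (Rn n) := ⟨L \ Metric.thickening 1 (K : Set (Rn n)),
      L.isCompact.diff Metric.isOpen_thickening⟩
    have hL' : Disjoint (L' : Set (Rn n)) (supp (Gc.toG u)) :=
      Set.disjoint_left.2 fun x hx hxs => hx.2 (Metric.self_subset_thickening one_pos _ (hu hxs))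
    have := expNegVal_le_exp_mul (f := fun ε => smoothSeminorm n (L, i) (f ε).toSmooth) 0 1
      (hf.1 (nhd K, i)) (negligible_of_disjoint_supp hf L' hL' i)
      (Eventually.of_forall fun ε => ?_)
    · simpa using this
    · rw [abs_of_nonneg (apply_nonneg _ _), Real.rpow_zero, one_mul, one_mul]
      refine (smoothSeminorm_mono (L := nhd K ⊔ L') ?_ le_rfl _).trans
        (smoothSeminorm_sup_le _ _ i _)
      intro x hx
      rw [TopologicalSpace.Compacts.coe_sup]
      by_cases h : x ∈ Metric.thickening 1 (K : Set (Rn n))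
      · exact Or.inl (Metric.thickening_subset_cthickening _ _ h)
      · exact Or.inr ⟨hx, h⟩

/-! ### Functionals on `G_c(ℝⁿ)` -/

/-- A net of functionals on test functions that is moderate on each compact set induces a
continuous functional on `G_c(ℝⁿ)`. -/
theorem Gc.exists_functional (L : Eps → Test n →ₗ[ℂ] ℂ)
    (hL : ∀ K : Compacts (Rn n), ∃ (j N : ℕ) (C : ℝ), ∀ᶠ ε : Eps in toZero, ∀ f : Test n,
      tsupport f ⊆ (K : Set (Rn n)) →
        ‖L ε f‖ ≤ C * ((ε : ℝ) ^ N)⁻¹ * smoothSeminorm n (K, j) f.toSmooth) :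
    ∃ S : Gc n →L[CTilde] CTilde, ∀ (u : Gc n) (f : Eps → Test n),
      RepresentsCompact f (Gc.toG u) → CTilde.Represents (fun ε => L ε (f ε)) (S u) := by
  obtain ⟨S, hS⟩ := exists_linearMap_of_net
    (fun (f : Eps → Test n) (u : Gc n) => RepresentsCompact f (Gc.toG u)) (fun u => u.2)
    (fun u v x y hu hv => hu.add hv) (fun a u x hu => hu.smul a) L
    (fun u x hu => by
      obtain ⟨R, -, hR, -⟩ := hu.exists_cut_eq
      obtain ⟨j, N, C, h⟩ := hL (closedBallC n R)
      exact (((ModerateNet.inv_pow N).const_mul C).mul (hu.2.1 _)).of_eventually_le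
        (h.mono fun ε h => by
          rw [abs_norm]
          exact h _ (hR ε)))
    (fun u v x hu hv => by
      obtain ⟨R, -, hR, -⟩ := hu.exists_cut_eq
      obtain ⟨R', -, hR', -⟩ := hv.exists_cut_eq
      obtain ⟨j, N, C, h⟩ := hL (closedBallC n R ⊔ closedBallC n R')
      refine (((ModerateNet.inv_pow N).const_mul C).mul_negligible
        (hu.2.negligible_sub hv.2
        (closedBallC n R ⊔ closedBallC n R', j))).of_eventually_le (h.mono fun ε h => ?_)
      rw [abs_norm]
      refine h (u ε - v ε) ?_
      rw [TopologicalSpace.Compacts.coe_sup]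
      exact (tsupport_sub (u ε) (v ε)).trans (Set.union_subset_union (hR ε) (hR' ε)))
  let Q : GcSeminorms n := ⟨{
    toFun := fun u => absE (S u)
    nonneg := fun u => absE_nonneg _
    map_zero := by rw [map_zero, absE_zero]
    smul_le := fun c u => by
      rw [map_smul]
      exact absE_mul_le c (S u)
    add_le := fun u v => by
      rw [map_add]
      exact absE_add_le _ _ }, fun K => by
    obtain ⟨R, -, hR⟩ := exists_subset_closedBallC K.isCompact
    obtain ⟨j, N, C, h⟩ := hL (closedBallC n (|R| + 2))
    refine ⟨j, Real.exp N, fun u hu => ?_⟩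
    obtain ⟨⟨f, hf, hfR⟩, hups⟩ := exists_representative_of_supp_subset hR hu
    change absE (S u) ≤ _
    rw [(hS u f hf).absE_eq]
    have := expNegVal_le_exp_mul (f := fun ε => ‖L ε (f ε)‖) (-(N : ℝ)) C
      (hf.2.1 (closedBallC n (|R| + 2), j)) NegligibleNet.zero (h.mono fun ε h => ?_)
    · rw [← hf.2.ups_eq, neg_neg] at this
      exact this.trans (mul_le_mul_of_nonneg_left (hups _ _) (Real.exp_pos _).le)
    · rw [abs_norm, Real.rpow_neg (eps_pos ε).le, Real.rpow_natCast, add_zero]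
      exact h _ (hfR ε)⟩
  refine ⟨⟨S, continuous_of_absE_le Gc.ups S Q 1 (fun u => ?_) (fun u => absE_nonneg _) ?_⟩, hS⟩
  · rw [one_mul]
    rfl
  · exact Q.1.map_zero

end

section

/-! ### Generalized functions as functionals -/

open TopologicalSpace (Compacts)

variable {n : ℕ}

theorem integrable_smooth_mul_test (g : Smooth n) (f : Test n) :
    Integrable fun x => (g : Rn n → ℂ) x * f x :=
  ((Smooth.contDiff g).continuous.mul f.contDiff.continuous).integrable_of_hasCompactSupport
    (f.hasCompactSupport.mul_left (f := (g : Rn n → ℂ)))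

theorem norm_integral_smooth_mul_test_le (g : Smooth n) {f : Test n} {K : Compacts (Rn n)}
    (hf : tsupport f ⊆ (K : Set (Rn n))) (i j : ℕ) :
    ‖∫ x, (g : Rn n → ℂ) x * f x‖ ≤ volume.real (K : Set (Rn n)) * smoothSeminorm n (K, i) g *
      smoothSeminorm n (K, j) f.toSmooth := by
  have h0 : ∀ x ∉ (K : Set (Rn n)), (g : Rn n → ℂ) x * f x = 0 := fun x hx => by
    rw [image_eq_zero_of_notMem_tsupport fun h => hx (hf h), mul_zero]
  rw [← setIntegral_eq_integral_of_forall_compl_eq_zero h0]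
  refine (norm_setIntegral_le_of_norm_le_const K.isCompact.measure_lt_top
    (C := smoothSeminorm n (K, i) g * smoothSeminorm n (K, j) f.toSmooth) fun x hx => ?_).trans
    (le_of_eq (by ring))
  have h1 := norm_iteratedFDeriv_le_smoothSeminorm hx (Nat.zero_le i) g
  have h2 := norm_iteratedFDeriv_le_smoothSeminorm hx (Nat.zero_le j) f.toSmooth
  rw [norm_iteratedFDeriv_zero] at h1 h2
  rw [norm_mul]
  exact mul_le_mul h1 h2 (norm_nonneg _) (apply_nonneg _ _)

/-- The functional `f ↦ ∫ g f` on test functions. -/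
def integralTest (g : Smooth n) : Test n →ₗ[ℂ] ℂ where
  toFun f := ∫ x, (g : Rn n → ℂ) x * f x
  map_add' f f' := by
    rw [← integral_add (integrable_smooth_mul_test g f) (integrable_smooth_mul_test g f')]
    exact integral_congr_ae (Eventually.of_forall fun x => mul_add _ _ _)
  map_smul' c f := by
    rw [RingHom.id_apply, ← integral_smul]
    exact integral_congr_ae (Eventually.of_forall fun x => mul_left_comm _ c _)

/-- The functional `f ↦ ∫ g f` on smooth functions. -/
def integralSmooth (g : Test n) : Smooth n →ₗ[ℂ] ℂ where
  toFun f := ∫ x, g x * (f : Rn n → ℂ) x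
  map_add' f f' := by
    have h : ∀ f : Smooth n, Integrable fun x => g x * (f : Rn n → ℂ) x := fun f =>
      (integrable_smooth_mul_test f g).congr (Eventually.of_forall fun x => mul_comm _ _)
    rw [← integral_add (h f) (h f')]
    exact integral_congr_ae (Eventually.of_forall fun x => mul_add _ _ _)
  map_smul' c f := by
    rw [RingHom.id_apply, ← integral_smul]
    exact integral_congr_ae (Eventually.of_forall fun x => mul_left_comm _ c _)

theorem integralSmooth_eq (g : Test n) (f : Smooth n) : integralSmooth g f = integralTest f g :=
  integral_congr_ae (Eventually.of_forall fun _ => mul_comm _ _)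

theorem Gc.exists_isIntegralFunctional (w : G n) :
    ∃ S : Gc n →L[CTilde] CTilde, Gc.IsIntegralFunctional w S := by
  obtain ⟨g, hg⟩ := GE.exists_representative w
  obtain ⟨S, hS⟩ := Gc.exists_functional (fun ε => integralTest (g ε)) fun K => by
    obtain ⟨N, C, hC, h⟩ := (moderateNet_iff fun _ => apply_nonneg _ _).1 (hg.1 (K, 0))
    refine ⟨0, N, volume.real (K : Set (Rn n)) * C, h.mono fun ε h f hf => ?_⟩
    refine (norm_integral_smooth_mul_test_le (g ε) hf 0 0).trans ?_
    rw [mul_assoc (volume.real (K : Set (Rn n))) C]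
    gcongr
  refine ⟨S, fun v g' f hg' hf => (CTilde.represents_iff_of_represents (hS v f hf)).2 ?_⟩
  obtain ⟨R, -, hR, -⟩ := hf.exists_cut_eq
  refine ((hf.2.1 (closedBallC n R, 0)).mul_negligible ((hg.negligible_sub hg'
    (closedBallC n R, 0)).const_mul (volume.real (closedBallC n R : Set (Rn n))))).mono fun ε => ?_
  rw [abs_norm]
  have h1 : integralTest (g ε) (f ε) - (∫ x, (g' ε : Rn n → ℂ) x * f ε x) =
      ∫ x, ((g ε - g' ε : Smooth n) : Rn n → ℂ) x * f ε x := by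
    refine (integral_sub (integrable_smooth_mul_test (g ε) (f ε))
      (integrable_smooth_mul_test (g' ε) (f ε))).symm.trans ?_
    exact integral_congr_ae (Eventually.of_forall fun x => (sub_mul _ _ _).symm)
  rw [h1]
  refine (norm_integral_smooth_mul_test_le _ (hR ε) 0 0).trans (le_of_eq (mul_comm _ _))

theorem G.exists_isIntegralFunctional (w : Gc n) :
    ∃ S : G n →L[CTilde] CTilde, G.IsIntegralFunctional w S := by
  obtain ⟨g, hg⟩ : ∃ g : Eps → Test n, RepresentsCompact g (Gc.toG w) := w.2
  obtain ⟨R, -, hR, -⟩ := hg.exists_cut_eq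
  obtain ⟨N, C, hC, h⟩ := (moderateNet_iff fun _ => apply_nonneg _ _).1
    (hg.2.1 (closedBallC n R, 0))
  obtain ⟨S, hS⟩ := GE.exists_functional (p := smoothSeminorm n) (fun ε => integralSmooth (g ε))
    (closedBallC n R, 0) N (volume.real (closedBallC n R : Set (Rn n)) * C)
    (h.mono fun ε h f => by
      rw [integralSmooth_eq]
      refine (norm_integral_smooth_mul_test_le f (hR ε) 0 0).trans ?_
      rw [mul_right_comm, mul_assoc (volume.real (closedBallC n R : Set (Rn n))) C]
      gcongr)
  refine ⟨S, fun v g' f hg' hf => (CTilde.represents_iff_of_represents (hS v f hf)).2 ?_⟩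
  obtain ⟨R', -, hR', -⟩ := hg'.exists_cut_eq
  set K := closedBallC n R ⊔ closedBallC n R' with hK
  refine (((hf.1 (K, 0)).const_mul (volume.real (K : Set (Rn n)))).mul_negligible
    (hg.2.negligible_sub hg'.2 (K, 0))).mono fun ε => ?_
  rw [abs_norm]
  have h1 : integralSmooth (g ε) (f ε) - (∫ x, g' ε x * (f ε : Rn n → ℂ) x) =
      integralTest (f ε) (g ε - g' ε) := by
    rw [map_sub, ← integralSmooth_eq, ← integralSmooth_eq]
    rfl
  rw [h1]
  refine norm_integral_smooth_mul_test_le _ (f := g ε - g' ε) ?_ 0 0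
  rw [hK, TopologicalSpace.Compacts.coe_sup]
  exact (tsupport_sub (g ε) (g' ε)).trans (Set.union_subset_union (hR ε) (hR' ε))

/-- A function of polynomial growth defines a functional on `𝓢(ℝⁿ)`. -/
theorem exists_norm_integral_mul_schwartz_le (n N : ℕ) : ∃ (h : ℕ) (D : ℝ), 0 ≤ D ∧
    ∀ (g : Rn n → ℂ) (A : ℝ), Continuous g → (∀ x, ‖g x‖ ≤ A * (1 + ‖x‖) ^ N) →
      ∀ f : 𝓢(Rn n, ℂ), (Integrable fun x => g x * f x) ∧
        ‖∫ x, g x * f x‖ ≤ A * D * schwartzSup n h f := by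
  have hint : Integrable fun x : Rn n => ((1 + ‖x‖) ^ (n + 1))⁻¹ := by
    have h := integrable_one_add_norm (E := Rn n) (μ := volume) (r := (n + 1 : ℕ))
      (by simp)
    refine h.congr (Eventually.of_forall fun x => ?_)
    change (1 + ‖x‖) ^ (-((n + 1 : ℕ) : ℝ)) = ((1 + ‖x‖) ^ (n + 1))⁻¹
    rw [Real.rpow_neg (by positivity), Real.rpow_natCast]
  refine ⟨N + (n + 1), 2 ^ (N + (n + 1)) * ∫ x : Rn n, ((1 + ‖x‖) ^ (n + 1))⁻¹,
    mul_nonneg (by positivity) (integral_nonneg fun x => by positivity), fun g A hg hA f => ?_⟩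
  have hb : ∀ x, ‖g x * f x‖ ≤ A * (2 ^ (N + (n + 1)) * schwartzSup n (N + (n + 1)) f) *
      ((1 + ‖x‖) ^ (n + 1))⁻¹ := fun x => by
    have hA0 : 0 ≤ A := by
      have := (norm_nonneg _).trans (hA 0)
      simpa using this
    have h1 := one_add_pow_le_schwartzSup (le_refl (N + (n + 1))) (Nat.zero_le _) f x
    rw [norm_iteratedFDeriv_zero] at h1
    rw [norm_mul, ← div_eq_mul_inv, le_div_iff₀ (by positivity)]
    calc ‖g x‖ * ‖f x‖ * (1 + ‖x‖) ^ (n + 1)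
        ≤ A * (1 + ‖x‖) ^ N * ‖f x‖ * (1 + ‖x‖) ^ (n + 1) := by
          gcongr
          exact hA x
      _ = A * ((1 + ‖x‖) ^ (N + (n + 1)) * ‖f x‖) := by
          rw [pow_add]
          ring
      _ ≤ _ := by gcongr
  refine ⟨(hint.const_mul _).mono' (hg.mul f.continuous).aestronglyMeasurable
    (Eventually.of_forall hb), ?_⟩
  refine (norm_integral_le_of_norm_le (hint.const_mul _) (Eventually.of_forall hb)).trans
    (le_of_eq ?_)
  rw [integral_const_mul]
  ring

theorem GS.exists_isIntegralFunctional (w : GTau n) :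
    ∃ S : GS n →L[CTilde] CTilde, GS.IsIntegralFunctional w S := by
  obtain ⟨g, hg⟩ : ∃ g, GTau.Represents g w := by
    obtain ⟨g, rfl⟩ := QuotientAddGroup.mk_surjective (s := negligibleTau n) w
    exact ⟨g, g.2, rfl⟩
  have hint : ∀ g ∈ moderateTau n, ∀ ε (f : 𝓢(Rn n, ℂ)), Integrable fun x => g ε x * f x := by
    intro g hg ε f
    obtain ⟨N, C, hN⟩ := (hg.1 ε).2 0
    simp only [norm_iteratedFDeriv_zero] at hN
    obtain ⟨h, D, -, hD⟩ := exists_norm_integral_mul_schwartz_le n N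
    exact (hD (g ε) C (hg.1 ε).1.continuous hN f).1
  let L : Eps → 𝓢(Rn n, ℂ) →ₗ[ℂ] ℂ := fun ε =>
    { toFun := fun f => ∫ x, g ε x * f x
      map_add' := fun f f' => by
        rw [← integral_add (hint g hg.1 ε f) (hint g hg.1 ε f')]
        exact integral_congr_ae (Eventually.of_forall fun x => mul_add _ _ _)
      map_smul' := fun c f => by
        rw [RingHom.id_apply, ← integral_smul]
        exact integral_congr_ae (Eventually.of_forall fun x => mul_left_comm _ c _) }
  obtain ⟨N, C, hN⟩ := hg.1.2 0
  simp only [norm_iteratedFDeriv_zero] at hN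
  obtain ⟨h, D, hD0, hD⟩ := exists_norm_integral_mul_schwartz_le n N
  obtain ⟨S, hS⟩ := GE.exists_functional (p := schwartzSup n) L h N (C * D)
    (hN.mono fun ε hN f => by
      refine (hD (g ε) (C * ((ε : ℝ) ^ N)⁻¹) (hg.1.1 ε).1.continuous
        (fun x => (hN x).trans (le_of_eq (by ring))) f).2.trans (le_of_eq (by ring)))
  refine ⟨S, fun v g' f hg' hf => (CTilde.represents_iff_of_represents (hS v f hf)).2 ?_⟩
  obtain ⟨hgm, hgw⟩ := hg
  obtain ⟨hgm', hgw'⟩ := hg'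
  have hneg : (⟨g, hgm⟩ - ⟨g', hgm'⟩ : moderateTau n) ∈ negligibleTau n := by
    have := QuotientAddGroup.eq.1 (hgw'.trans hgw.symm)
    rwa [neg_add_eq_sub] at this
  obtain ⟨M, hM⟩ := hneg 0
  simp only [norm_iteratedFDeriv_zero] at hM
  obtain ⟨k, E, hE0, hE⟩ := exists_norm_integral_mul_schwartz_le n M
  obtain ⟨P, B, hB, hfb⟩ := (moderateNet_iff fun _ => apply_nonneg _ _).1 (hf.1 k)
  refine (negligibleNet_iff fun _ => norm_nonneg _).2 fun q => ?_
  obtain ⟨A, hA⟩ := hM (P + q)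
  refine ⟨|A| * E * B, by positivity, ?_⟩
  filter_upwards [hA, hfb] with ε hA hfb
  have h0 := eps_pos ε
  have h1 : L ε (f ε) - (∫ x, g' ε x * f ε x) = ∫ x, (g ε x - g' ε x) * f ε x := by
    refine (integral_sub (hint g hgm ε (f ε)) (hint g' hgm' ε (f ε))).symm.trans ?_
    exact integral_congr_ae (Eventually.of_forall fun x => (sub_mul _ _ _).symm)
  rw [h1]
  refine (hE (fun x => g ε x - g' ε x) (|A| * (ε : ℝ) ^ (P + q))
    ((hgm.1 ε).1.continuous.sub (hgm'.1 ε).1.continuous) (fun x => ?_) (f ε)).2.trans ?_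
  · refine (hA x).trans ?_
    rw [mul_right_comm]
    gcongr
    exact le_abs_self A
  · calc |A| * (ε : ℝ) ^ (P + q) * E * schwartzSup n k (f ε)
        ≤ |A| * (ε : ℝ) ^ (P + q) * E * (B * ((ε : ℝ) ^ P)⁻¹) := by gcongr
      _ = |A| * E * B * (ε : ℝ) ^ q := by
          rw [pow_add]
          field_simp

end

section

/-! ### Regularization of basic functionals -/

open TopologicalSpace (Compacts)

variable {n : ℕ}

theorem toSmooth_mollifierNet_mem_moderate (ρ : Test n) (q : ℕ) :
    (fun ε => (mollifierNet ρ q ε).toSmooth) ∈ moderate (smoothSeminorm n) := by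
  simpa only [schwartzToSmooth_toSchwartz] using
    schwartzToSmooth_mem_moderate (mollifierNet_mem_moderate ρ q)

theorem exists_representsCompact_mollifierNet (ρ : Test n) (q : ℕ) :
    ∃ u : Gc n, RepresentsCompact (mollifierNet ρ q) (Gc.toG u) := by
  obtain ⟨R, -, hR⟩ := exists_norm_le_of_mem_tsupport ρ
  have h : RepresentsCompact (mollifierNet ρ q)
      (GE.mk ⟨_, toSmooth_mollifierNet_mem_moderate ρ q⟩) :=
    ⟨⟨_, (closedBallC n R).isCompact, fun ε y hy => mem_closedBallC.2
      (norm_le_of_mem_tsupport_mollifierNet hR q ε y hy)⟩, _, rfl⟩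
  exact ⟨⟨_, _, h⟩, h⟩

/-- A net bounded by `ε ^ (q - N)` times a seminorm has value at most `e ^ (N - q)` times the
corresponding ultra-pseudo-seminorm. -/
theorem absE_le_exp_neg_mul {E ι : Type} [AddCommGroup E] [Module ℂ E] {p : ι → Seminorm ℂ E}
    {a : Eps → ℂ} {z : CTilde} (ha : CTilde.Represents a z) {f : Eps → E} {x : GE p}
    (hf : GE.Represents f x) (i : ι) (q N : ℕ) (C : ℝ)
    (h : ∀ᶠ ε : Eps in toZero, ‖a ε‖ ≤ C * (ε : ℝ) ^ ((q : ℝ) - N) * p i (f ε)) :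
    absE z ≤ Real.exp N * Real.exp (-q) * GE.ups i x := by
  rw [ha.absE_eq, hf.ups_eq]
  have := expNegVal_le_exp_mul (f := fun ε => ‖a ε‖) ((q : ℝ) - N) C (hf.1 i)
    NegligibleNet.zero (h.mono fun ε h => by rwa [abs_norm, add_zero])
  rwa [neg_sub, sub_eq_add_neg, Real.exp_add] at this

/-- Convergence in the dual of `G_c(ℝⁿ)` follows from a rate of convergence `e ^ (-q)` on each
`G_K(ℝⁿ)`: weighting the differences by `e ^ q` gives one continuous ultra-pseudo-seminorm. -/
theorem Gc.tendsto_strongTopology (S : ℕ → Gc n →L[CTilde] CTilde) (T : Gc n →L[CTilde] CTilde)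
    (h : ∀ K : Compacts (Rn n), ∃ (i : ℕ) (C : ℝ), ∀ (q : ℕ) (u : Gc n),
      supp (Gc.toG u) ⊆ (K : Set (Rn n)) →
        absE (S q u - T u) ≤ C * Real.exp (-q) * GE.ups (nhd K, i) (Gc.toG u)) :
    Tendsto S atTop (@nhds _ (strongTopology Gc.ups) T) := by
  have h' : ∀ K : Compacts (Rn n), ∃ (i : ℕ) (C : ℝ), ∀ (u : Gc n),
      supp (Gc.toG u) ⊆ (K : Set (Rn n)) → ∀ q : ℕ,
        Real.exp q * absE (S q u - T u) ≤ C * GE.ups (nhd K, i) (Gc.toG u) := fun K => by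
    obtain ⟨i, C, hC⟩ := h K
    refine ⟨i, C, fun u hu q => ?_⟩
    calc Real.exp q * absE (S q u - T u)
        ≤ Real.exp q * (C * Real.exp (-q) * GE.ups (nhd K, i) (Gc.toG u)) :=
          mul_le_mul_of_nonneg_left (hC q u hu) (Real.exp_pos _).le
      _ = Real.exp q * Real.exp (-q) * (C * GE.ups (nhd K, i) (Gc.toG u)) := by ring
      _ = _ := by rw [← Real.exp_add, add_neg_cancel, Real.exp_zero, one_mul]
  have hbdd : ∀ u : Gc n, BddAbove (Set.range fun q : ℕ => Real.exp q * absE (S q u - T u)) :=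
    fun u => by
      obtain ⟨K, hK⟩ := exists_supp_subset u
      obtain ⟨i, C, hC⟩ := h' K
      exact ⟨_, Set.forall_mem_range.2 (hC u hK)⟩
  have hpos : ∀ (u : Gc n) (q : ℕ), 0 ≤ Real.exp q * absE (S q u - T u) := fun u q =>
    mul_nonneg (Real.exp_pos _).le (absE_nonneg _)
  let Q : GcSeminorms n := ⟨{
    toFun := fun u => ⨆ q : ℕ, Real.exp q * absE (S q u - T u)
    nonneg := fun u => Real.iSup_nonneg (hpos u)
    map_zero := by simp [absE_zero]
    smul_le := fun c u => by
      refine ciSup_le fun q => ?_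
      rw [map_smul, map_smul, ← smul_sub]
      calc Real.exp q * absE (c • (S q u - T u))
          ≤ Real.exp q * (absE c * absE (S q u - T u)) :=
            mul_le_mul_of_nonneg_left (absE_mul_le c _) (Real.exp_pos _).le
        _ = absE c * (Real.exp q * absE (S q u - T u)) := by ring
        _ ≤ _ := mul_le_mul_of_nonneg_left (le_ciSup (hbdd u) q) (absE_nonneg c)
    add_le := fun u v => by
      refine ciSup_le fun q => ?_
      rw [map_add, map_add, add_sub_add_comm]
      refine (mul_le_mul_of_nonneg_left (absE_add_le _ _) (Real.exp_pos _).le).trans ?_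
      rw [mul_max_of_nonneg _ _ (Real.exp_pos _).le]
      exact max_le_max (le_ciSup (hbdd u) q) (le_ciSup (hbdd v) q) }, fun K => by
    obtain ⟨i, C, hC⟩ := h' K
    exact ⟨i, C, fun u hu => ciSup_le (hC u hu)⟩⟩
  refine Colombeau.tendsto_strongTopology Gc.ups S T Q 1 (fun u => Q.1.nonneg u) fun q u => ?_
  have h1 : Real.exp q * absE (S q u - T u) ≤ Gc.ups Q u := le_ciSup (hbdd u) q
  rw [one_mul, Real.exp_neg, inv_mul_eq_div, le_div_iff₀ (Real.exp_pos _)]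
  rwa [mul_comm]

theorem Gc.exists_tendsto_convolution {ρ : Test n} (hρ : ∫ y, ρ y = 1)
    {T : Gc n →L[CTilde] CTilde} (hT : Gc.IsBasic T) :
    ∃ (u : ℕ → Gc n) (w : ℕ → G n) (S : ℕ → Gc n →L[CTilde] CTilde),
      (∀ q, RepresentsCompact (mollifierNet ρ q) (Gc.toG (u q)) ∧
        Gc.IsConv (u q) T (w q) ∧ Gc.IsIntegralFunctional (w q) (S q)) ∧
      Tendsto S atTop (@nhds _ (strongTopology Gc.ups) T) := by
  obtain ⟨T', hT'⟩ := hT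
  have hm : ModerateDistributionNet T' := hT'.1
  choose u hu using exists_representsCompact_mollifierNet ρ
  let w : ℕ → G n := fun q => GE.mk ⟨_, hm.conv_mem_moderate (hu q)⟩
  have hw : ∀ q, GE.Represents (hm.conv (mollifierNet ρ q)) (w q) := fun q => ⟨_, rfl⟩
  choose S hS using fun q => Gc.exists_isIntegralFunctional (w q)
  refine ⟨u, w, S, fun q => ⟨hu q, hT'.isConv hm (hu q) (hw q), hS q⟩,
    Gc.tendsto_strongTopology S T fun K => ?_⟩
  obtain ⟨r, hr0, hr⟩ := exists_norm_le_of_mem_tsupport ρ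
  obtain ⟨R, -, hR⟩ := exists_subset_closedBallC K.isCompact
  -- On this ball the convolution is a convolution with a net of tempered functionals.
  obtain ⟨h, N, C, hC, hbound⟩ :=
    (hm.temperedNet (|R| + 2 + r)).exists_norm_integral_sub_le hρ
  obtain ⟨D, hD, hDf⟩ := exists_schwartzSup_le (closedBallC n (|R| + 2)) h
  refine ⟨h, Real.exp N, fun q v hv => ?_⟩
  obtain ⟨⟨f, hf, hfR⟩, hups⟩ := exists_representative_of_supp_subset hR hv
  have hrep := (hS q v _ f (hw q) hf).sub (hT'.2 v f hf)
  refine (absE_le_exp_neg_mul hrep hf.2 (closedBallC n (|R| + 2), h) q N (C * D) ?_).trans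
    (mul_le_mul_of_nonneg_left (hups _ _) (by positivity))
  filter_upwards [hbound] with ε hbound
  have h0 := eps_pos ε
  have e1 : (∫ x, (hm.conv (mollifierNet ρ q) ε : Rn n → ℂ) x * f ε x) =
      ∫ x, cutNet T' (|R| + 2 + r) ε (schwartzReflect x (mollifierNet ρ q ε).toSchwartz) *
        (f ε).toSchwartz x := by
    refine integral_congr_ae (Eventually.of_forall fun x => ?_)
    by_cases hx : x ∈ tsupport (f ε)
    · have hmol : tsupport (mollifierNet ρ q ε) ⊆ (closedBallC n r : Set (Rn n)) := fun y hy =>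
        mem_closedBallC.2 (norm_le_of_mem_tsupport_mollifierNet hr q ε y hy)
      change T' ε ((mollifierNet ρ q ε).reflect x) * f ε x = _
      rw [← cutNet_schwartzReflect T' (R := |R| + 2 + r) (s := |R| + 2) ε hmol (by linarith)
        (mem_closedBallC.1 (hfR ε hx))]
      rfl
    · have h1 : f ε x = 0 := image_eq_zero_of_notMem_tsupport hx
      have h2 : (f ε).toSchwartz x = 0 := h1
      change _ * f ε x = _ * (f ε).toSchwartz x
      rw [h1, h2, mul_zero, mul_zero]
  have e2 : T' ε (f ε) = cutNet T' (|R| + 2 + r) ε (f ε).toSchwartz :=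
    (cutNet_toSchwartz T' ε ((hfR ε).trans fun x hx => mem_closedBallC.2
      ((mem_closedBallC.1 hx).trans (by linarith)))).symm
  rw [e1, e2]
  refine (hbound q (f ε).toSchwartz).trans ?_
  rw [mul_right_comm C D, mul_assoc (C * _) D]
  exact mul_le_mul_of_nonneg_left (hDf (f ε) (hfR ε)) (by positivity)

theorem G.exists_tendsto_convolution {ρ : Test n} (hρ : ∫ y, ρ y = 1)
    {T : G n →L[CTilde] CTilde} (hT : GE.IsBasic T) :
    ∃ (u : ℕ → G n) (w : ℕ → Gc n) (S : ℕ → G n →L[CTilde] CTilde),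
      (∀ q, GE.Represents (fun ε => (mollifierNet ρ q ε).toSmooth) (u q) ∧
        G.IsConv (u q) T (Gc.toG (w q)) ∧ G.IsIntegralFunctional (w q) (S q)) ∧
      Tendsto S atTop (@nhds _ (strongTopology GE.ups) T) := by
  obtain ⟨T', hT'⟩ := hT
  obtain ⟨r, j, M, η, hr0, hr⟩ := hT'.1.exists_eventually_norm_le
  obtain ⟨s, hs0, hs⟩ := exists_norm_le_of_mem_tsupport ρ
  set R := r + 1 + s with hRdef
  let m : ℕ → Eps → Smooth n := fun q ε => (mollifierNet ρ q ε).toSmooth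
  have hm : ∀ q, m q ∈ moderate (smoothSeminorm n) := toSmooth_mollifierNet_mem_moderate ρ
  let g : ℕ → Eps → Smooth n := fun q => hT'.1.conv (m q)
  have hgm : ∀ q, g q ∈ moderate (smoothSeminorm n) := fun q => hT'.1.conv_mem_moderate (hm q)
  -- The support of the convolution is contained in the sum of the supports.
  have hsupp : ∀ q, ∀ ε ≤ η, ∀ x, R < ‖x‖ → (g q ε : Rn n → ℂ) x = 0 := by
    intro q ε hε x hx
    have h1 : T' ε (Smooth.reflect x (m q ε)) = T' ε 0 := by
      refine map_eq_of_eqOn_ball (hr ε hε) fun y hy => ?_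
      refine image_eq_zero_of_notMem_tsupport (f := mollifierNet ρ q ε) fun hmem => ?_
      have h2 := norm_le_of_mem_tsupport_mollifierNet hs q ε _ hmem
      have h3 := norm_sub_norm_le x y
      linarith
    exact h1.trans (map_zero _)
  have hcut : ∀ q, ∀ ε ≤ η, (cut n R (g q ε)).toSmooth = g q ε := by
    intro q ε hε
    ext x
    change cut n R (g q ε) x = _
    rcases le_or_gt ‖x‖ R with hx | hx
    · exact cut_apply_of_norm_le (by linarith) _
    · rw [cut_apply, hsupp q ε hε x hx, mul_zero]
  choose w hw using fun q => representsCompact_cut (hgm q) R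
  have hgw : ∀ q, GE.Represents (g q) (Gc.toG (w q)) := fun q =>
    (hw q).2.congr (hgm q) fun i => NegligibleNet.zero.of_eventually_le
      ((eventually_le η).mono fun ε hε => by
        change |smoothSeminorm n i ((cut n R (g q ε)).toSmooth - g q ε)| ≤ 0
        rw [hcut q ε hε, sub_self, map_zero, abs_zero])
  choose S hS using fun q => G.exists_isIntegralFunctional (w q)
  have hu : ∀ q, GE.Represents (m q) (GE.mk ⟨m q, hm q⟩ : G n) := fun q => ⟨_, rfl⟩
  obtain ⟨h, N, C, hC, hbound⟩ :=
    hT'.1.temperedNet_restrictNet.exists_norm_integral_sub_le hρ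
  obtain ⟨D, hD, hDf⟩ := exists_schwartzSup_cut_le (n := n) R h
  refine ⟨fun q => GE.mk ⟨m q, hm q⟩, w, S, fun q => ⟨hu q, hT'.isConv (hu q) (hgw q), hS q⟩,
    Colombeau.tendsto_strongTopology GE.ups S T (closedBallC n (|R| + 2), h) (Real.exp N)
      (fun v => ?_) fun q v => ?_⟩
  · obtain ⟨f, hf⟩ := GE.exists_representative v
    rw [hf.ups_eq]
    exact expNegVal_nonneg _
  obtain ⟨f, hf⟩ := GE.exists_representative v
  have hrep := (hS q v _ f (hw q) hf).sub (hT'.2 v f hf)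
  refine absE_le_exp_neg_mul hrep hf _ q N (C * D) ?_
  filter_upwards [hbound, eventually_le η] with ε hbound hε
  have h0 := eps_pos ε
  have e1 : (∫ x, cut n R (g q ε) x * (f ε : Rn n → ℂ) x) =
      ∫ x, restrictNet T' ε (schwartzReflect x (mollifierNet ρ q ε).toSchwartz) *
        (cut n R (f ε)).toSchwartz x := by
    refine integral_congr_ae (Eventually.of_forall fun x => ?_)
    have e3 : restrictNet T' ε (schwartzReflect x (mollifierNet ρ q ε).toSchwartz) =
        (g q ε : Rn n → ℂ) x := by
      rw [restrictNet_apply]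
      refine congrArg (T' ε) ?_
      ext y
      rw [schwartzToSmooth_apply, schwartzReflect_apply]
      rfl
    change cut n R (g q ε) x * (f ε : Rn n → ℂ) x = _ * cut n R (f ε) x
    rw [e3, cut_apply, cut_apply]
    ring
  have e2 : T' ε (f ε) = restrictNet T' ε (cut n R (f ε)).toSchwartz :=
    (restrictNet_cut (hr ε hε) (by linarith) (f ε)).symm
  rw [e1, e2]
  refine (hbound q (cut n R (f ε)).toSchwartz).trans ?_
  rw [mul_right_comm C D, mul_assoc (C * _) D]
  exact mul_le_mul_of_nonneg_left (hDf (f ε)) (by positivity)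

theorem GS.exists_tendsto_convolution {ρ : Test n} (hρ : ∫ y, ρ y = 1)
    {T : GS n →L[CTilde] CTilde} (hT : GE.IsBasic T) :
    ∃ (u : ℕ → GS n) (w : ℕ → GTau n) (S : ℕ → GS n →L[CTilde] CTilde),
      (∀ q, GE.Represents (fun ε => (mollifierNet ρ q ε).toSchwartz) (u q) ∧
        GS.IsConv (u q) T (w q) ∧ GS.IsIntegralFunctional (w q) (S q)) ∧
      Tendsto S atTop (@nhds _ (strongTopology GE.ups) T) := by
  obtain ⟨T', hT'⟩ := hT
  have ht := hT'.1.temperedNet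
  have hm := mollifierNet_mem_moderate ρ
  have hu : ∀ q, GE.Represents (fun ε => (mollifierNet ρ q ε).toSchwartz)
      (GE.mk ⟨_, hm q⟩ : GS n) := fun q => ⟨_, rfl⟩
  let w : ℕ → GTau n := fun q =>
    (QuotientAddGroup.mk ⟨_, ht.mem_moderateTau (hm q)⟩ : moderateTau n ⧸ negligibleTau n)
  have hw : ∀ q, GTau.Represents
      (fun ε x => T' ε (schwartzReflect x (mollifierNet ρ q ε).toSchwartz)) (w q) :=
    fun q => ⟨_, rfl⟩
  choose S hS using fun q => GS.exists_isIntegralFunctional (w q)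
  obtain ⟨h, N, C, hC, hbound⟩ := ht.exists_norm_integral_sub_le hρ
  refine ⟨_, w, S, fun q => ⟨hu q, hT'.isConv_schwartz (hu q) (hw q), hS q⟩,
    Colombeau.tendsto_strongTopology GE.ups S T h (Real.exp N) (fun v => ?_) fun q v => ?_⟩
  · obtain ⟨f, hf⟩ := GE.exists_representative v
    rw [hf.ups_eq]
    exact expNegVal_nonneg _
  obtain ⟨f, hf⟩ := GE.exists_representative v
  exact absE_le_exp_neg_mul ((hS q v _ f (hw q) hf).sub (hT'.2 v f hf)) hf h q N C
    (hbound.mono fun ε hb => hb q (f ε))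

end

end Colombeau

end

theorem mainTheorem11 (n : ℕ) (ρ : Test n) (hρ : ∫ y, ρ y = 1) :
    (∀ T : Gc n →L[CTilde] CTilde, Gc.IsBasic T →
      ∃ (u : ℕ → Gc n) (w : ℕ → G n) (S : ℕ → Gc n →L[CTilde] CTilde),
        (∀ q, RepresentsCompact (mollifierNet ρ q) (Gc.toG (u q)) ∧
          Gc.IsConv (u q) T (w q) ∧ Gc.IsIntegralFunctional (w q) (S q)) ∧
        Tendsto S atTop (@nhds _ (strongTopology Gc.ups) T)) ∧
    (∀ T : G n →L[CTilde] CTilde, GE.IsBasic T →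
      ∃ (u : ℕ → G n) (w : ℕ → Gc n) (S : ℕ → G n →L[CTilde] CTilde),
        (∀ q, GE.Represents (fun ε => (mollifierNet ρ q ε).toSmooth) (u q) ∧
          G.IsConv (u q) T (Gc.toG (w q)) ∧ G.IsIntegralFunctional (w q) (S q)) ∧
        Tendsto S atTop (@nhds _ (strongTopology GE.ups) T)) ∧
    (∀ T : GS n →L[CTilde] CTilde, GE.IsBasic T →
      ∃ (u : ℕ → GS n) (w : ℕ → GTau n) (S : ℕ → GS n →L[CTilde] CTilde),
        (∀ q, GE.Represents (fun ε => (mollifierNet ρ q ε).toSchwartz) (u q) ∧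
          GS.IsConv (u q) T (w q) ∧ GS.IsIntegralFunctional (w q) (S q)) ∧
        Tendsto S atTop (@nhds _ (strongTopology GE.ups) T)) := by
  exact ⟨fun _ hT => Gc.exists_tendsto_convolution hρ hT, fun _ hT =>
    G.exists_tendsto_convolution hρ hT, fun _ hT => GS.exists_tendsto_convolution hρ hT⟩
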